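/- **Setting.** Let $L>0$, $\mu>0$, and for small $\gamma>0$ put $$L_\gamma=\tfrac{2}{\gamma}\Big(\sqrt{1+\tfrac{\gamma L}{2}}-\sqrt{1-\tfrac{\gamma L}{2}}\Big),\qquad \delta(x)=-\frac{3L_\gamma}{4L}\,\frac{\gamma}{\sqrt{1+\frac{\gamma L}{2}}-\frac{\gamma L_\gamma x}{2L}},\qquad \Lambda=\begin{pmatrix}1&0\\0&-1\end{pmatrix},\quad J=\begin{pmatrix}0&\frac13\\-\frac13&0\end{pmatrix}.$$ On $L^2=L^2((0,L);\mathbb C^2)$ use $\langle f,g\rangle=\int_0^L (f_1\overline{g_1}+f_2\overline{g_2})\,dx$. Let $\mathcal A=\Lambda\partial_x+\delta J$ with domain $D(\mathcal A)=\{f\in H^1((0,L);\mathbb C^2): f_1(0)+f_2(0)=0,\ f_1(L)+f_2(L)=0\}$, and $\widetilde{\mathcal A}=\Lambda\partial_x+\delta J$ with domain $D(\widetilde{\mathcal A})=\{f\in H^1((0,L);\mathbb C^2): f_1(0)+e^{-2\mu L}f_2(0)=0,\ f_1(L)+f_2(L)=0\}$, both domains carrying the $H^1$ norm; $D(\widetilde{\mathcal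 A}^2)=\{\beta\in D(\widetilde{\mathcal A}):\widetilde{\mathcal A}\beta\in D(\widetilde{\mathcal A})\}$. Let $(f_n)_{n\in\mathbb Z}$ be an orthonormal basis of $L^2$ of eigenfunctions of $\mathcal A$, with eigenvalues $\mu_n=\frac{i\pi n}{L}+O(\frac1n)$, indexed and normalized so that $\mu_{-n}=\overline{\mu_n}=-\mu_n$, $f_{-n}=\overline{f_n}=(-f_{n,2},-f_{n,1})$ and $f_{0,1}(0)>0$. Let $(\widetilde f_p)_{p\in\mathbb Z}$ be a Riesz basis of $L^2$ of eigenfunctions of $\widetilde{\mathcal A}$, with eigenvalues $\widetilde\mu_p=\mu+\frac{i\pi p}{L}+O(\frac1p)$, $\widetilde\mu_{-p}=\overline{\widetilde\mu_p}$, $\widetilde f_{-p}=\overline{\widetilde f_p}$, and let $(\widetilde\phi_p)$ be its biorthonormal family, with $\widetilde\phi_{-p}=\overline{\widetilde\phi_p}$. For $\nu>0$ put $\mathcal I_\nu=\exp\big(\int_0^x\delta\big)(1,1)^T+\nu f_0$, and let $F$ be the linear form with $$\langle f_n,F\rangle=-2\tanh(\mu L)\,\frac{(f_{n,1}(0))^2}{\langle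 \mathcal I_\nu,f_n\rangle},\qquad \langle\alpha,F\rangle=\lim_{N\to\infty}\sum_{|n|\le N}\langle\alpha,f_n\rangle\langle f_n,F\rangle$$ whenever the limit exists. Let $D_F$ be the set of $\alpha\in D(\mathcal A)$ for which $\langle\alpha,F\rangle$ is defined and $-\mathcal A\alpha+\langle\alpha,F\rangle\mathcal I_\nu\in D(\mathcal A)$; on it, $(-\mathcal A+\mathcal I_\nu F)\alpha:=-\mathcal A\alpha+\langle\alpha,F\rangle\mathcal I_\nu$. **Proposition.** For every $L>0$ and $\mu>0$ there is $\gamma_0>0$ such that for every $\gamma\in(0,\gamma_0)$ such families $(f_n,\mu_n)$ and $(\widetilde f_p,\widetilde\phi_p,\widetilde\mu_p)$ exist, and for all such families and every $\nu>0$ the following holds. 1. The formula $$T\alpha=\sum_{n\in\mathbb Z}\langle\alpha,f_n\rangle g_n,\qquad g_n=-\langle f_n,F\rangle\sum_{p\in\mathbb Z}\frac{\langle\mathcal I_\nu,\widetilde\phi_p\rangle}{\widetilde\mu_p-\mu_n}\,\widetilde f_p$$ (both series converging in $D(\widetilde{\mathcal A})$) defines an isomorphism $T:D(\mathcal A)\to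 D(\widetilde{\mathcal A})$, and $-\widetilde{\mathcal A}$ with domain $D(\widetilde{\mathcal A}^2)$ generates a $C^0$-semigroup $\widetilde S(t)$ on $D(\widetilde{\mathcal A})$. 2. $S(t)=T^{-1}\widetilde S(t)T$, $t\ge0$, is a $C^0$-semigroup on $D(\mathcal A)$, exponentially stable with decay rate $\frac{3\mu}{4}$: $\|S(t)\alpha\|\le Ce^{-\frac{3\mu}{4}t}\|\alpha\|$ for some constant $C$. Its infinitesimal generator is exactly the operator $(-\mathcal A+\mathcal I_\nu F, D_F)$. 3. $D_F=T^{-1}D(\widetilde{\mathcal A}^2)$. 4. The functions $h_p=T^{-1}(\widetilde f_p/\widetilde\mu_p)$, $p\in\mathbb Z$, form a Riesz basis of $D(\mathcal A)$, belong to $D_F$, and $(-\mathcal A+\mathcal I_\nu F)h_p=-\widetilde\mu_p h_p$. 5. If $\alpha\in D(\mathcal A)$ is real-valued, then $S(t)\alpha$ is real-valued for all $t\ge0$. -/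

import Mathlib

open MeasureTheory Filter Topology Set
open scoped NNReal ComplexConjugate

noncomputable section

namespace WaterTank

/-! ### Function spaces on `(0, L)` -/

/-- Values of the two-component functions. -/
abbrev Val : Type := EuclideanSpace ℂ (Fin 2)

/-- Lebesgue measure on `(0, L)`. -/
abbrev mes (L : ℝ) : Measure ℝ := volume.restrict (Ioo 0 L)

/-- `L²((0,L); ℂ²)`, with the scalar product `∫₀ᴸ (f₁ ḡ₁ + f₂ ḡ₂)`. -/
abbrev State (L : ℝ) : Type := Lp Val 2 (mes L)

/-- Pairs `(f, g)` of `L²` functions, with norm `(‖f‖² + ‖g‖²)^{1/2}`; a function `f` of class `H¹`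
is represented by the pair `(f, f')`, and the norm is then the `H¹` norm of `f`. -/
abbrev Pairs (L : ℝ) : Type := WithLp 2 (State L × State L)

/-- The first component of the pair is (a.e.) the primitive, with value `c` at `0`, of the second
component: thus it belongs to `H¹`, has derivative `p.snd`, and its continuous representative
takes the value `c` at `0`. -/
def IsPrimitive (L : ℝ) (p : Pairs L) (c : Val) : Prop :=
  ∀ᵐ x ∂(mes L), p.fst x = c + ∫ t in (0 : ℝ)..x, p.snd t ∂(mes L)

/-- The value at `L` of the continuous representative whose value at `0` is `c`. -/
def endValue (L : ℝ) (p : Pairs L) (c : Val) : Val :=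
  c + ∫ t in (0 : ℝ)..L, p.snd t ∂(mes L)

lemma intervalIntegrable_state {L : ℝ} (g : State L) (a b : ℝ) :
    IntervalIntegrable (fun t => g t) (mes L) a b :=
  ((Lp.memLp g).integrable (by norm_num)).intervalIntegrable

lemma integral_add_state {L : ℝ} (g h : State L) (x : ℝ) :
    ∫ t in (0 : ℝ)..x, (g + h : State L) t ∂(mes L)
      = (∫ t in (0 : ℝ)..x, g t ∂(mes L)) + ∫ t in (0 : ℝ)..x, h t ∂(mes L) := by
  rw [← intervalIntegral.integral_add (intervalIntegrable_state g 0 x)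
    (intervalIntegrable_state h 0 x)]
  apply intervalIntegral.integral_congr_ae
  filter_upwards [Lp.coeFn_add g h] with t ht _
  simpa using ht

lemma integral_smul_state {L : ℝ} (a : ℂ) (g : State L) (x : ℝ) :
    ∫ t in (0 : ℝ)..x, (a • g : State L) t ∂(mes L) = a • ∫ t in (0 : ℝ)..x, g t ∂(mes L) := by
  rw [← intervalIntegral.integral_smul]
  apply intervalIntegral.integral_congr_ae
  filter_upwards [Lp.coeFn_smul a g] with t ht _
  simpa using ht

lemma integral_zero_state {L : ℝ} (x : ℝ) :
    ∫ t in (0 : ℝ)..x, (0 : State L) t ∂(mes L) = 0 := by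
  have h := integral_smul_state (L := L) 0 0 x
  simpa using h

/-- The `H¹` functions `f` on `(0, L)` with `f₁(0) + κ f₂(0) = 0` and `f₁(L) + f₂(L) = 0`,
with the `H¹` norm. -/
def Dom (L κ : ℝ) : Submodule ℂ (Pairs L) where
  carrier := {p | ∃ c : Val, IsPrimitive L p c ∧ c 0 + (κ : ℂ) * c 1 = 0 ∧
    endValue L p c 0 + endValue L p c 1 = 0}
  zero_mem' := by
    refine ⟨0, ?_, by simp, ?_⟩
    · filter_upwards [Lp.coeFn_zero Val 2 (mes L)] with x hx
      simp only [WithLp.zero_fst, WithLp.zero_snd, hx, integral_zero_state]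
      simp
    · simp only [endValue, WithLp.zero_snd, integral_zero_state]
      simp
  add_mem' := by
    rintro p q ⟨c, hc, h0, hL⟩ ⟨d, hd, k0, kL⟩
    refine ⟨c + d, ?_, ?_, ?_⟩
    · filter_upwards [hc, hd, Lp.coeFn_add p.fst q.fst] with x h1 h2 h3
      rw [WithLp.add_fst, WithLp.add_snd, integral_add_state, h3, Pi.add_apply, h1, h2]
      abel
    · simp only [PiLp.add_apply]
      linear_combination h0 + k0
    · simp only [endValue, WithLp.add_snd, integral_add_state, PiLp.add_apply] at hL kL ⊢
      linear_combination hL + kL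
  smul_mem' := by
    rintro a p ⟨c, hc, h0, hL⟩
    refine ⟨a • c, ?_, ?_, ?_⟩
    · filter_upwards [hc, Lp.coeFn_smul a p.fst] with x h1 h3
      rw [WithLp.smul_fst, WithLp.smul_snd, integral_smul_state, h3, Pi.smul_apply, h1, smul_add]
    · simp only [PiLp.smul_apply, smul_eq_mul]
      linear_combination a * h0
    · simp only [endValue, WithLp.smul_snd, integral_smul_state, PiLp.add_apply, PiLp.smul_apply,
        smul_eq_mul] at hL ⊢
      linear_combination a * hL

/-- The function underlying an element of `Dom L κ`, as an element of `L²`. -/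
def toL2 {L κ : ℝ} (α : Dom L κ) : State L := (α : Pairs L).fst

/-- The derivative of an element of `Dom L κ`, as an element of `L²`. -/
def der {L κ : ℝ} (α : Dom L κ) : State L := (α : Pairs L).snd

/-- The value at `0` of (the continuous representative of) an element of `Dom L κ`. -/
def valZero {L κ : ℝ} (α : Dom L κ) : Val := Classical.choose α.2

/-- Real-valued almost everywhere. -/
def IsRealValued {L : ℝ} (u : State L) : Prop := ∀ᵐ x ∂(mes L), ∀ i, (u x i).im = 0

/-- The scalar product `∫₀ᴸ (f₁ ḡ₁ + f₂ ḡ₂)`, linear in the first argument. -/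
def pairing (L : ℝ) (f g : ℝ → Val) : ℂ :=
  ∫ x, (f x 0 * conj (g x 0) + f x 1 * conj (g x 1)) ∂(mes L)

/-! ### The operators -/

/-- `L_γ = (2/γ) (√(1 + γL/2) - √(1 - γL/2))`. -/
def lenGamma (L γ : ℝ) : ℝ := 2 / γ * (√(1 + γ * L / 2) - √(1 - γ * L / 2))

/-- The coupling coefficient `δ`. -/
def delta (L γ x : ℝ) : ℝ :=
  -(3 * lenGamma L γ / (4 * L)) * (γ / (√(1 + γ * L / 2) - γ * lenGamma L γ * x / (2 * L)))

/-- `Λ ∂ₓ α + δ J α` with `Λ = diag(1, -1)`, `J = [[0, 1/3], [-1/3, 0]]`. This is the operator `𝒜` on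
`D(𝒜) = Dom L 1`, and the operator `𝒜̃` on `D(𝒜̃) = Dom L (e^{-2μL})`. -/
def opA (L γ : ℝ) {κ : ℝ} (α : Dom L κ) : ℝ → Val := fun x =>
  !₂[der α x 0 + (delta L γ x : ℂ) / 3 * toL2 α x 1,
    -der α x 1 - (delta L γ x : ℂ) / 3 * toL2 α x 0]

/-- `D(𝒜)`. -/
abbrev DomA (L : ℝ) : Type := Dom L 1

/-- `D(𝒜̃)`. -/
abbrev DomT (L μ : ℝ) : Type := Dom L (Real.exp (-2 * μ * L))

/-- `D(𝒜̃²) = {β ∈ D(𝒜̃) : 𝒜̃ β ∈ D(𝒜̃)}`. -/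
def DomT2 (L γ μ : ℝ) : Set (DomT L μ) :=
  {β | ∃ β' : DomT L μ, ∀ᵐ x ∂(mes L), toL2 β' x = opA L γ β x}

/-- The graph of `-𝒜̃`, as an operator in `D(𝒜̃)` with domain `D(𝒜̃²)`. -/
def targetGraph (L γ μ : ℝ) : Set (DomT L μ × DomT L μ) :=
  {q | ∀ᵐ x ∂(mes L), toL2 q.2 x = -opA L γ q.1 x}

/-! ### Riesz bases and families of eigenfunctions -/

/-- A Riesz basis: the image of the canonical orthonormal basis of `ℓ²(ℤ)` under an isomorphism. -/
def IsRieszBasis {V : Type*} [NormedAddCommGroup V] [NormedSpace ℂ V] (v : ℤ → V) : Prop :=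
  ∃ Φ : lp (fun _ : ℤ => ℂ) 2 ≃L[ℂ] V, ∀ n, Φ (lp.single 2 n (1 : ℂ)) = v n

/-- An orthonormal basis `(f_n)` of `L²` made of eigenfunctions of `𝒜`, with eigenvalues `μ_n`,
indexed and normalized in the usual way. -/
structure OpenLoopFamily (L γ : ℝ) where
  f : ℤ → DomA L
  ev : ℤ → ℂ
  eigen : ∀ n, ∀ᵐ x ∂(mes L), opA L γ (f n) x = ev n • toL2 (f n) x
  orthonormal : Orthonormal ℂ (fun n => toL2 (f n))
  complete : (Submodule.span ℂ (range fun n => toL2 (f n))).topologicalClosure = ⊤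
  ev_asymp : ∃ C : ℝ, ∀ n : ℤ, n ≠ 0 → ‖ev n - Complex.I * Real.pi * n / L‖ ≤ C / |(n : ℝ)|
  ev_conj : ∀ n, ev (-n) = conj (ev n)
  ev_neg : ∀ n, ev (-n) = -ev n
  f_conj : ∀ n, ∀ᵐ x ∂(mes L), ∀ i, toL2 (f (-n)) x i = conj (toL2 (f n) x i)
  f_swap : ∀ n, ∀ᵐ x ∂(mes L), toL2 (f (-n)) x 0 = -toL2 (f n) x 1 ∧
    toL2 (f (-n)) x 1 = -toL2 (f n) x 0
  f_zero_pos : 0 < ((valZero (f 0)) 0).re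

/-- A Riesz basis `(f̃_n)` of `L²` made of eigenfunctions of `𝒜̃`, with eigenvalues `μ̃_n`, and its
biorthonormal family `(φ̃_n)`. -/
structure TargetFamily (L γ μ : ℝ) where
  f : ℤ → DomT L μ
  φ : ℤ → State L
  ev : ℤ → ℂ
  eigen : ∀ n, ∀ᵐ x ∂(mes L), opA L γ (f n) x = ev n • toL2 (f n) x
  riesz : IsRieszBasis (fun n => toL2 (f n))
  biorth : ∀ n m, pairing L (toL2 (f n)) (φ m) = if n = m then 1 else 0
  ev_asymp : ∃ C : ℝ, ∀ n : ℤ, n ≠ 0 → ‖ev n - (μ + Complex.I * Real.pi * n / L)‖ ≤ C / |(n : ℝ)|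
  ev_conj : ∀ n, ev (-n) = conj (ev n)
  f_conj : ∀ n, ∀ᵐ x ∂(mes L), ∀ i, toL2 (f (-n)) x i = conj (toL2 (f n) x i)
  φ_conj : ∀ n, ∀ᵐ x ∂(mes L), ∀ i, φ (-n) x i = conj (φ n x i)

/-! ### Control profile, feedback law, transformation -/

variable {L γ μ : ℝ}

/-- `𝓘 = exp(∫₀ˣ δ) (1, 1)`. -/
def profile (L γ : ℝ) : ℝ → Val := fun x =>
  !₂[(Real.exp (∫ y in (0 : ℝ)..x, delta L γ y) : ℂ), (Real.exp (∫ y in (0 : ℝ)..x, delta L γ y) : ℂ)]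

/-- `𝓘_ν = 𝓘 + ν f₀`. -/
def virtualProfile (E : OpenLoopFamily L γ) (ν : ℝ) : ℝ → Val := fun x =>
  profile L γ x + (ν : ℂ) • toL2 (E.f 0) x

/-- The coefficients `⟨f_n, F⟩ = -2 tanh(μL) f_{n,1}(0)² / ⟨𝓘_ν, f_n⟩` of the feedback law `F`. -/
def feedbackCoeff (E : OpenLoopFamily L γ) (μ ν : ℝ) (n : ℤ) : ℂ :=
  -2 * (Real.tanh (μ * L) : ℂ) * ((valZero (E.f n)) 0) ^ 2
    / pairing L (virtualProfile E ν) (toL2 (E.f n))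

/-- `⟨α, F⟩ = ℓ`: the feedback law extended from the finite linear combinations of the `f_n` through
the partial sums `⟨α⁽ᴺ⁾, F⟩` with `α⁽ᴺ⁾ = ∑_{|n| ≤ N} ⟨α, f_n⟩ f_n`. -/
def HasFeedbackValue (E : OpenLoopFamily L γ) (μ ν : ℝ) (α : DomA L) (ℓ : ℂ) : Prop :=
  Tendsto (fun N : ℕ => ∑ n ∈ Finset.Icc (-(N : ℤ)) N,
    pairing L (toL2 α) (toL2 (E.f n)) * feedbackCoeff E μ ν n) atTop (𝓝 ℓ)

/-- The graph of the closed-loop operator `-𝒜 + 𝓘_ν F` in `D(𝒜)`: the pairs `(α, β)` in `D(𝒜)` for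
which `⟨α, F⟩` is defined and `β = -𝒜 α + ⟨α, F⟩ 𝓘_ν`. -/
def closedLoopGraph (E : OpenLoopFamily L γ) (μ ν : ℝ) : Set (DomA L × DomA L) :=
  {q | ∃ ℓ : ℂ, HasFeedbackValue E μ ν q.1 ℓ ∧
    ∀ᵐ x ∂(mes L), toL2 q.2 x = -opA L γ q.1 x + ℓ • virtualProfile E ν x}

/-- `D_F = {α ∈ D(𝒜) : -𝒜 α + ⟨α, F⟩ 𝓘_ν ∈ D(𝒜)}`. -/
def domF (E : OpenLoopFamily L γ) (μ ν : ℝ) : Set (DomA L) :=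
  {α | ∃ β, (α, β) ∈ closedLoopGraph E μ ν}

/-- `T α = ∑_n ⟨α, f_n⟩ g_n` on `D(𝒜)`, where
`g_n = T f_n = -⟨f_n, F⟩ ∑_p ⟨𝓘_ν, φ̃_p⟩ / (μ̃_p - μ_n) f̃_p`, both series converging in `D(𝒜̃)`. -/
def IsBackstepping (E : OpenLoopFamily L γ) (G : TargetFamily L γ μ) (ν : ℝ)
    (T : DomA L → DomT L μ) : Prop :=
  (∀ n, HasSum (fun p : ℤ => (-feedbackCoeff E μ ν n *
      (pairing L (virtualProfile E ν) (G.φ p) / (G.ev p - E.ev n))) • G.f p) (T (E.f n))) ∧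
  ∀ α, HasSum (fun n : ℤ => pairing L (toL2 α) (toL2 (E.f n)) • T (E.f n)) (T α)

/-! ### Semigroups -/

/-- A strongly continuous semigroup of bounded operators. -/
structure IsC0Semigroup {V : Type*} [NormedAddCommGroup V] [NormedSpace ℂ V]
    (S : ℝ≥0 → V →L[ℂ] V) : Prop where
  zero : S 0 = ContinuousLinearMap.id ℂ V
  add : ∀ s t, S (s + t) = (S s).comp (S t)
  continuous : ∀ v, Continuous fun t => S t v

/-- The graph of the infinitesimal generator: the pairs `(v, w)` with
`(S(t) v - v) / t → w` as `t → 0⁺`. -/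
def generatorGraph {V : Type*} [NormedAddCommGroup V] [NormedSpace ℂ V]
    (S : ℝ≥0 → V →L[ℂ] V) : Set (V × V) :=
  {q | Tendsto (fun t : ℝ≥0 => ((t : ℝ) : ℂ)⁻¹ • (S t q.1 - q.1)) (𝓝[>] 0) (𝓝 q.2)}

/-- Exponential stability with decay rate `r`. -/
def IsExpStable {V : Type*} [NormedAddCommGroup V] [NormedSpace ℂ V]
    (S : ℝ≥0 → V →L[ℂ] V) (r : ℝ) : Prop :=
  ∃ C : ℝ, ∀ (t : ℝ≥0) (v : V), ‖S t v‖ ≤ C * Real.exp (-r * t) * ‖v‖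

/-- `T⁻¹ S̃(t) T`. -/
def conjSemigroup {V W : Type*} [NormedAddCommGroup V] [NormedSpace ℂ V] [NormedAddCommGroup W]
    [NormedSpace ℂ W] (T : V ≃L[ℂ] W) (S : ℝ≥0 → W →L[ℂ] W) : ℝ≥0 → V →L[ℂ] V := fun t =>
  (T.symm : W →L[ℂ] V).comp ((S t).comp (T : V →L[ℂ] W))

end WaterTank

end

noncomputable section

namespace WaterTank


/-! ### Primitives on `(0, L)` -/

/-! Put `h = δ/3`, `κ = exp(-2μL)`, `t_n = f_{n,1}(0)`, `b_n = ⟨𝓘_ν, f_n⟩`, and replace the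
coordinates `a_n = ⟨α, f_n⟩` by `X_n = -2 tanh(μL) (t_n / b_n) a_n`. Then `⟨α, F⟩` is the limit `ℓ`
of the symmetric sums of `X_n t_n`, and `β = -𝒜α + ℓ 𝓘_ν` becomes `X_n(β) = -μ_n X_n(α) - 2 tanh(μL)
ℓ t_n`.

Let `y = ∑ X_n f_n` in `L²`. If `y` satisfies the condition `y₁(0) + κ y₂(0) = 0` of `𝒜̃`, Green's
formula (`green`) says that the coefficients of `𝒜̃ y` are `μ_n X_n + (κ - 1) y₂(0) t_n`. The
symmetric sums of `X_n t_n` converge to `(y₁(0) - y₂(0)) / 2 = -(1 + κ) y₂(0) / 2`, and `tanh(μL) =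
(1 - κ) / (1 + κ)`, so this is exactly the closed-loop relation: the feedback amounts to changing
the boundary condition at `0`. `OpenLoopFamily.exists_dom_iff` also proves the converse. Thus `α ↦
y` conjugates the closed loop in `D(𝒜)` to `-𝒜̃` in `L²` with domain `D(𝒜̃)`. A multiplier that is
diagonal in the basis `f̃_p` commutes with `𝒜̃` and can carry `L²` onto `D(𝒜̃)`; the composite is
`T` (`exists_transformation`, `closedLoopGraph_eq`). By Green's formula the coordinates of `f_n` in
the target basis are proportional to `1 / (μ̃_p - μ_n)`, so `T` is the announced series
(`isBackstepping`). Generation, decay, the Riesz basis and reality are then read off diagonal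
operators on `ℓ²`.

What makes `T` an isomorphism is that `μ_n b_n` (for `n ≠ 0`, and `b_0`) and `μ̃_p ⟨𝓘_ν, φ̃_p⟩` are
bounded above and away from zero. Both moments are computed by integrating `exp(3H) (f₁ - f₂)`,
where `H = ∫ h`. For the target family the end `0` contributes `1 + κ`, the end `L` about `2√κ`, and
`(1 - √κ)²` remains; the term `ν f₀` only helps, by the sign of `f_{0,1}(0)`. For the open-loop
family the ends cancel at leading order. The first-order gain is the loss of mass of `exp(3H)` at
`L`, the other first-order terms being oscillating, hence of second order (`OscSol.moment_lower`).
The zero mode is orthogonal to the unmodified profile, which is why `ν > 0` is needed. Decay comes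
from `exp(-2 μ̃_p L)` lying within `O(γL)` of `κ` (`EigSol.exp_eigenvalue`).

The two families exist for small `γ` because the coupling is a small perturbation of `Λ ∂ₓ`, whose
eigenfunctions are explicit exponentials. Its matrix entries decay like `1 / (1 + |p + q|)`, so a
fixed point gives eigenvectors quadratically close to that basis (`exists_eigenbasis`). -/

lemma integral_mes_eq {E : Type*} [NormedAddCommGroup E] [NormedSpace ℝ E] {L x : ℝ}
    (hx : x ∈ Icc 0 L) (f : ℝ → E) :
    ∫ t in (0 : ℝ)..x, f t ∂(mes L) = ∫ t in (0 : ℝ)..x, f t := by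
  rw [intervalIntegral.integral_of_le hx.1, intervalIntegral.integral_of_le hx.1,
    integral_Ioc_eq_integral_Ioo' (by simp), integral_Ioc_eq_integral_Ioo,
    Measure.restrict_restrict measurableSet_Ioo, Ioo_inter_Ioo]
  simp [hx.2]

lemma integral_mes_full {E : Type*} [NormedAddCommGroup E] [NormedSpace ℝ E] {L : ℝ}
    (hL : 0 ≤ L) (f : ℝ → E) : ∫ t in (0 : ℝ)..L, f t = ∫ t, f t ∂(mes L) := by
  rw [intervalIntegral.integral_of_le hL, integral_Ioc_eq_integral_Ioo]

lemma intervalIntegrable_iff_mes {E : Type*} [NormedAddCommGroup E] {L : ℝ} (hL : 0 ≤ L)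
    {f : ℝ → E} : IntervalIntegrable f volume 0 L ↔ Integrable f (mes L) := by
  rw [intervalIntegrable_iff_integrableOn_Ioo_of_le hL]; rfl

/-- `F` is, on `[0, L]`, a primitive of the integrable function `f`. -/
def HasPrim (L : ℝ) (F f : ℝ → ℂ) : Prop :=
  Integrable f (mes L) ∧ ∀ x ∈ Icc 0 L, F x = F 0 + ∫ t in (0 : ℝ)..x, f t

lemma HasPrim.continuousOn {L : ℝ} (hL : 0 ≤ L) {F f : ℝ → ℂ} (h : HasPrim L F f) :
    ContinuousOn F (Icc 0 L) := by
  have h1 : ContinuousOn (fun x => F 0 + ∫ t in (0 : ℝ)..x, f t) (Icc 0 L) := by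
    refine continuousOn_const.add ?_
    have := intervalIntegral.continuousOn_primitive_interval (f := f) (a := 0) (b := L)
      (μ := volume) ?_
    · rwa [uIcc_of_le hL] at this
    · rw [uIcc_of_le hL, integrableOn_Icc_iff_integrableOn_Ioo]; exact h.1
  exact h1.congr fun x hx => h.2 x hx

lemma HasPrim.of_hasDerivAt {L : ℝ} {F f : ℝ → ℂ}
    (hc : ContinuousOn F (Icc 0 L)) (hd : ∀ x ∈ Ioo 0 L, HasDerivAt F (f x) x)
    (hf : Integrable f (mes L)) : HasPrim L F f := by
  refine ⟨hf, fun x hx => ?_⟩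
  have hL : 0 ≤ L := hx.1.trans hx.2
  rw [intervalIntegral.integral_eq_sub_of_hasDerivAt_of_le hx.1
    (hc.mono (Icc_subset_Icc_right hx.2))
    (fun y hy => hd y ⟨hy.1, hy.2.trans_le hx.2⟩)]
  · ring
  · refine ((intervalIntegrable_iff_mes hL).2 hf).mono_set ?_
    rw [uIcc_of_le hx.1, uIcc_of_le hL]
    exact Icc_subset_Icc_right hx.2

lemma HasPrim.hasDerivAt {L : ℝ} {F f : ℝ → ℂ} (h : HasPrim L F f)
    (hc : ContinuousOn f (Ioo 0 L)) {x : ℝ} (hx : x ∈ Ioo 0 L) : HasDerivAt F (f x) x := by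
  have hL : 0 ≤ L := hx.1.le.trans hx.2.le
  have h1 : HasDerivAt (fun x => F 0 + ∫ t in (0 : ℝ)..x, f t) (f x) x := by
    refine HasDerivAt.const_add _ ?_
    refine intervalIntegral.integral_hasDerivAt_right ?_ ?_ (hc.continuousAt (isOpen_Ioo.mem_nhds hx))
    · refine ((intervalIntegrable_iff_mes hL).2 h.1).mono_set ?_
      rw [uIcc_of_le hx.1.le, uIcc_of_le hL]
      exact Icc_subset_Icc_right hx.2.le
    · exact hc.stronglyMeasurableAtFilter isOpen_Ioo x hx
  refine h1.congr_of_eventuallyEq ?_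
  filter_upwards [isOpen_Ioo.mem_nhds hx] with y hy
  exact h.2 y ⟨hy.1.le, hy.2.le⟩

lemma ae_mem {L : ℝ} : ∀ᵐ x ∂(mes L), x ∈ Ioo 0 L := ae_restrict_mem measurableSet_Ioo

/-- Fubini: the two iterated integrals are those of the product over the two triangles of the
square, which overlap only in the null diagonal. -/
lemma integral_primitive_add (L : ℝ) {f g : ℝ → ℂ} (hf : Integrable f (mes L))
    (hg : Integrable g (mes L)) :
    (∫ x, f x * (∫ t in (0 : ℝ)..x, g t) ∂(mes L)) + ∫ x, g x * (∫ t in (0 : ℝ)..x, f t) ∂(mes L)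
      = (∫ x, f x ∂(mes L)) * ∫ x, g x ∂(mes L) := by
  have key : ∀ (u v : ℝ → ℂ), ∀ x ∈ Ioo 0 L, u x * (∫ t in (0 : ℝ)..x, v t)
      = ∫ t, (Iic x).indicator (fun t => u x * v t) t ∂(mes L) := by
    intro u v x hx
    rw [integral_indicator measurableSet_Iic, ← integral_mes_eq ⟨hx.1.le, hx.2.le⟩,
      intervalIntegral.integral_of_le hx.1.le, integral_const_mul]
    congr 2
    rw [Measure.restrict_restrict measurableSet_Iic, Measure.restrict_restrict measurableSet_Ioc]
    congr 1
    ext y; constructor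
    · rintro ⟨h1, h2⟩; exact ⟨h1.2, h2⟩
    · rintro ⟨h1, h2⟩; exact ⟨⟨h2.1, h1⟩, h2⟩
  have hprod : Integrable (fun z : ℝ × ℝ => g z.1 * f z.2) ((mes L).prod (mes L)) := hg.mul_prod hf
  have hms : MeasurableSet {z : ℝ × ℝ | z.2 ≤ z.1} := measurableSet_le measurable_snd measurable_fst
  have e1 : ∫ x, g x * (∫ t in (0 : ℝ)..x, f t) ∂(mes L)
      = ∫ x, ∫ t, (Ici x).indicator (fun t => f x * g t) t ∂(mes L) ∂(mes L) := by
    rw [integral_congr_ae (ae_mem.mono fun x hx => key g f x hx)]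
    rw [integral_integral_swap]
    · congr 1; ext x; congr 1; ext t
      simp only [indicator, mem_Iic, mem_Ici]; split_ifs <;> ring
    · refine (hprod.indicator hms).congr (Eventually.of_forall fun z => ?_)
      simp [indicator, Function.uncurry]
  rw [e1, integral_congr_ae (ae_mem.mono fun x hx => key f g x hx), ← integral_add]
  · rw [← integral_mul_const]
    congr 1; ext x
    rw [← integral_const_mul, ← integral_add]
    · refine integral_congr_ae ?_
      have : ∀ᵐ t ∂(mes L), t ≠ x := by
        rw [ae_iff]; simp
      filter_upwards [this] with t ht
      rcases lt_or_gt_of_ne ht with h | h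
      · simp [h.le, h]
      · simp [h.le, h]
    · exact (hg.const_mul _).indicator measurableSet_Iic
    · exact (hg.const_mul _).indicator measurableSet_Ici
  · have := ((hf.mul_prod hg).indicator hms).integral_prod_left
    refine this.congr (Eventually.of_forall fun x => ?_)
    simp [indicator]
  · have hms' : MeasurableSet {z : ℝ × ℝ | z.1 ≤ z.2} :=
      measurableSet_le measurable_fst measurable_snd
    have := ((hf.mul_prod hg).indicator hms').integral_prod_left
    refine this.congr (Eventually.of_forall fun x => ?_)
    simp [indicator]

lemma HasPrim.integrable_mul {L : ℝ} (hL : 0 ≤ L) {F f g : ℝ → ℂ} (hF : HasPrim L F f)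
    (hg : Integrable g (mes L)) : Integrable (fun x => F x * g x) (mes L) := by
  obtain ⟨C, hC⟩ := isCompact_Icc.exists_bound_of_continuousOn (hF.continuousOn hL)
  refine hg.bdd_mul (c := C) ?_ (ae_mem.mono fun x hx => hC x ⟨hx.1.le, hx.2.le⟩)
  exact ((hF.continuousOn hL).mono Ioo_subset_Icc_self).aestronglyMeasurable measurableSet_Ioo

/-- Integration by parts. -/
lemma HasPrim.integral_mul {L : ℝ} (hL : 0 ≤ L) {F f G g : ℝ → ℂ} (hF : HasPrim L F f)
    (hG : HasPrim L G g) :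
    (∫ x, F x * g x ∂(mes L)) + ∫ x, G x * f x ∂(mes L) = F L * G L - F 0 * G 0 := by
  have e : ∀ {F f G g : ℝ → ℂ}, HasPrim L F f → HasPrim L G g → ∫ x, F x * g x ∂(mes L)
      = F 0 * (∫ x, g x ∂(mes L)) + ∫ x, g x * (∫ t in (0 : ℝ)..x, f t) ∂(mes L) := by
    intro F f G g hF hG
    have h1 : ∫ x, F x * g x ∂(mes L)
        = ∫ x, (F 0 * g x + g x * (∫ t in (0 : ℝ)..x, f t)) ∂(mes L) := by
      refine integral_congr_ae (ae_mem.mono fun x hx => ?_)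
      simp only [hF.2 x ⟨hx.1.le, hx.2.le⟩]; ring
    rw [h1, integral_add (hG.1.const_mul _), integral_const_mul]
    have := (hF.integrable_mul hL hG.1).sub (hG.1.const_mul (F 0))
    refine this.congr (ae_mem.mono fun x hx => ?_)
    simp only [Pi.sub_apply]
    rw [hF.2 x ⟨hx.1.le, hx.2.le⟩]; ring
  have hFL := hF.2 L ⟨hL, le_rfl⟩
  have hGL := hG.2 L ⟨hL, le_rfl⟩
  rw [integral_mes_full hL] at hFL hGL
  rw [e hF hG, e hG hF, hFL, hGL]
  have := integral_primitive_add L hF.1 hG.1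
  linear_combination this

/-! ### Elements of the domain and their continuous representatives -/

lemma comp_integrable {L : ℝ} (g : State L) (i : Fin 2) : Integrable (fun t => g t i) (mes L) :=
  ((Lp.memLp g).integrable (by norm_num)).eval_piLp i

lemma integral_val_apply {L x : ℝ} (g : State L) (i : Fin 2) :
    (∫ t in (0 : ℝ)..x, g t ∂(mes L)) i = ∫ t in (0 : ℝ)..x, g t i ∂(mes L) := by
  have := ContinuousLinearMap.intervalIntegral_comp_comm (EuclideanSpace.proj (𝕜 := ℂ)
    (ι := Fin 2) i)
    (intervalIntegrable_state g 0 x)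
  simpa using this.symm

/-- The components of the continuous representative. -/
def rep {L κ : ℝ} (α : Dom L κ) (i : Fin 2) (x : ℝ) : ℂ :=
  valZero α i + ∫ t in (0 : ℝ)..x, der α t i

section rep
variable {L κ : ℝ} (α : Dom L κ)

lemma valZero_spec : IsPrimitive L α (valZero α) ∧ valZero α 0 + (κ : ℂ) * valZero α 1 = 0 ∧
    endValue L α (valZero α) 0 + endValue L α (valZero α) 1 = 0 := Classical.choose_spec α.2

@[simp] lemma rep_zero (i : Fin 2) : rep α i 0 = valZero α i := by simp [rep]

lemma rep_hasPrim (i : Fin 2) : HasPrim L (rep α i) (fun t => der α t i) :=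
  ⟨comp_integrable _ i, fun x _ => by simp [rep]⟩

lemma rep_ae : ∀ᵐ x ∂(mes L), ∀ i, toL2 α x i = rep α i x := by
  filter_upwards [(valZero_spec α).1, ae_mem] with x hx h2 i
  have : toL2 α x = _ := hx
  rw [this, PiLp.add_apply, integral_val_apply, integral_mes_eq ⟨h2.1.le, h2.2.le⟩]
  rfl

lemma rep_bc_zero : rep α 0 0 = -(κ : ℂ) * rep α 1 0 := by
  have := (valZero_spec α).2.1
  simp only [rep_zero]; linear_combination this

lemma rep_end (hL : 0 ≤ L) (i : Fin 2) : rep α i L = endValue L α (valZero α) i := by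
  rw [endValue, PiLp.add_apply, integral_val_apply, integral_mes_eq ⟨hL, le_rfl⟩]
  rfl

lemma rep_bc_end (hL : 0 ≤ L) : rep α 0 L = -rep α 1 L := by
  rw [rep_end α hL, rep_end α hL]; linear_combination (valZero_spec α).2.2

end rep

lemma ae_unique_const {L : ℝ} (hL : 0 < L) {c d : ℂ} (h : ∀ᵐ _x ∂(mes L), c = d) : c = d := by
  have : NeZero (mes L) := ⟨by
    intro h0
    have : (mes L) univ = 0 := by rw [h0]; simp
    simp at this; linarith⟩
  exact h.exists.choose_spec

/-- Functions with an integrable derivative in `L²` and the right boundary values are in the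
domain. -/
lemma exists_dom {L : ℝ} (hL : 0 < L) {κ : ℝ} (u g : State L) (F : Fin 2 → ℝ → ℂ)
    (hu : ∀ᵐ x ∂(mes L), ∀ i, u x i = F i x) (hF : ∀ i, HasPrim L (F i) (fun x => g x i))
    (h0 : F 0 0 = -(κ : ℂ) * F 1 0) (h1 : F 0 L = -F 1 L) :
    ∃ α : Dom L κ, toL2 α = u ∧ der α = g ∧ ∀ i, ∀ x ∈ Icc 0 L, rep α i x = F i x := by
  have hc : IsPrimitive L (WithLp.toLp 2 (u, g)) (!₂[F 0 0, F 1 0]) := by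
    filter_upwards [hu, ae_mem] with x hx h2
    ext i
    rw [PiLp.add_apply]
    have := integral_val_apply (x := x) g i
    simp only [WithLp.toLp_snd, WithLp.toLp_fst]
    rw [this, hx, integral_mes_eq ⟨h2.1.le, h2.2.le⟩, (hF i).2 x ⟨h2.1.le, h2.2.le⟩]
    fin_cases i <;> rfl
  have hend : ∀ i, endValue L (WithLp.toLp 2 (u, g)) (!₂[F 0 0, F 1 0]) i = F i L := by
    intro i
    rw [endValue, PiLp.add_apply, integral_val_apply, integral_mes_eq ⟨hL.le, le_rfl⟩,
      (hF i).2 L ⟨hL.le, le_rfl⟩]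
    fin_cases i <;> rfl
  let α : Dom L κ := ⟨WithLp.toLp 2 (u, g), !₂[F 0 0, F 1 0], hc, by simp [h0], by
    rw [hend, hend, h1]; ring⟩
  refine ⟨α, rfl, rfl, fun i x hx => ?_⟩
  -- Both representatives have derivative `g` and agree almost everywhere with `u`, so they differ
  -- by a constant that must vanish.
  have hv : valZero α i = F i 0 := by
    refine ae_unique_const hL ?_
    filter_upwards [rep_ae α, hu, ae_mem] with x h1 h2 h3
    have e1 := h1 i
    have e2 := h2 i
    rw [(hF i).2 x ⟨h3.1.le, h3.2.le⟩] at e2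
    have : toL2 α x i = u x i := rfl
    rw [this, e2, rep] at e1
    exact add_right_cancel e1.symm
  rw [rep, hv, (hF i).2 x hx]
  rfl


/-! ### Completeness of the domain -/

section complete
variable {L : ℝ}

lemma mes_real_univ (hL : 0 ≤ L) : (mes L).real univ = L := by
  simp [Measure.real, hL]

lemma integral_norm_state_le (hL : 0 ≤ L) (g : State L) : ∫ t, ‖g t‖ ∂(mes L) ≤ √L * ‖g‖ := by
  have h := eLpNorm_le_eLpNorm_mul_rpow_measure_univ (μ := mes L) (p := 1) (q := 2)
    (by norm_num) (Lp.memLp g).1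
  have h1 : ∫ t, ‖g t‖ ∂(mes L) = (eLpNorm g 1 (mes L)).toReal := by
    rw [eLpNorm_one_eq_lintegral_enorm, integral_norm_eq_lintegral_enorm (Lp.memLp g).1]
  rw [h1, Lp.norm_def, mul_comm]
  refine (ENNReal.toReal_mono ?_ h).trans_eq ?_
  · exact ENNReal.mul_ne_top (Lp.memLp g).2.ne (by simp; norm_num)
  · rw [ENNReal.toReal_mul, ← ENNReal.toReal_rpow]
    congr 1
    have : ((mes L) univ).toReal = L := mes_real_univ hL
    rw [this, Real.sqrt_eq_rpow, ENNReal.toReal_one, ENNReal.toReal_ofNat]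
    congr 1; norm_num

lemma norm_integral_state_le (hL : 0 ≤ L) (g : State L) (a b : ℝ) :
    ‖∫ t in a..b, g t ∂(mes L)‖ ≤ √L * ‖g‖ := by
  refine intervalIntegral.norm_integral_le_integral_norm_uIoc.trans
    ((setIntegral_le_integral ?_ ?_).trans (integral_norm_state_le hL g))
  · exact ((Lp.memLp g).integrable (by norm_num)).norm
  · exact Eventually.of_forall fun _ => norm_nonneg _

lemma primitive_memLp (hL : 0 ≤ L) (g : State L) :
    MemLp (fun x => ∫ t in (0 : ℝ)..x, g t ∂(mes L)) 2 (mes L) := by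
  refine MemLp.of_bound ?_ (√L * ‖g‖) (Eventually.of_forall fun x => norm_integral_state_le hL g 0 x)
  exact (intervalIntegral.continuous_primitive
    (fun a b => intervalIntegrable_state g a b) 0).aestronglyMeasurable

/-- The primitive vanishing at `0`, as an operator. -/
def primS (hL : 0 ≤ L) : State L →L[ℂ] State L :=
  LinearMap.mkContinuous
    { toFun := fun g => (primitive_memLp hL g).toLp
      map_add' := fun f g => by
        rw [← MemLp.toLp_add]
        refine MemLp.toLp_congr _ _ (Eventually.of_forall fun x => ?_)
        exact integral_add_state f g x
      map_smul' := fun a g => by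
        rw [RingHom.id_apply, ← MemLp.toLp_const_smul]
        refine MemLp.toLp_congr _ _ (Eventually.of_forall fun x => ?_)
        exact integral_smul_state a g x }
    (√L * √L) (fun g => by
      have := Lp.norm_le_of_ae_bound (p := 2) (μ := mes L) (f := (primitive_memLp hL g).toLp)
        (C := √L * ‖g‖) (by positivity) (by
          filter_upwards [(primitive_memLp hL g).coeFn_toLp] with x hx
          rw [hx]; exact norm_integral_state_le hL g 0 x)
      refine this.trans_eq ?_
      rw [show measureUnivNNReal (mes L) = Real.toNNReal L by
        ext; simp [measureUnivNNReal, ENNReal.ofReal], Real.sqrt_eq_rpow]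
      simp [hL, mul_assoc])

lemma primS_coe (hL : 0 ≤ L) (g : State L) :
    primS hL g =ᵐ[mes L] fun x => ∫ t in (0 : ℝ)..x, g t ∂(mes L) :=
  (primitive_memLp hL g).coeFn_toLp

/-- The integral over `(0, L)`, as an operator. -/
def intS (hL : 0 ≤ L) : State L →L[ℂ] Val :=
  LinearMap.mkContinuous
    { toFun := fun g => ∫ t in (0 : ℝ)..L, g t ∂(mes L)
      map_add' := fun f g => integral_add_state f g L
      map_smul' := fun a g => integral_smul_state a g L }
    (√L) (fun g => norm_integral_state_le hL g 0 L)

lemma intS_apply (hL : 0 ≤ L) (g : State L) : intS hL g = ∫ t in (0 : ℝ)..L, g t ∂(mes L) := rfl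

lemma intS_const (hL : 0 ≤ L) (c : Val) : intS hL (Lp.const 2 (mes L) c) = (L : ℂ) • c := by
  rw [intS_apply, integral_mes_eq ⟨hL, le_rfl⟩, integral_mes_full hL,
    integral_congr_ae (Lp.coeFn_const (p := 2) (μ := mes L) c)]
  simp only [Function.const]
  rw [integral_const, mes_real_univ hL]
  simp

/-- The value at `0`, as an operator. -/
def startL (hL : 0 ≤ L) : Pairs L →L[ℂ] Val :=
  ((L : ℂ)⁻¹) • (intS hL).comp (WithLp.fstL 2 ℂ (State L) (State L)
    - (primS hL).comp (WithLp.sndL 2 ℂ (State L) (State L)))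

lemma isPrimitive_iff (hL : 0 ≤ L) (p : Pairs L) (c : Val) :
    IsPrimitive L p c ↔ p.fst = Lp.const 2 (mes L) c + primS hL p.snd := by
  rw [Lp.ext_iff]
  have h := Lp.coeFn_add (Lp.const 2 (mes L) c) (primS hL p.snd)
  constructor
  · intro hp
    filter_upwards [hp, h, primS_coe hL p.snd, Lp.coeFn_const (p := 2) (μ := mes L) c]
      with x h1 h2 h3 h4
    rw [h1, h2, Pi.add_apply, h3, h4]; rfl
  · intro hp
    filter_upwards [hp, h, primS_coe hL p.snd, Lp.coeFn_const (p := 2) (μ := mes L) c]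
      with x h1 h2 h3 h4
    rw [h1, h2, Pi.add_apply, h3, h4]; rfl

/-- Subtracting the primitive of `f'` from `f` leaves the constant `f 0`, and `startL` is the mean
of that difference. Hence the value at `0`, chosen abstractly in `valZero`, depends continuously on
the pair. -/
lemma startL_eq (hL : 0 < L) {p : Pairs L} {c : Val} (h : IsPrimitive L p c) :
    startL hL.le p = c := by
  rw [isPrimitive_iff hL.le] at h
  simp only [startL, _root_.smul_apply, ContinuousLinearMap.comp_apply,
    _root_.sub_apply, WithLp.fstL_apply, WithLp.sndL_apply, h, add_sub_cancel_right]
  rw [intS_const, smul_smul, inv_mul_cancel₀, one_smul]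
  exact_mod_cast hL.ne'

/-- Once the value at `0` is expressed by the bounded operator `startL`, membership is a set of
equalities between continuous functions. -/
lemma isClosed_dom (hL : 0 < L) (κ : ℝ) : IsClosed (Dom L κ : Set (Pairs L)) := by
  have : (Dom L κ : Set (Pairs L)) = {p | p.fst = Lp.constL 2 (mes L) ℂ (startL hL.le p)
      + primS hL.le p.snd} ∩ ({p | startL hL.le p 0 + (κ : ℂ) * startL hL.le p 1 = 0} ∩
      {p | (startL hL.le p + intS hL.le p.snd) 0 + (startL hL.le p + intS hL.le p.snd) 1 = 0}) := by
    ext p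
    constructor
    · rintro ⟨c, hc, h0, h1⟩
      have e := startL_eq hL hc
      refine ⟨?_, ?_, ?_⟩
      · rw [mem_ofPred_eq, e]; exact (isPrimitive_iff hL.le p c).1 hc
      · rw [mem_ofPred_eq, e]; exact h0
      · rw [mem_ofPred_eq, e]; exact h1
    · rintro ⟨h0, h1, h2⟩
      exact ⟨startL hL.le p, (isPrimitive_iff hL.le p _).2 h0, h1, h2⟩
  have c1 : Continuous fun p : Pairs L => p.fst := (WithLp.fstL 2 ℂ (State L) (State L)).continuous
  have c2 : Continuous fun p : Pairs L => p.snd := (WithLp.sndL 2 ℂ (State L) (State L)).continuous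
  rw [this]
  refine (isClosed_eq c1 (by fun_prop)).inter ((isClosed_eq ?_ (by fun_prop)).inter
    (isClosed_eq ?_ (by fun_prop)))
  · fun_prop
  · fun_prop

lemma completeSpace_dom (hL : 0 < L) (κ : ℝ) : CompleteSpace (Dom L κ) :=
  (isClosed_dom hL κ).completeSpace_coe

/-- `valZero`, as an operator. -/
def valZeroL (hL : 0 < L) (κ : ℝ) : Dom L κ →L[ℂ] Val := (startL hL.le).comp (Dom L κ).subtypeL

lemma valZeroL_apply (hL : 0 < L) {κ : ℝ} (α : Dom L κ) : valZeroL hL κ α = valZero α :=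
  startL_eq hL (valZero_spec α).1

/-- `toL2`, as an operator. -/
def toL2L (L κ : ℝ) : Dom L κ →L[ℂ] State L :=
  (WithLp.fstL 2 ℂ (State L) (State L)).comp (Dom L κ).subtypeL

/-- `der`, as an operator. -/
def derL (L κ : ℝ) : Dom L κ →L[ℂ] State L :=
  (WithLp.sndL 2 ℂ (State L) (State L)).comp (Dom L κ).subtypeL

lemma toL2L_apply {κ : ℝ} (α : Dom L κ) : toL2L L κ α = toL2 α := rfl
lemma derL_apply {κ : ℝ} (α : Dom L κ) : derL L κ α = der α := rfl

lemma norm_dom_sq {κ : ℝ} (α : Dom L κ) : ‖α‖ ^ 2 = ‖toL2 α‖ ^ 2 + ‖der α‖ ^ 2 := by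
  rw [Submodule.coe_norm, WithLp.prod_norm_sq_eq_of_L2]; rfl

lemma norm_dom_le {κ : ℝ} (α : Dom L κ) : ‖α‖ ≤ ‖toL2 α‖ + ‖der α‖ := by
  refine abs_le_of_sq_le_sq' ?_ (by positivity) |>.2
  rw [norm_dom_sq]; nlinarith [norm_nonneg (toL2 α), norm_nonneg (der α)]

end complete

/-! ### Multiplication operators -/

/-- Entrywise bounds for a matrix-valued coefficient. -/
structure BddMat (L : ℝ) (m : Fin 2 → Fin 2 → ℝ → ℂ) (C : ℝ) : Prop where
  meas : ∀ i j, AEStronglyMeasurable (m i j) (mes L)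
  bound : ∀ i j, ∀ x ∈ Ioo 0 L, ‖m i j x‖ ≤ C

/-- The product of a matrix field with a vector field. -/
def mulFun (m : Fin 2 → Fin 2 → ℝ → ℂ) (u : ℝ → Val) (x : ℝ) : Val :=
  !₂[m 0 0 x * u x 0 + m 0 1 x * u x 1, m 1 0 x * u x 0 + m 1 1 x * u x 1]

@[simp] lemma mulFun_zero (m : Fin 2 → Fin 2 → ℝ → ℂ) (u : ℝ → Val) (x : ℝ) :
    mulFun m u x 0 = m 0 0 x * u x 0 + m 0 1 x * u x 1 := rfl

@[simp] lemma mulFun_one (m : Fin 2 → Fin 2 → ℝ → ℂ) (u : ℝ → Val) (x : ℝ) :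
    mulFun m u x 1 = m 1 0 x * u x 0 + m 1 1 x * u x 1 := rfl

lemma val_ext {v w : Val} (h0 : v 0 = w 0) (h1 : v 1 = w 1) : v = w := by
  ext i; fin_cases i
  · exact h0
  · exact h1

section mul
variable {L : ℝ} {m : Fin 2 → Fin 2 → ℝ → ℂ} {C : ℝ}

lemma norm_val_sq (v : Val) : ‖v‖ ^ 2 = ‖v 0‖ ^ 2 + ‖v 1‖ ^ 2 := by
  rw [EuclideanSpace.norm_sq_eq, Fin.sum_univ_two]

lemma norm_mulFun_le (h : BddMat L m C) (u : State L) : ∀ᵐ x ∂(mes L),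
    ‖mulFun m u x‖ ≤ 2 * C * ‖u x‖ := by
  filter_upwards [ae_mem] with x hx
  have hC : 0 ≤ C := (norm_nonneg _).trans (h.bound 0 0 x hx)
  refine abs_le_of_sq_le_sq' ?_ (by positivity) |>.2
  rw [mul_pow, norm_val_sq, norm_val_sq]
  have key : ∀ i, ‖m i 0 x * u x 0 + m i 1 x * u x 1‖ ^ 2
      ≤ C ^ 2 * (2 * (‖u x 0‖ ^ 2 + ‖u x 1‖ ^ 2)) := by
    intro i
    have : ‖m i 0 x * u x 0 + m i 1 x * u x 1‖ ≤ C * (‖u x 0‖ + ‖u x 1‖) := by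
      refine (norm_add_le _ _).trans ?_
      rw [norm_mul, norm_mul, mul_add]
      gcongr <;> exact h.bound _ _ x hx
    refine (pow_le_pow_left₀ (norm_nonneg _) this 2).trans ?_
    rw [mul_pow]
    gcongr
    nlinarith [sq_nonneg (‖u x 0‖ - ‖u x 1‖)]
  have h0 := key 0
  have h1 := key 1
  simp only [mulFun, PiLp.toLp_apply, Matrix.cons_val_zero, Matrix.cons_val_one]
  linarith

lemma memLp_mulFun (h : BddMat L m C) (u : State L) : MemLp (mulFun m u) 2 (mes L) := by
  refine MemLp.of_le_mul (c := 2 * C) (Lp.memLp u) ?_ (norm_mulFun_le h u)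
  have hu : ∀ i, AEStronglyMeasurable (fun x => u x i) (mes L) := fun i =>
    (comp_integrable u i).1
  have : ∀ i, AEStronglyMeasurable (fun x => m i 0 x * u x 0 + m i 1 x * u x 1) (mes L) := fun i =>
    ((h.meas i 0).mul (hu 0)).add ((h.meas i 1).mul (hu 1))
  have hp : AEStronglyMeasurable (fun x => ![m 0 0 x * u x 0 + m 0 1 x * u x 1,
      m 1 0 x * u x 0 + m 1 1 x * u x 1]) (mes L) := by
    refine (aemeasurable_pi_iff.2 fun i => ?_).aestronglyMeasurable
    fin_cases i
    · exact (this 0).aemeasurable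
    · exact (this 1).aemeasurable
  exact (PiLp.continuous_toLp 2 _).comp_aestronglyMeasurable hp

open Classical in
/-- Multiplication by a bounded matrix field. -/
def mulOp (L : ℝ) (m : Fin 2 → Fin 2 → ℝ → ℂ) : State L →L[ℂ] State L :=
  -- The zero operator is the default for unbounded fields, so that no proof of boundedness has to
  -- be carried in the term.
  if h : ∃ C, BddMat L m C then
    LinearMap.mkContinuous
      { toFun := fun u => (memLp_mulFun h.choose_spec u).toLp
        map_add' := fun u v => by
          rw [← MemLp.toLp_add]
          refine MemLp.toLp_congr _ _ ?_
          filter_upwards [Lp.coeFn_add u v] with x hx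
          refine val_ext ?_ ?_ <;>
            simp only [mulFun_zero, mulFun_one, hx, Pi.add_apply, PiLp.add_apply] <;> ring
        map_smul' := fun a u => by
          rw [RingHom.id_apply, ← MemLp.toLp_const_smul]
          refine MemLp.toLp_congr _ _ ?_
          filter_upwards [Lp.coeFn_smul a u] with x hx
          refine val_ext ?_ ?_ <;>
            simp only [mulFun_zero, mulFun_one, hx, Pi.smul_apply, PiLp.smul_apply,
              smul_eq_mul] <;> ring }
      (2 * h.choose) (fun u => Lp.norm_le_mul_norm_of_ae_le_mul (by
        filter_upwards [(memLp_mulFun h.choose_spec u).coeFn_toLp, norm_mulFun_le h.choose_spec u]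
          with x h1 h2
        simp only [LinearMap.coe_mk, AddHom.coe_mk]
        rw [h1]; exact h2))
  else 0

lemma mulOp_coe (h : BddMat L m C) (u : State L) : mulOp L m u =ᵐ[mes L] mulFun m u := by
  have h' : ∃ C, BddMat L m C := ⟨C, h⟩
  rw [mulOp, dif_pos h']
  exact (memLp_mulFun h'.choose_spec u).coeFn_toLp

lemma norm_mulOp_apply_le (h : BddMat L m C) (u : State L) : ‖mulOp L m u‖ ≤ 2 * C * ‖u‖ := by
  refine Lp.norm_le_mul_norm_of_ae_le_mul ?_
  filter_upwards [mulOp_coe h u, norm_mulFun_le h u] with x h1 h2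
  rw [h1]; exact h2

end mul


/-! ### Conjugation, swap, and the bilinear form -/

/-- Componentwise conjugation on `ℂ²`. -/
def conjVal : Val →SL[starRingEnd ℂ] Val where
  toFun v := !₂[conj (v 0), conj (v 1)]
  map_add' v w := val_ext (by simp) (by simp)
  map_smul' a v := val_ext (by simp) (by simp)
  cont := by
    refine (PiLp.continuous_toLp 2 _).comp ?_
    refine continuous_pi fun i => ?_
    fin_cases i
    · exact Complex.continuous_conj.comp (PiLp.continuous_apply 2 _ 0)
    · exact Complex.continuous_conj.comp (PiLp.continuous_apply 2 _ 1)

/-- Swap of the components of `ℂ²`. -/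
def swapVal : Val →L[ℂ] Val where
  toFun v := !₂[v 1, v 0]
  map_add' v w := val_ext (by simp) (by simp)
  map_smul' a v := val_ext (by simp) (by simp)
  cont := by
    refine (PiLp.continuous_toLp 2 _).comp ?_
    refine continuous_pi fun i => ?_
    fin_cases i
    · exact PiLp.continuous_apply 2 _ 1
    · exact PiLp.continuous_apply 2 _ 0

/-- `diag(1, -1)`. -/
def lamVal : Val →L[ℂ] Val where
  toFun v := !₂[v 0, -v 1]
  map_add' v w := val_ext (by simp) (by simp; ring)
  map_smul' a v := val_ext (by simp) (by simp)
  cont := by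
    refine (PiLp.continuous_toLp 2 _).comp ?_
    refine continuous_pi fun i => ?_
    fin_cases i
    · exact PiLp.continuous_apply 2 _ 0
    · exact (PiLp.continuous_apply 2 _ 1).neg

def conjS (L : ℝ) : State L →SL[starRingEnd ℂ] State L := conjVal.compLpL 2 (mes L)
def swapS (L : ℝ) : State L →L[ℂ] State L := swapVal.compLpL 2 (mes L)
def lamS (L : ℝ) : State L →L[ℂ] State L := lamVal.compLpL 2 (mes L)

section basic
variable {L : ℝ}

lemma conjS_ae (u : State L) : ∀ᵐ x ∂(mes L), ∀ i, conjS L u x i = conj (u x i) := by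
  filter_upwards [conjVal.coeFn_compLpL (p := 2) (μ := mes L) u] with x hx i
  rw [conjS, hx]; fin_cases i <;> rfl

lemma swapS_ae (u : State L) : ∀ᵐ x ∂(mes L), swapS L u x 0 = u x 1 ∧ swapS L u x 1 = u x 0 := by
  filter_upwards [swapVal.coeFn_compLpL (p := 2) (μ := mes L) u] with x hx
  rw [swapS, hx]; exact ⟨rfl, rfl⟩

lemma lamS_ae (u : State L) : ∀ᵐ x ∂(mes L), lamS L u x 0 = u x 0 ∧ lamS L u x 1 = -u x 1 := by
  filter_upwards [lamVal.coeFn_compLpL (p := 2) (μ := mes L) u] with x hx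
  rw [lamS, hx]; exact ⟨rfl, rfl⟩

lemma state_ext {u v : State L} (h : ∀ᵐ x ∂(mes L), u x 0 = v x 0 ∧ u x 1 = v x 1) : u = v := by
  refine Lp.ext ?_
  filter_upwards [h] with x hx
  exact val_ext hx.1 hx.2

lemma norm_state_eq {u v : State L} (h : ∀ᵐ x ∂(mes L), ‖u x‖ = ‖v x‖) : ‖u‖ = ‖v‖ := by
  rw [Lp.norm_def, Lp.norm_def, eLpNorm_congr_norm_ae h]

lemma norm_val (v : Val) : ‖v‖ = √(‖v 0‖ ^ 2 + ‖v 1‖ ^ 2) := by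
  rw [← norm_val_sq, Real.sqrt_sq (norm_nonneg _)]

@[simp] lemma norm_conjS (u : State L) : ‖conjS L u‖ = ‖u‖ := norm_state_eq <| by
  filter_upwards [conjS_ae u] with x hx
  rw [norm_val, norm_val, hx, hx, RCLike.norm_conj, RCLike.norm_conj]

@[simp] lemma norm_swapS (u : State L) : ‖swapS L u‖ = ‖u‖ := norm_state_eq <| by
  filter_upwards [swapS_ae u] with x hx
  rw [norm_val, norm_val, hx.1, hx.2, add_comm]

@[simp] lemma lamS_lamS (u : State L) : lamS L (lamS L u) = u := state_ext <| by
  filter_upwards [lamS_ae u, lamS_ae (lamS L u)] with x h1 h2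
  simp [h1, h2]

@[simp] lemma conjS_conjS (u : State L) : conjS L (conjS L u) = u := state_ext <| by
  filter_upwards [conjS_ae u, conjS_ae (conjS L u)] with x h1 h2
  simp [h1, h2]

@[simp] lemma swapS_swapS (u : State L) : swapS L (swapS L u) = u := state_ext <| by
  filter_upwards [swapS_ae u, swapS_ae (swapS L u)] with x h1 h2
  simp [h1, h2]

lemma isRealValued_iff (u : State L) : IsRealValued u ↔ conjS L u = u := by
  constructor
  · intro h
    refine state_ext ?_
    filter_upwards [conjS_ae u, h] with x h1 h2
    rw [h1, h1]
    exact ⟨Complex.conj_eq_iff_im.2 (h2 0), Complex.conj_eq_iff_im.2 (h2 1)⟩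
  · intro h
    have := conjS_ae u
    rw [h] at this
    filter_upwards [this] with x h1 i
    exact Complex.conj_eq_iff_im.1 (h1 i).symm

lemma pairing_eq_inner (u v : State L) : pairing L u v = inner ℂ v u := by
  rw [L2.inner_def, pairing]
  congr 1; ext x
  rw [PiLp.inner_apply, Fin.sum_univ_two]
  simp

lemma pairing_congr {f f' g g' : ℝ → Val} (h : f =ᵐ[mes L] f') (h' : g =ᵐ[mes L] g') :
    pairing L f g = pairing L f' g' := by
  refine integral_congr_ae ?_
  filter_upwards [h, h'] with x h1 h2
  rw [h1, h2]

/-- The bilinear form `∫ (u₁ v₂ + u₂ v₁)`. -/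
def bil (u v : State L) : ℂ := inner ℂ (conjS L (swapS L v)) u

lemma bil_eq (u v : State L) : bil u v = ∫ x, (u x 0 * v x 1 + u x 1 * v x 0) ∂(mes L) := by
  rw [bil, ← pairing_eq_inner, pairing]
  refine integral_congr_ae ?_
  filter_upwards [conjS_ae (swapS L v), swapS_ae v] with x h1 h2
  simp [h1, h2]

lemma bil_integrable (u v : State L) :
    Integrable (fun x => u x 0 * v x 1 + u x 1 * v x 0) (mes L) :=
  (((Lp.memLp u).eval_piLp 0).integrable_mul ((Lp.memLp v).eval_piLp 1)).add
    (((Lp.memLp u).eval_piLp 1).integrable_mul ((Lp.memLp v).eval_piLp 0))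

lemma norm_bil_le (u v : State L) : ‖bil u v‖ ≤ ‖u‖ * ‖v‖ := by
  refine (norm_inner_le_norm _ _).trans_eq ?_
  simp [mul_comm]

lemma bil_comm (u v : State L) : bil u v = bil v u := by
  rw [bil_eq, bil_eq]; congr 1; ext x; ring

/-- `bil · v` as an operator. -/
def bilL (v : State L) : State L →L[ℂ] ℂ := innerSL ℂ (conjS L (swapS L v))

lemma bil_add_left (u u' v : State L) : bil (u + u') v = bil u v + bil u' v := inner_add_right _ _ _
lemma bil_smul_left (a : ℂ) (u v : State L) : bil (a • u) v = a * bil u v := inner_smul_right _ _ _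
lemma bil_smul_right (a : ℂ) (u v : State L) : bil u (a • v) = a * bil u v := by
  rw [bil_comm, bil_smul_left, bil_comm]

/-- Quantitative nondegeneracy of the bilinear form; it gives the lower bound on `TargetFamily.c`.
-/
lemma bil_self_conj (u : State L) : bil (conjS L (swapS L u)) u = (‖u‖ : ℂ) ^ 2 := by
  rw [bil, inner_self_eq_norm_sq_to_K]; simp

end basic

/-! ### The operator -/

/-- Bounds for the coupling coefficient `h = δ / 3`. -/
structure IsCoupling (L : ℝ) (h : ℝ → ℝ) (ε : ℝ) : Prop where
  cont : ContinuousOn h (Icc 0 L)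
  bound : ∀ x ∈ Icc 0 L, |h x| ≤ ε

/-- Multiplication by `h [[0, 1], [-1, 0]]`. -/
def couple (L : ℝ) (h : ℝ → ℝ) : State L →L[ℂ] State L :=
  mulOp L ![![0, fun x => (h x : ℂ)], ![fun x => -(h x : ℂ), 0]]

/-- `Λ ∂ₓ + h [[0, 1], [-1, 0]]` on `Dom L κ`. -/
def Aop (L κ : ℝ) (h : ℝ → ℝ) : Dom L κ →L[ℂ] State L :=
  (lamS L).comp (derL L κ) + (couple L h).comp (toL2L L κ)

section op
variable {L : ℝ} {h : ℝ → ℝ} {ε : ℝ}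

lemma IsCoupling.aesm (H : IsCoupling L h ε) :
    AEStronglyMeasurable (fun x => (h x : ℂ)) (mes L) :=
  (Complex.continuous_ofReal.comp_continuousOn
    (H.cont.mono Ioo_subset_Icc_self)).aestronglyMeasurable measurableSet_Ioo

lemma IsCoupling.nonneg (H : IsCoupling L h ε) (hL : 0 ≤ L) : 0 ≤ ε :=
  (abs_nonneg _).trans (H.bound 0 ⟨le_rfl, hL⟩)

lemma IsCoupling.bddMat (H : IsCoupling L h ε) (hL : 0 ≤ L) :
    BddMat L ![![0, fun x => (h x : ℂ)], ![fun x => -(h x : ℂ), 0]] ε where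
  meas i j := by
    fin_cases i <;> fin_cases j
    · exact aestronglyMeasurable_zero
    · exact H.aesm
    · exact H.aesm.neg
    · exact aestronglyMeasurable_zero
  bound i j x hx := by
    have h0 := H.nonneg hL
    have h1 := H.bound x ⟨hx.1.le, hx.2.le⟩
    fin_cases i <;> fin_cases j <;> simp [h0, h1]

lemma couple_ae (H : IsCoupling L h ε) (hL : 0 ≤ L) (u : State L) :
    ∀ᵐ x ∂(mes L), couple L h u x 0 = h x * u x 1 ∧ couple L h u x 1 = -(h x * u x 0) := by
  filter_upwards [mulOp_coe (H.bddMat hL) u] with x hx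
  rw [couple, hx]; simp

lemma norm_couple_le (H : IsCoupling L h ε) (hL : 0 ≤ L) : ‖couple L h‖ ≤ 2 * ε :=
  ContinuousLinearMap.opNorm_le_bound _ (mul_nonneg zero_le_two (H.nonneg hL))
    (norm_mulOp_apply_le (H.bddMat hL))

variable {κ κ' : ℝ}

lemma Aop_apply (α : Dom L κ) : Aop L κ h α = lamS L (der α) + couple L h (toL2 α) := rfl

lemma Aop_ae (H : IsCoupling L h ε) (hL : 0 ≤ L) (α : Dom L κ) : ∀ᵐ x ∂(mes L),
    Aop L κ h α x 0 = der α x 0 + h x * toL2 α x 1 ∧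
    Aop L κ h α x 1 = -der α x 1 - h x * toL2 α x 0 := by
  filter_upwards [couple_ae H hL (toL2 α), lamS_ae (der α),
    Lp.coeFn_add (lamS L (der α)) (couple L h (toL2 α))] with x h1 h2 h3
  rw [Aop_apply, h3, Pi.add_apply, PiLp.add_apply, PiLp.add_apply, h1.1, h1.2, h2.1, h2.2]
  exact ⟨rfl, by ring⟩

lemma der_eq (α : Dom L κ) : der α = lamS L (Aop L κ h α - couple L h (toL2 α)) := by
  rw [Aop_apply, add_sub_cancel_right, lamS_lamS]

/-- Symmetry of the operator with respect to the bilinear form. -/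
lemma green (H : IsCoupling L h ε) (hL : 0 ≤ L) (α : Dom L κ) (β : Dom L κ') :
    bil (Aop L κ h α) (toL2 β) - bil (toL2 α) (Aop L κ' h β)
      = ((κ : ℂ) - κ') * (rep α 1 0 * rep β 1 0) := by
  have i1 := HasPrim.integral_mul hL (rep_hasPrim α 0) (rep_hasPrim β 1)
  have i2 := HasPrim.integral_mul hL (rep_hasPrim α 1) (rep_hasPrim β 0)
  have I := fun (i j : Fin 2) => (rep_hasPrim α i).integrable_mul hL (comp_integrable (der β) j)
  have J := fun (i j : Fin 2) => (rep_hasPrim β i).integrable_mul hL (comp_integrable (der α) j)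
  rw [← integral_add (I 0 1) (J 1 0)] at i1
  rw [← integral_add (I 1 0) (J 0 1)] at i2
  have e : bil (Aop L κ h α) (toL2 β) - bil (toL2 α) (Aop L κ' h β)
      = (∫ x, (rep α 0 x * der β x 1 + rep β 1 x * der α x 0) ∂(mes L))
        - ∫ x, (rep α 1 x * der β x 0 + rep β 0 x * der α x 1) ∂(mes L) := by
    have i3 := integral_sub (f := fun x => rep α 0 x * der β x 1 + rep β 1 x * der α x 0)
      (g := fun x => rep α 1 x * der β x 0 + rep β 0 x * der α x 1)
      ((I 0 1).add (J 1 0)) ((I 1 0).add (J 0 1))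
    rw [← i3, bil_eq, bil_eq, ← integral_sub (bil_integrable _ _) (bil_integrable _ _)]
    refine integral_congr_ae ?_
    filter_upwards [Aop_ae H hL α, Aop_ae H hL β, rep_ae α, rep_ae β] with x h1 h2 h3 h4
    rw [h1.1, h1.2, h2.1, h2.2, h3, h3, h4, h4]; ring
  -- The condition at `L` is the same for `α` and `β`, so the terms there cancel; at `0` only the
  -- difference of the two constants survives.
  rw [e, i1, i2, rep_bc_end α hL, rep_bc_end β hL, rep_bc_zero α, rep_bc_zero β]
  ring

end op


/-! ### Square-summable sequences and diagonal operators -/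

/-- `ℓ²(ℤ)`. -/
abbrev Seq : Type := lp (fun _ : ℤ => ℂ) 2

/-- The canonical basis of `ℓ²(ℤ)`. -/
abbrev sg (n : ℤ) : Seq := lp.single 2 n (1 : ℂ)

lemma sg_apply (n m : ℤ) : (sg n : Seq) m = if m = n then 1 else 0 := by
  rw [lp.single_apply, Pi.single_apply]

lemma seq_hasSum (c : Seq) : HasSum (fun n => c n • sg n) c := by
  have h := lp.hasSum_single (by simp) c
  refine h.congr_fun fun n => ?_
  rw [← lp.single_smul, smul_eq_mul, mul_one]

lemma seq_norm_sq (c : Seq) : ‖c‖ ^ 2 = ∑' n, ‖c n‖ ^ 2 := by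
  have := lp.norm_rpow_eq_tsum (p := 2) (by simp) c
  simpa using this

lemma seq_summable_sq (c : Seq) : Summable fun n => ‖c n‖ ^ 2 := by
  have := (lp.memℓp c).summable (by simp)
  simpa using this

lemma memSeq_iff {a : ℤ → ℂ} : Memℓp a 2 ↔ Summable fun n => ‖a n‖ ^ 2 := by
  rw [memℓp_gen_iff (by simp)]; simp

lemma memSeq_of_le {a : ℤ → ℂ} (c : Seq) {C : ℝ} (h : ∀ n, ‖a n‖ ≤ C * ‖c n‖) : Memℓp a 2 := by
  rw [memSeq_iff]
  refine Summable.of_nonneg_of_le (fun _ => by positivity) (fun n => ?_)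
    ((seq_summable_sq c).mul_left (C ^ 2))
  rw [← mul_pow]
  exact pow_le_pow_left₀ (norm_nonneg _) (h n) 2

lemma seq_norm_le (a c : Seq) {C : ℝ} (hC : 0 ≤ C) (h : ∀ n, ‖a n‖ ≤ C * ‖c n‖) :
    ‖a‖ ≤ C * ‖c‖ := by
  have h1 : ‖a‖ ≤ ‖(C : ℂ) • c‖ := lp.norm_mono (by simp) fun n => by
    rw [lp.coeFn_smul, Pi.smul_apply, norm_smul, Complex.norm_real, Real.norm_of_nonneg hC]
    exact h n
  rwa [norm_smul, Complex.norm_real, Real.norm_of_nonneg hC] at h1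

/-- The coordinates of `ℓ²(ℤ)`. -/
def coord (n : ℤ) : Seq →L[ℂ] ℂ := innerSL ℂ (sg n)

@[simp] lemma coord_apply (n : ℤ) (c : Seq) : coord n c = c n := by
  rw [coord, innerSL_apply_apply, lp.inner_single_left]; simp

lemma seq_clm_ext {V : Type*} [NormedAddCommGroup V] [NormedSpace ℂ V] {S T : Seq →L[ℂ] V}
    (h : ∀ n, S (sg n) = T (sg n)) : S = T := by
  ext c
  have h1 := (seq_hasSum c).mapL S
  have h2 := (seq_hasSum c).mapL T
  simp only [map_smul, h] at h1 h2
  exact h1.unique h2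

open Classical in
/-- The diagonal operator of a bounded sequence. -/
def diag (m : ℤ → ℂ) : Seq →L[ℂ] Seq :=
  if h : ∃ C : ℝ, ∀ n, ‖m n‖ ≤ C then
    LinearMap.mkContinuous
      { toFun := fun c => ⟨fun n => m n * c n, memSeq_of_le c (C := h.choose) fun n => by
          rw [norm_mul]; exact mul_le_mul_of_nonneg_right (h.choose_spec n) (norm_nonneg _)⟩
        map_add' := fun c d => by ext n; exact mul_add _ _ _
        map_smul' := fun a c => by ext n; simp; ring }
      h.choose (fun c => seq_norm_le _ _ ((norm_nonneg _).trans (h.choose_spec 0)) fun n => by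
        simp only [LinearMap.coe_mk, AddHom.coe_mk]
        rw [norm_mul]; exact mul_le_mul_of_nonneg_right (h.choose_spec n) (norm_nonneg _))
  else 0

section diag
variable {m : ℤ → ℂ} {C : ℝ}

lemma diag_apply (h : ∀ n, ‖m n‖ ≤ C) (c : Seq) (n : ℤ) : diag m c n = m n * c n := by
  rw [diag, dif_pos ⟨C, h⟩]; rfl

lemma norm_diag_apply_le (h : ∀ n, ‖m n‖ ≤ C) (c : Seq) : ‖diag m c‖ ≤ C * ‖c‖ :=
  seq_norm_le _ _ ((norm_nonneg _).trans (h 0)) fun n => by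
    rw [diag_apply h, norm_mul]
    exact mul_le_mul_of_nonneg_right (h n) (norm_nonneg _)

/-- The diagonal operator of a sequence bounded above and below. -/
def diagEquiv (m : ℤ → ℂ) (c C : ℝ) (hc : 0 < c) (h : ∀ n, c ≤ ‖m n‖ ∧ ‖m n‖ ≤ C) :
    Seq ≃L[ℂ] Seq :=
  ContinuousLinearEquiv.equivOfInverse (diag m) (diag fun n => (m n)⁻¹)
    (fun x => by
      ext n
      rw [diag_apply (C := c⁻¹) (fun n => by
        rw [norm_inv]; exact inv_anti₀ hc (h n).1), diag_apply (fun n => (h n).2), ← mul_assoc,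
        inv_mul_cancel₀ (norm_pos_iff.1 (hc.trans_le (h n).1)), one_mul])
    (fun x => by
      ext n
      rw [diag_apply (fun n => (h n).2), diag_apply (C := c⁻¹) (fun n => by
        rw [norm_inv]; exact inv_anti₀ hc (h n).1), ← mul_assoc,
        mul_inv_cancel₀ (norm_pos_iff.1 (hc.trans_le (h n).1)), one_mul])

lemma diagEquiv_apply {c : ℝ} (hc : 0 < c) (h : ∀ n, c ≤ ‖m n‖ ∧ ‖m n‖ ≤ C) (x : Seq) (n : ℤ) :
    diagEquiv m c C hc h x n = m n * x n :=
  diag_apply (fun n => (h n).2) x n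

end diag

/-! ### Bases of the domain made of eigenvectors -/

section eigenbasis
variable {L κ : ℝ} {h : ℝ → ℝ} {ev : ℤ → ℂ} {f : ℤ → Dom L κ} {Φ : Seq ≃L[ℂ] State L}

/-- Series of eigenvectors converging in the graph norm. -/
lemma exists_dom_series (hL : 0 < L) (hΦ : ∀ n, Φ (sg n) = toL2 (f n))
    (heig : ∀ n, Aop L κ h (f n) = ev n • toL2 (f n)) (x y : Seq) (hxy : ∀ n, y n = ev n * x n) :
    ∃ α : Dom L κ, toL2 α = Φ x ∧ Aop L κ h α = Φ y ∧ HasSum (fun n => x n • f n) α := by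
  have s1 : HasSum (fun n => toL2L L κ (x n • f n)) (Φ x) := by
    refine ((seq_hasSum x).mapL (Φ : Seq →L[ℂ] State L)).congr_fun fun n => ?_
    rw [map_smul, map_smul, toL2L_apply, ← hΦ]; rfl
  have s2 : HasSum (fun n => Aop L κ h (x n • f n)) (Φ y) := by
    refine ((seq_hasSum y).mapL (Φ : Seq →L[ℂ] State L)).congr_fun fun n => ?_
    rw [map_smul, map_smul, heig, smul_smul, hxy, mul_comm (ev n), ← hΦ]; rfl
  -- By `der_eq` the derivative is a bounded function of `u` and `𝒜 u`: convergence in the graph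
  -- norm is convergence in `H¹`.
  have s3 : HasSum (fun n => derL L κ (x n • f n)) (lamS L (Φ y - couple L h (Φ x))) := by
    refine ((s2.sub (s1.mapL (couple L h))).mapL (lamS L)).congr_fun fun n => ?_
    rw [derL_apply, toL2L_apply]
    exact der_eq _
  have s4 : HasSum (fun n => ((x n • f n : Dom L κ) : Pairs L))
      (WithLp.toLp 2 (Φ x, lamS L (Φ y - couple L h (Φ x)))) := by
    have := (s1.prodMk s3).mapL (WithLp.prodContinuousLinearEquiv 2 ℂ (State L) (State L)).symm.toContinuousLinearMap
    exact this
  have hmem : (WithLp.toLp 2 (Φ x, lamS L (Φ y - couple L h (Φ x))) : Pairs L) ∈ Dom L κ := by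
    refine (isClosed_dom hL κ).mem_of_tendsto s4 (Eventually.of_forall fun s => ?_)
    exact Submodule.sum_mem _ fun n _ => (x n • f n).2
  refine ⟨⟨_, hmem⟩, rfl, ?_, ?_⟩
  · rw [Aop_apply]
    change lamS L (lamS L (Φ y - couple L h (Φ x))) + couple L h (Φ x) = Φ y
    rw [lamS_lamS, sub_add_cancel]
  · rw [HasSum, tendsto_subtype_rng]
    refine s4.congr fun s => ?_
    simp

/-- Suitably rescaled, a basis of eigenvectors is a basis of the domain. -/
lemma exists_dom_basis (hL : 0 < L) (hΦ : ∀ n, Φ (sg n) = toL2 (f n))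
    (heig : ∀ n, Aop L κ h (f n) = ev n • toL2 (f n))
    (hcoef : ∀ α n, Φ.symm (Aop L κ h α) n = ev n * Φ.symm (toL2 α) n)
    {w : ℤ → ℂ} {c C : ℝ} (hc : 0 < c) (h1 : ∀ n, c ≤ ‖w n‖) (h2 : ∀ n, ‖ev n‖ ≤ C * ‖w n‖)
    (h3 : ∀ n, ‖w n‖ ≤ C * (1 + ‖ev n‖)) :
    ∃ Ψ : Seq ≃L[ℂ] Dom L κ, (∀ n, Ψ (sg n) = (w n)⁻¹ • f n) ∧
      ∀ α n, Φ.symm (toL2 α) n = (w n)⁻¹ * Ψ.symm α n := by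
  have hw : ∀ n, w n ≠ 0 := fun n => norm_pos_iff.1 (hc.trans_le (h1 n))
  have hC : 0 ≤ C := by
    by_contra hC
    have := (hc.trans_le (h1 0)).trans_le (h3 0)
    nlinarith [norm_nonneg (ev 0)]
  have b1 : ∀ n, ‖w n / (1 + ‖ev n‖ ^ 2 : ℝ)‖ ≤ 2 * C := fun n => by
    rw [norm_div, Complex.norm_real, Real.norm_of_nonneg (by positivity), div_le_iff₀ (by positivity)]
    have := h3 n
    nlinarith [norm_nonneg (ev n), sq_nonneg (‖ev n‖ - 1), mul_nonneg hC (sq_nonneg (‖ev n‖ - 1))]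
  have b2 : ∀ n, ‖w n * conj (ev n) / (1 + ‖ev n‖ ^ 2 : ℝ)‖ ≤ 2 * C := fun n => by
    rw [norm_div, norm_mul, RCLike.norm_conj, Complex.norm_real, Real.norm_of_nonneg (by positivity),
      div_le_iff₀ (by positivity)]
    have := mul_le_mul_of_nonneg_right (h3 n) (norm_nonneg (ev n))
    nlinarith [norm_nonneg (ev n), sq_nonneg (‖ev n‖ - 1), mul_nonneg hC (sq_nonneg (‖ev n‖ - 1))]
  -- `K` multiplies the coordinates by `w n`, possibly unbounded. Writing `w = (w + w conj(ev) ev) /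
  -- (1 + |ev|²)` expresses it by bounded multipliers of the coordinates of `u` and of `𝒜 u`.
  let K : Dom L κ →L[ℂ] Seq :=
    (diag fun n => w n / (1 + ‖ev n‖ ^ 2 : ℝ)).comp ((Φ.symm : State L →L[ℂ] Seq).comp (toL2L L κ))
    + (diag fun n => w n * conj (ev n) / (1 + ‖ev n‖ ^ 2 : ℝ)).comp
        ((Φ.symm : State L →L[ℂ] Seq).comp (Aop L κ h))
  have hK : ∀ α n, K α n = w n * Φ.symm (toL2 α) n := by
    intro α n
    have e : K α n = w n / (1 + ‖ev n‖ ^ 2 : ℝ) * Φ.symm (toL2 α) n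
        + w n * conj (ev n) / (1 + ‖ev n‖ ^ 2 : ℝ) * Φ.symm (Aop L κ h α) n := by
      rw [← diag_apply b1, ← diag_apply b2]; rfl
    rw [e, hcoef]
    have h0 : ((1 + ‖ev n‖ ^ 2 : ℝ) : ℂ) ≠ 0 := by
      exact_mod_cast (by positivity : (1 + ‖ev n‖ ^ 2 : ℝ) ≠ 0)
    have h4 : conj (ev n) * ev n = ((‖ev n‖ ^ 2 : ℝ) : ℂ) := by
      rw [mul_comm, Complex.mul_conj, Complex.normSq_eq_norm_sq]
    field_simp
    push_cast at h4 ⊢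
    linear_combination w n * (Φ.symm (toL2 α)) n * h4
  have hinj : (K : Dom L κ →ₗ[ℂ] Seq).ker = ⊥ := by
    rw [LinearMap.ker_eq_bot']
    intro α hα
    have h0 : Φ.symm (toL2 α) = 0 := by
      ext n
      have := hK α n
      rw [show K α = 0 from hα] at this
      simpa [hw n] using this.symm
    have h5 : Φ.symm (Aop L κ h α) = 0 := by
      ext n; rw [hcoef, h0]; simp
    have h6 : toL2 α = 0 := by simpa using h0
    have h7 : Aop L κ h α = 0 := by simpa using h5
    have h8 : der α = 0 := by rw [der_eq (h := h), h6, h7]; simp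
    have := norm_dom_le α
    rw [h6, h8] at this
    simpa using this
  have hsurj : (K : Dom L κ →ₗ[ℂ] Seq).range = ⊤ := by
    rw [LinearMap.range_eq_top]
    intro y
    have bw : ∀ n, ‖(w n)⁻¹‖ ≤ c⁻¹ := fun n => by
      rw [norm_inv]; exact inv_anti₀ hc (h1 n)
    have be : ∀ n, ‖ev n * (w n)⁻¹‖ ≤ C := fun n => by
      rw [norm_mul, norm_inv, ← div_eq_mul_inv, div_le_iff₀ (hc.trans_le (h1 n))]
      exact h2 n
    obtain ⟨α, h4, -, -⟩ := exists_dom_series hL hΦ heig (diag (fun n => (w n)⁻¹) y)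
      (diag (fun n => ev n * (w n)⁻¹) y) (fun n => by
        rw [diag_apply bw, diag_apply be, mul_assoc])
    refine ⟨α, ?_⟩
    ext n
    have : K α n = y n := by
      rw [hK, h4, ContinuousLinearEquiv.symm_apply_apply, diag_apply bw, ← mul_assoc,
        mul_inv_cancel₀ (hw n), one_mul]
    exact this
  -- Completeness lets the open mapping theorem supply the bounded inverse.
  have := completeSpace_dom hL κ
  let Ψ := (ContinuousLinearEquiv.ofBijective K hinj hsurj).symm
  refine ⟨Ψ, fun n => ?_, fun α n => ?_⟩
  · rw [ContinuousLinearEquiv.symm_apply_eq]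
    ext k
    have : K ((w n)⁻¹ • f n) k = sg n k := by
      rw [map_smul, lp.coeFn_smul, Pi.smul_apply, hK, ← hΦ, ContinuousLinearEquiv.symm_apply_apply,
        sg_apply]
      split_ifs with hk
      · rw [hk]; simp [hw n]
      · simp
    exact this.symm
  · have : Ψ.symm α n = w n * Φ.symm (toL2 α) n := hK α n
    rw [this, ← mul_assoc, inv_mul_cancel₀ (hw n), one_mul]

end eigenbasis


/-! ### Estimates for solutions of the eigenvalue equation -/

lemma norm_sub_le_of_deriv {E : Type*} [NormedAddCommGroup E] [NormedSpace ℝ E] {L C : ℝ}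
    {F F' : ℝ → E} (hc : ContinuousOn F (Icc 0 L))
    (hd : ∀ x ∈ Ioo 0 L, HasDerivAt F (F' x) x) (hb : ∀ x ∈ Ioo 0 L, ‖F' x‖ ≤ C) {x y : ℝ}
    (hx : x ∈ Icc 0 L) (hy : y ∈ Icc 0 L) : ‖F y - F x‖ ≤ C * L := by
  rcases (hx.1.trans hx.2).eq_or_lt with h0 | hL
  · have : x = y := by
      have h1 := hx.1; have h2 := hx.2; have h3 := hy.1; have h4 := hy.2
      linarith
    simp [this, ← h0]
  have hC : 0 ≤ C := (norm_nonneg _).trans (hb (L / 2) ⟨by linarith, by linarith⟩)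
  have h1 : LipschitzOnWith (Real.toNNReal C) F (Ioo 0 L) := by
    refine (convex_Ioo 0 L).lipschitzOnWith_of_nnnorm_hasDerivWithin_le
      (fun z hz => (hd z hz).hasDerivWithinAt) fun z hz => ?_
    rw [← NNReal.coe_le_coe, coe_nnnorm, Real.coe_toNNReal _ hC]
    exact hb z hz
  rw [← closure_Ioo hL.ne] at hc hx hy
  have h2 := (h1.closure hc).dist_le_mul y hy x hx
  rw [closure_Ioo hL.ne] at hx hy
  rw [dist_eq_norm, Real.coe_toNNReal _ hC] at h2
  refine h2.trans (mul_le_mul_of_nonneg_left ?_ hC)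
  rw [Real.dist_eq, abs_le]
  exact ⟨by linarith [hx.2, hy.1], by linarith [hx.1, hy.2]⟩

/-- Grönwall: `exp (K z) D z` is nondecreasing. -/
lemma exp_growth_bwd {L K : ℝ} {D D' : ℝ → ℝ} (hc : ContinuousOn D (Icc 0 L))
    (hd : ∀ x ∈ Ioo 0 L, HasDerivAt D (D' x) x) (hb : ∀ x ∈ Ioo 0 L, -(K * D x) ≤ D' x) {x y : ℝ}
    (hx : x ∈ Icc 0 L) (hy : y ∈ Icc 0 L) (hxy : x ≤ y) : D x ≤ Real.exp (K * (y - x)) * D y := by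
  have hd' : ∀ z ∈ Ioo 0 L, HasDerivAt (fun z => Real.exp (K * z) * D z)
      (Real.exp (K * z) * (K * D z + D' z)) z := fun z hz => by
    have h1 : HasDerivAt (fun z => Real.exp (K * z)) (Real.exp (K * z) * (K * 1)) z :=
      ((hasDerivAt_id z).const_mul K).exp
    refine (h1.mul (hd z hz)).congr_deriv ?_
    ring
  have hm : MonotoneOn (fun z => Real.exp (K * z) * D z) (Icc 0 L) := by
    refine monotoneOn_of_deriv_nonneg (convex_Icc 0 L)
      ((by fun_prop : Continuous fun z => Real.exp (K * z)).continuousOn.mul hc) ?_ ?_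
    · rw [interior_Icc]; exact fun z hz => (hd' z hz).differentiableAt.differentiableWithinAt
    · rw [interior_Icc]; intro z hz
      rw [(hd' z hz).deriv]
      exact mul_nonneg (Real.exp_pos _).le (by linarith [hb z hz])
  have h := hm hx hy hxy
  simp only at h
  rw [mul_sub, Real.exp_sub, div_mul_eq_mul_div, le_div_iff₀ (Real.exp_pos _)]
  linarith

lemma exp_growth_fwd {L K : ℝ} {D D' : ℝ → ℝ} (hc : ContinuousOn D (Icc 0 L))
    (hd : ∀ x ∈ Ioo 0 L, HasDerivAt D (D' x) x) (hb : ∀ x ∈ Ioo 0 L, D' x ≤ K * D x) {x y : ℝ}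
    (hx : x ∈ Icc 0 L) (hy : y ∈ Icc 0 L) (hxy : x ≤ y) : D y ≤ Real.exp (K * (y - x)) * D x := by
  have h := exp_growth_bwd (D := fun z => -D z) (D' := fun z => -D' z) (K := -K) hc.neg
    (fun z hz => (hd z hz).neg) (fun z hz => by linarith [hb z hz]) hx hy hxy
  have h1 : Real.exp (-K * (y - x)) = (Real.exp (K * (y - x)))⁻¹ := by
    rw [← Real.exp_neg]; ring_nf
  rw [h1, inv_mul_eq_div, le_div_iff₀ (Real.exp_pos _)] at h
  linarith

/-- A classical solution of the eigenvalue equation on `[0, L]`. -/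
structure EigSol (L : ℝ) (h : ℝ → ℝ) (l : ℂ) (f g : ℝ → ℂ) : Prop where
  cf : ContinuousOn f (Icc 0 L)
  cg : ContinuousOn g (Icc 0 L)
  df : ∀ x ∈ Ioo 0 L, HasDerivAt f (l * f x - h x * g x) x
  dg : ∀ x ∈ Ioo 0 L, HasDerivAt g (-l * g x - h x * f x) x

lemma HasPrim.congr_ae {L : ℝ} {F f f' : ℝ → ℂ} (h : HasPrim L F f) (hf : f =ᵐ[mes L] f') :
    HasPrim L F f' := by
  refine ⟨h.1.congr hf, fun x hx => ?_⟩
  rw [h.2 x hx, ← integral_mes_eq hx, ← integral_mes_eq hx,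
    intervalIntegral.integral_congr_ae (hf.mono fun _ h _ => h)]

section
variable {L κ : ℝ} {h : ℝ → ℝ} {ε : ℝ} {l : ℂ}

/-- The weak derivative agrees almost everywhere with a continuous expression in the representative,
which is therefore a classical solution inside. -/
lemma eigSol_of_eigen (hL : 0 ≤ L) (H : IsCoupling L h ε) {α : Dom L κ}
    (hα : Aop L κ h α = l • toL2 α) : EigSol L h l (rep α 0) (rep α 1) := by
  have c0 := (rep_hasPrim α 0).continuousOn hL
  have c1 := (rep_hasPrim α 1).continuousOn hL
  have hh : ContinuousOn (fun x => (h x : ℂ)) (Icc 0 L) :=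
    Complex.continuous_ofReal.comp_continuousOn H.cont
  have hs := Lp.coeFn_smul l (toL2 α)
  have hA := Aop_ae H hL α
  rw [hα] at hA
  refine ⟨c0, c1, fun x hx => ?_, fun x hx => ?_⟩
  · refine ((rep_hasPrim α 0).congr_ae (f' := fun x => l * rep α 0 x - h x * rep α 1 x)
      ?_).hasDerivAt (((c0.const_mul l).sub (hh.mul c1)).mono Ioo_subset_Icc_self) hx
    filter_upwards [hs, hA, rep_ae α] with x h1 h2 h3
    rw [h1] at h2
    simp only [Pi.smul_apply, PiLp.smul_apply, smul_eq_mul, h3] at h2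
    linear_combination -h2.1
  · refine ((rep_hasPrim α 1).congr_ae (f' := fun x => -l * rep α 1 x - h x * rep α 0 x)
      ?_).hasDerivAt (((c1.const_mul (-l)).sub (hh.mul c0)).mono Ioo_subset_Icc_self) hx
    filter_upwards [hs, hA, rep_ae α] with x h1 h2 h3
    rw [h1] at h2
    simp only [Pi.smul_apply, PiLp.smul_apply, smul_eq_mul, h3] at h2
    linear_combination h2.2

variable {f g : ℝ → ℂ}

namespace EigSol

/-- The coupling contributes the same term to the derivatives of `|f|²` and `|g|²`: it doubles in
the sum and cancels in the difference. -/
lemma deriv_sq_f (S : EigSol L h l f g) {x : ℝ} (hx : x ∈ Ioo 0 L) :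
    HasDerivAt (fun x => ‖f x‖ ^ 2) (2 * l.re * ‖f x‖ ^ 2 - 2 * h x * (f x * conj (g x)).re) x := by
  refine (S.df x hx).norm_sq.congr_deriv ?_
  rw [Complex.inner, ← Complex.normSq_eq_norm_sq, Complex.normSq_apply]
  simp; ring

lemma deriv_sq_g (S : EigSol L h l f g) {x : ℝ} (hx : x ∈ Ioo 0 L) :
    HasDerivAt (fun x => ‖g x‖ ^ 2) (-2 * l.re * ‖g x‖ ^ 2 - 2 * h x * (f x * conj (g x)).re) x := by
  refine (S.dg x hx).norm_sq.congr_deriv ?_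
  rw [Complex.inner, ← Complex.normSq_eq_norm_sq, Complex.normSq_apply]
  simp; ring

lemma cont_energy (S : EigSol L h l f g) :
    ContinuousOn (fun x => ‖f x‖ ^ 2 + ‖g x‖ ^ 2) (Icc 0 L) :=
  (S.cf.norm.pow 2).add (S.cg.norm.pow 2)

lemma cross_le (H : IsCoupling L h ε) {x : ℝ} (hx : x ∈ Ioo 0 L) :
    |4 * h x * (f x * conj (g x)).re| ≤ 2 * ε * (‖f x‖ ^ 2 + ‖g x‖ ^ 2) := by
  have h1 := H.bound x ⟨hx.1.le, hx.2.le⟩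
  have h2 : |(f x * conj (g x)).re| ≤ ‖f x‖ * ‖g x‖ := by
    refine (Complex.abs_re_le_norm _).trans_eq ?_
    rw [norm_mul, RCLike.norm_conj]
  rw [abs_mul, abs_mul, abs_of_pos (by norm_num : (0 : ℝ) < 4)]
  have h3 : |h x| * |(f x * conj (g x)).re| ≤ ε * (‖f x‖ * ‖g x‖) :=
    mul_le_mul h1 h2 (abs_nonneg _) ((abs_nonneg _).trans h1)
  have h4 : ε * (2 * (‖f x‖ * ‖g x‖)) ≤ ε * (‖f x‖ ^ 2 + ‖g x‖ ^ 2) :=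
    mul_le_mul_of_nonneg_left (by nlinarith [sq_nonneg (‖f x‖ - ‖g x‖)]) ((abs_nonneg _).trans h1)
  linarith

lemma energy_bwd (H : IsCoupling L h ε) (S : EigSol L h l f g) {ρ : ℝ} (hρ : |l.re| ≤ ρ)
    {x y : ℝ} (hx : x ∈ Icc 0 L) (hy : y ∈ Icc 0 L) (hxy : x ≤ y) :
    ‖f x‖ ^ 2 + ‖g x‖ ^ 2 ≤ Real.exp ((2 * ρ + 2 * ε) * (y - x)) * (‖f y‖ ^ 2 + ‖g y‖ ^ 2) := by
  refine exp_growth_bwd (D := fun x => ‖f x‖ ^ 2 + ‖g x‖ ^ 2) S.cont_energy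
    (fun z hz => (S.deriv_sq_f hz).add (S.deriv_sq_g hz)) (fun z hz => ?_) hx hy hxy
  have := abs_le.1 (cross_le (f := f) (g := g) H hz)
  have h1 := abs_le.1 hρ
  nlinarith [mul_nonneg (by linarith : 0 ≤ ρ + l.re) (sq_nonneg ‖f z‖),
    mul_nonneg (by linarith : 0 ≤ ρ - l.re) (sq_nonneg ‖g z‖),
    mul_nonneg (by linarith : 0 ≤ ρ) (sq_nonneg ‖f z‖),
    mul_nonneg (by linarith : 0 ≤ ρ) (sq_nonneg ‖g z‖)]

lemma energy_fwd (H : IsCoupling L h ε) (S : EigSol L h l f g) {ρ : ℝ} (hρ : |l.re| ≤ ρ)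
    {x y : ℝ} (hx : x ∈ Icc 0 L) (hy : y ∈ Icc 0 L) (hxy : x ≤ y) :
    ‖f y‖ ^ 2 + ‖g y‖ ^ 2 ≤ Real.exp ((2 * ρ + 2 * ε) * (y - x)) * (‖f x‖ ^ 2 + ‖g x‖ ^ 2) := by
  refine exp_growth_fwd (D := fun x => ‖f x‖ ^ 2 + ‖g x‖ ^ 2) S.cont_energy
    (fun z hz => (S.deriv_sq_f hz).add (S.deriv_sq_g hz)) (fun z hz => ?_) hx hy hxy
  have := abs_le.1 (cross_le (f := f) (g := g) H hz)
  have h1 := abs_le.1 hρ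
  nlinarith [mul_nonneg (by linarith : 0 ≤ ρ - l.re) (sq_nonneg ‖f z‖),
    mul_nonneg (by linarith : 0 ≤ ρ + l.re) (sq_nonneg ‖g z‖),
    mul_nonneg (by linarith : 0 ≤ ρ) (sq_nonneg ‖f z‖),
    mul_nonneg (by linarith : 0 ≤ ρ) (sq_nonneg ‖g z‖)]

/-- Eigenvalues have nonnegative real part. -/
lemma re_nonneg (hL : 0 ≤ L) (S : EigSol L h l f g) (hκ0 : 0 ≤ κ) (hκ : κ < 1) (h0 : f 0 = -(κ : ℂ) * g 0)
    (h1 : f L = -g L) (hne : g 0 ≠ 0) : 0 ≤ l.re := by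
  by_contra hneg
  push Not at hneg
  -- If `re l < 0` this difference is nonincreasing; but it is `(κ² - 1) |g 0|² < 0` at `0` and
  -- vanishes at `L`.
  have hd : ∀ z ∈ Ioo 0 L, HasDerivAt (fun x => ‖f x‖ ^ 2 - ‖g x‖ ^ 2)
      (2 * l.re * (‖f z‖ ^ 2 + ‖g z‖ ^ 2)) z := fun z hz =>
    ((S.deriv_sq_f hz).sub (S.deriv_sq_g hz)).congr_deriv (by ring)
  have hm : AntitoneOn (fun x => ‖f x‖ ^ 2 - ‖g x‖ ^ 2) (Icc 0 L) := by
    refine antitoneOn_of_deriv_nonpos (convex_Icc 0 L) ((S.cf.norm.pow 2).sub (S.cg.norm.pow 2)) ?_ ?_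
    · rw [interior_Icc]; exact fun z hz => (hd z hz).differentiableAt.differentiableWithinAt
    · rw [interior_Icc]; intro z hz
      rw [(hd z hz).deriv]
      exact mul_nonpos_of_nonpos_of_nonneg (by linarith) (by positivity)
  have h2 := hm ⟨le_rfl, hL⟩ ⟨hL, le_rfl⟩ hL
  simp only [h0, h1, norm_neg, neg_mul, norm_mul, Complex.norm_real, Real.norm_eq_abs,
    abs_of_nonneg hκ0] at h2
  have h3 : 0 < ‖g 0‖ ^ 2 := by positivity
  have : κ ^ 2 < 1 := by nlinarith
  nlinarith

/-! ### Solutions with the condition at `L`: growth, variation of constants, localization of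
eigenvalues -/

section target
variable (hL : 0 < L) (H : IsCoupling L h ε) (S : EigSol L h l f g) (hε : ε * L ≤ 1 / 10)
  (hre : 0 ≤ l.re) (h1 : f L = -g L)
include hL H S hε hre h1

/-- The energy estimate is run backwards from `L`, where the energy is `2 |g L|²`. Since `exp (2εL)
≤ 3`, the squared constant is `6 ≤ (5/2)²`. -/
lemma bound_of_end {x : ℝ} (hx : x ∈ Icc 0 L) :
    ‖f x‖ ≤ 5 / 2 * Real.exp (l.re * (L - x)) * ‖g L‖ ∧
    ‖g x‖ ≤ 5 / 2 * Real.exp (l.re * (L - x)) * ‖g L‖ := by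
  have h2 := S.energy_bwd H (le_of_eq (abs_of_nonneg hre)) hx ⟨hL.le, le_rfl⟩ hx.2
  rw [h1, norm_neg] at h2
  have hε0 := H.nonneg hL.le
  have h3 : Real.exp (2 * ε * (L - x)) ≤ 3 := by
    refine le_trans ?_ Real.exp_one_lt_three.le
    rw [Real.exp_le_exp]; nlinarith [hx.1]
  have h4 : Real.exp ((2 * l.re + 2 * ε) * (L - x))
      = Real.exp (l.re * (L - x)) ^ 2 * Real.exp (2 * ε * (L - x)) := by
    rw [← Real.exp_nat_mul, ← Real.exp_add]; push_cast; ring_nf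
  have h5 : ‖f x‖ ^ 2 + ‖g x‖ ^ 2 ≤ (5 / 2 * Real.exp (l.re * (L - x)) * ‖g L‖) ^ 2 := by
    rw [h4] at h2
    have : Real.exp (l.re * (L - x)) ^ 2 * Real.exp (2 * ε * (L - x)) * (‖g L‖ ^ 2 + ‖g L‖ ^ 2)
      ≤ Real.exp (l.re * (L - x)) ^ 2 * 3 * (‖g L‖ ^ 2 + ‖g L‖ ^ 2) := by gcongr
    nlinarith [sq_nonneg (Real.exp (l.re * (L - x)) * ‖g L‖)]
  constructor
  · exact (abs_le_of_sq_le_sq' (by nlinarith [sq_nonneg ‖g x‖]) (by positivity)).2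
  · exact (abs_le_of_sq_le_sq' (by nlinarith [sq_nonneg ‖f x‖]) (by positivity)).2

/-- Variation of constants: the derivative of `exp (-l (L - x)) g x` contains only the coupling, and
the weight exactly compensates the growth allowed by `bound_of_end`. -/
lemma end_sub_le : ‖g L - Complex.exp (-(l * L)) * g 0‖ ≤ 5 / 2 * (ε * L) * ‖g L‖ := by
  have hd : ∀ x ∈ Ioo 0 L, HasDerivAt (fun x : ℝ => Complex.exp (-(l * (L - x))) * g x)
      (-(h x * Complex.exp (-(l * (L - x))) * f x)) x := fun x hx => by
    have e : HasDerivAt (fun x : ℝ => -(l * ((L : ℂ) - x))) (-(l * (0 - 1))) x :=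
      (((hasDerivAt_const x (L : ℂ)).sub (hasDerivAt_id x).ofReal_comp).const_mul l).neg
    refine (e.cexp.mul (S.dg x hx)).congr_deriv ?_
    ring
  have h2 := norm_sub_le_of_deriv (C := 5 / 2 * ε * ‖g L‖)
    ((by fun_prop : Continuous fun x : ℝ => Complex.exp (-(l * (L - x)))).continuousOn.mul S.cg) hd
    (fun x hx => ?_) (x := 0) (y := L) ⟨le_rfl, hL.le⟩ ⟨hL.le, le_rfl⟩
  · simp only [Pi.mul_apply, sub_self, mul_zero, neg_zero, Complex.exp_zero, one_mul, Complex.ofReal_zero,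
      sub_zero] at h2
    refine h2.trans_eq (by ring)
  · have hx' : x ∈ Icc 0 L := ⟨hx.1.le, hx.2.le⟩
    have h3 := (S.bound_of_end hL H hε hre h1 hx').1
    have h4 := H.bound x hx'
    have hε0 := H.nonneg hL.le
    rw [norm_neg, norm_mul, norm_mul, Complex.norm_real, Complex.norm_exp, Real.norm_eq_abs]
    have e : (-(l * (L - x))).re = -(l.re * (L - x)) := by
      simp [Complex.mul_re]
    rw [e]
    calc |h x| * Real.exp (-(l.re * (L - x))) * ‖f x‖
        ≤ ε * Real.exp (-(l.re * (L - x))) * (5 / 2 * Real.exp (l.re * (L - x)) * ‖g L‖) := by gcongr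
      _ = 5 / 2 * ε * ‖g L‖ * (Real.exp (-(l.re * (L - x))) * Real.exp (l.re * (L - x))) := by ring
      _ = _ := by rw [← Real.exp_add]; simp

/-- The companion for `f`, multiplied by an extra `exp (-lL)`. With `f 0 = -κ g 0` it then contains
the same `exp (-lL) g 0` as `end_sub_le`, so that the two combine into a relation on `g L` alone. -/
lemma end_sub_le' : ‖Complex.exp (-(2 * l * L)) * f L - Complex.exp (-(l * L)) * f 0‖
    ≤ 5 / 2 * (ε * L) * ‖g L‖ := by
  have hd : ∀ x ∈ Ioo 0 L, HasDerivAt (fun x : ℝ => Complex.exp (-(l * (L + x))) * f x)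
      (-(h x * Complex.exp (-(l * (L + x))) * g x)) x := fun x hx => by
    have e : HasDerivAt (fun x : ℝ => -(l * ((L : ℂ) + x))) (-(l * (0 + 1))) x :=
      (((hasDerivAt_const x (L : ℂ)).add (hasDerivAt_id x).ofReal_comp).const_mul l).neg
    refine (e.cexp.mul (S.df x hx)).congr_deriv ?_
    ring
  have h2 := norm_sub_le_of_deriv (C := 5 / 2 * ε * ‖g L‖)
    ((by fun_prop : Continuous fun x : ℝ => Complex.exp (-(l * (L + x)))).continuousOn.mul S.cf) hd
    (fun x hx => ?_) (x := 0) (y := L) ⟨le_rfl, hL.le⟩ ⟨hL.le, le_rfl⟩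
  · rw [Pi.mul_apply, Pi.mul_apply, show -(l * ((L : ℂ) + (0 : ℝ))) = -(l * L) by simp,
      show -(l * ((L : ℂ) + L)) = -(2 * l * L) by ring] at h2
    refine h2.trans_eq (by ring)
  · have hx' : x ∈ Icc 0 L := ⟨hx.1.le, hx.2.le⟩
    have h3 := (S.bound_of_end hL H hε hre h1 hx').2
    have h4 := H.bound x hx'
    have hx0 : 0 ≤ x := hx.1.le
    have hε0 := H.nonneg hL.le
    rw [norm_neg, norm_mul, norm_mul, Complex.norm_real, Complex.norm_exp, Real.norm_eq_abs]
    have e : (-(l * (L + x))).re = -(l.re * (L + x)) := by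
      simp [Complex.mul_re]
    rw [e]
    calc |h x| * Real.exp (-(l.re * (L + x))) * ‖g x‖
        ≤ ε * Real.exp (-(l.re * (L - x))) * (5 / 2 * Real.exp (l.re * (L - x)) * ‖g L‖) := by
          gcongr
          linarith
      _ = 5 / 2 * ε * ‖g L‖ * (Real.exp (-(l.re * (L - x))) * Real.exp (l.re * (L - x))) := by ring
      _ = _ := by rw [← Real.exp_add]; simp

/-- Localization of the eigenvalues. -/
lemma exp_eigenvalue (hκ0 : 0 ≤ κ) (hκ : κ ≤ 1) (h0 : f 0 = -(κ : ℂ) * g 0) (hne : g L ≠ 0) :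
    ‖Complex.exp (-(2 * l * L)) - κ‖ ≤ 5 * (ε * L) := by
  have e1 := S.end_sub_le hL H hε hre h1
  have e2 := S.end_sub_le' hL H hε hre h1
  rw [h1, h0] at e2
  have e3 : (Complex.exp (-(2 * l * L)) - κ) * g L
      = -(Complex.exp (-(2 * l * L)) * -g L - Complex.exp (-(l * L)) * (-κ * g 0))
        - κ * (g L - Complex.exp (-(l * L)) * g 0) := by ring
  have e4 : ‖(Complex.exp (-(2 * l * L)) - κ) * g L‖ ≤ 5 * (ε * L) * ‖g L‖ := by
    rw [e3]
    refine (norm_sub_le _ _).trans ?_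
    rw [norm_neg, norm_mul (κ : ℂ), Complex.norm_real, Real.norm_of_nonneg hκ0]
    have := mul_le_mul_of_nonneg_right hκ (norm_nonneg (g L - Complex.exp (-(l * L)) * g 0))
    linarith
  rw [norm_mul] at e4
  exact le_of_mul_le_mul_right e4 (norm_pos_iff.2 hne)

/-- The error in `end_sub_le` is at most `|g L| / 4` and is absorbed on the left. -/
lemma end_le : Real.exp (l.re * L) * ‖g L‖ ≤ 2 * ‖g 0‖ := by
  have e1 := S.end_sub_le hL H hε hre h1
  have e2 : ‖g L‖ ≤ ‖g L - Complex.exp (-(l * L)) * g 0‖ + ‖Complex.exp (-(l * L)) * g 0‖ := by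
    simpa using norm_add_le (g L - Complex.exp (-(l * L)) * g 0) (Complex.exp (-(l * L)) * g 0)
  have e : (-(l * L)).re = -(l.re * L) := by simp [Complex.mul_re]
  rw [norm_mul, Complex.norm_exp, e] at e2
  have e3 : ‖g L‖ ≤ 2 * (Real.exp (-(l.re * L)) * ‖g 0‖) := by
    nlinarith [norm_nonneg (g L), mul_le_mul_of_nonneg_right hε (norm_nonneg (g L))]
  calc Real.exp (l.re * L) * ‖g L‖
      ≤ Real.exp (l.re * L) * (2 * (Real.exp (-(l.re * L)) * ‖g 0‖)) := by gcongr
    _ = (Real.exp (l.re * L) * Real.exp (-(l.re * L))) * (2 * ‖g 0‖) := by ring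
    _ = _ := by rw [← Real.exp_add]; simp

end target

end EigSol

end


/-! ### Moments of eigenfunctions against the control profile -/

/-- Bounds for the coupling coefficient `h` with derivative `h'` and primitive `H`. -/
structure IsSmallCoupling (L : ℝ) (h h' H : ℝ → ℝ) (ε : ℝ) : Prop extends IsCoupling L h ε where
  pos : 0 < ε
  small : ε * L ≤ 1 / 4000
  deriv : ∀ x ∈ Ioo 0 L, HasDerivAt h (h' x) x
  bound' : ∀ x ∈ Ioo 0 L, |h' x| ≤ 2 * ε ^ 2
  upper : ∀ x ∈ Icc 0 L, h x ≤ -(ε / 8)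
  contPrim : ContinuousOn H (Icc 0 L)
  derivPrim : ∀ x ∈ Ioo 0 L, HasDerivAt H (h x) x
  prim_zero : H 0 = 0

section
variable {L κ : ℝ} {h h' H : ℝ → ℝ} {ε : ℝ} {l : ℂ} {f g : ℝ → ℂ}

lemma IsSmallCoupling.prim_bounds (hL : 0 ≤ L) (K : IsSmallCoupling L h h' H ε) {x : ℝ}
    (hx : x ∈ Icc 0 L) : H x ≤ 0 ∧ -(1 / 4000) ≤ H x := by
  constructor
  · have hm : AntitoneOn H (Icc 0 L) := by
      refine antitoneOn_of_deriv_nonpos (convex_Icc 0 L) K.contPrim ?_ ?_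
      · rw [interior_Icc]; exact fun z hz => (K.derivPrim z hz).differentiableAt.differentiableWithinAt
      · rw [interior_Icc]; intro z hz
        rw [(K.derivPrim z hz).deriv]
        have := K.upper z ⟨hz.1.le, hz.2.le⟩
        linarith [K.pos]
    have := hm ⟨le_rfl, hL⟩ hx hx.1
    rwa [K.prim_zero] at this
  · have := norm_sub_le_of_deriv K.contPrim K.derivPrim
      (fun z hz => K.bound z ⟨hz.1.le, hz.2.le⟩) ⟨le_rfl, hL⟩ hx
    rw [K.prim_zero, sub_zero, Real.norm_eq_abs] at this
    linarith [(abs_le.1 this).1, K.small]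

lemma IsSmallCoupling.prim_end (hL : 0 ≤ L) (K : IsSmallCoupling L h h' H ε) :
    H L ≤ -(ε * L / 8) := by
  have hd : ∀ z ∈ Ioo 0 L, HasDerivAt (fun x => H x + ε / 8 * x) (h z + ε / 8) z := fun z hz =>
    ((K.derivPrim z hz).add ((hasDerivAt_id z).const_mul (ε / 8))).congr_deriv (by simp)
  have hm : AntitoneOn (fun x => H x + ε / 8 * x) (Icc 0 L) := by
    refine antitoneOn_of_deriv_nonpos (convex_Icc 0 L)
      (K.contPrim.add (by fun_prop)) ?_ ?_
    · rw [interior_Icc]; exact fun z hz => (hd z hz).differentiableAt.differentiableWithinAt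
    · rw [interior_Icc]; intro z hz
      rw [(hd z hz).deriv]
      linarith [K.upper z ⟨hz.1.le, hz.2.le⟩]
  have := hm ⟨le_rfl, hL⟩ ⟨hL, le_rfl⟩ hL
  simp only [K.prim_zero] at this
  linarith

lemma norm_integral_mes_le (hL : 0 ≤ L) {u : ℝ → ℂ} {C : ℝ} (hu : ∀ x ∈ Ioo 0 L, ‖u x‖ ≤ C) :
    ‖∫ x, u x ∂(mes L)‖ ≤ C * L := by
  have := norm_setIntegral_le_of_norm_le_const (μ := volume) (s := Ioo 0 L) (f := u) (C := C)
    (by simp) hu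
  simpa [hL] using this

lemma integrable_of_continuousOn {u : ℝ → ℂ} (hu : ContinuousOn u (Icc 0 L)) :
    Integrable u (mes L) :=
  (hu.integrableOn_Icc (μ := volume)).mono_set Ioo_subset_Icc_self

namespace EigSol

/-- The moment of an eigenfunction against `exp (3 H)`. -/
lemma moment_eq (hL : 0 < L) (K : IsSmallCoupling L h h' H ε) (S : EigSol L h l f g) :
    l * ∫ x, Real.exp (3 * H x) * (f x + g x) ∂(mes L)
      = Real.exp (3 * H L) * (f L - g L) - (f 0 - g 0)
        - 4 * ∫ x, h x * Real.exp (3 * H x) * (f x - g x) ∂(mes L) := by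
  have ce : ContinuousOn (fun x => (Real.exp (3 * H x) : ℂ)) (Icc 0 L) :=
    Complex.continuous_ofReal.comp_continuousOn
      (Real.continuous_exp.comp_continuousOn (continuousOn_const.mul K.contPrim))
  have ch : ContinuousOn (fun x => (h x : ℂ)) (Icc 0 L) :=
    Complex.continuous_ofReal.comp_continuousOn K.cont
  have c1 : ContinuousOn (fun x => (Real.exp (3 * H x) : ℂ) * (f x + g x)) (Icc 0 L) :=
    ce.mul (S.cf.add S.cg)
  have c2 : ContinuousOn (fun x => (h x : ℂ) * Real.exp (3 * H x) * (f x - g x)) (Icc 0 L) :=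
    (ch.mul ce).mul (S.cf.sub S.cg)
  -- In the derivative of `exp (3H) (f - g)` the weight contributes `3h` and the coupling `h`, hence
  -- the `4`.
  have hP : HasPrim L (fun x => (Real.exp (3 * H x) : ℂ) * (f x - g x))
      (fun x => l * ((Real.exp (3 * H x) : ℂ) * (f x + g x))
        + 4 * ((h x : ℂ) * Real.exp (3 * H x) * (f x - g x))) := by
    refine HasPrim.of_hasDerivAt (ce.mul (S.cf.sub S.cg)) (fun x hx => ?_)
      (integrable_of_continuousOn ((c1.const_mul l).add (c2.const_mul 4)))
    have e := (((K.derivPrim x hx).const_mul 3).exp).ofReal_comp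
    refine (e.mul ((S.df x hx).sub (S.dg x hx))).congr_deriv ?_
    push_cast [Function.comp_apply]; simp only [Pi.sub_apply]; ring
  have h2 := hP.2 L ⟨hL.le, le_rfl⟩
  rw [integral_mes_full hL.le, integral_add ((integrable_of_continuousOn c1).const_mul _)
    ((integrable_of_continuousOn c2).const_mul _), integral_const_mul, integral_const_mul] at h2
  simp only [K.prim_zero, mul_zero, Real.exp_zero, Complex.ofReal_one, one_mul] at h2
  linear_combination -h2

/-! ### Upper and lower bounds for the moments of target eigenfunctions -/

section target
variable (hL : 0 < L) (K : IsSmallCoupling L h h' H ε) (S : EigSol L h l f g)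
  (hre : 0 ≤ l.re) (h1 : f L = -g L) (h0 : f 0 = -(κ : ℂ) * g 0)
include hL K S hre h1 h0

/-- In `moment_eq` the end `0` gives `(1 + κ) g 0`, the end `L` at most `2 |g L|`, and the integral
is `O(εL)`. As `|g L|` is at most `exp (-re l L) |g 0|` up to `5 εL |g 0|`, the `50` is `2 · 5 + 4 ·
10`. -/
lemma moment_sub_le :
    ‖l * (∫ x, Real.exp (3 * H x) * (f x + g x) ∂(mes L)) - (1 + κ) * g 0‖
      ≤ (2 * Real.exp (-(l.re * L)) + 50 * (ε * L)) * ‖g 0‖ := by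
  have hε : ε * L ≤ 1 / 10 := K.small.trans (by norm_num)
  have hε0 := K.pos
  have e1 := S.end_sub_le hL K.toIsCoupling hε hre h1
  have e2 := S.end_le hL K.toIsCoupling hε hre h1
  have e3 : ‖g L‖ ≤ 2 * ‖g 0‖ := by
    refine le_trans ?_ e2
    exact le_mul_of_one_le_left (norm_nonneg _) (Real.one_le_exp (by positivity))
  have e4 : ‖g L‖ ≤ Real.exp (-(l.re * L)) * ‖g 0‖ + 5 * (ε * L) * ‖g 0‖ := by
    have e5 : ‖g L‖ ≤ ‖g L - Complex.exp (-(l * L)) * g 0‖ + ‖Complex.exp (-(l * L)) * g 0‖ := by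
      simpa using norm_add_le (g L - Complex.exp (-(l * L)) * g 0) (Complex.exp (-(l * L)) * g 0)
    have e : (-(l * L)).re = -(l.re * L) := by simp [Complex.mul_re]
    rw [norm_mul, Complex.norm_exp, e] at e5
    have : 5 / 2 * (ε * L) * ‖g L‖ ≤ 5 / 2 * (ε * L) * (2 * ‖g 0‖) := by gcongr
    linarith
  have e6 : ‖∫ x, h x * Real.exp (3 * H x) * (f x - g x) ∂(mes L)‖ ≤ 10 * ε * ‖g 0‖ * L := by
    refine norm_integral_mes_le hL.le fun x hx => ?_
    have hx' : x ∈ Icc 0 L := ⟨hx.1.le, hx.2.le⟩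
    have b := S.bound_of_end hL K.toIsCoupling hε hre h1 hx'
    have b3 : ‖f x - g x‖ ≤ 10 * ‖g 0‖ := by
      have : Real.exp (l.re * (L - x)) ≤ Real.exp (l.re * L) := by
        rw [Real.exp_le_exp]; nlinarith [hx.1]
      have b4 : Real.exp (l.re * (L - x)) * ‖g L‖ ≤ Real.exp (l.re * L) * ‖g L‖ := by gcongr
      refine (norm_sub_le _ _).trans ?_
      linarith [b.1, b.2]
    rw [norm_mul, norm_mul, Complex.norm_real, Complex.norm_real, Real.norm_eq_abs,
      Real.norm_of_nonneg (Real.exp_pos _).le]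
    have b5 : Real.exp (3 * H x) ≤ 1 := by
      rw [Real.exp_le_one_iff]; linarith [(K.prim_bounds hL.le hx').1]
    calc |h x| * Real.exp (3 * H x) * ‖f x - g x‖ ≤ ε * 1 * (10 * ‖g 0‖) := by
          gcongr; exact K.bound x hx'
      _ = _ := by ring
  rw [S.moment_eq hL K, h1, h0]
  have e7 : (Real.exp (3 * H L) : ℂ) * (-g L - g L) - (-(κ : ℂ) * g 0 - g 0)
      - 4 * (∫ x, h x * Real.exp (3 * H x) * (f x - g x) ∂(mes L)) - (1 + κ) * g 0
      = -(2 * Real.exp (3 * H L) * g L)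
        - 4 * ∫ x, h x * Real.exp (3 * H x) * (f x - g x) ∂(mes L) := by ring
  rw [e7]
  refine (norm_sub_le _ _).trans ?_
  rw [norm_neg, norm_mul, norm_mul, norm_mul, Complex.norm_real,
    Real.norm_of_nonneg (Real.exp_pos _).le]
  have b5 : Real.exp (3 * H L) ≤ 1 := by
    rw [Real.exp_le_one_iff]; linarith [(K.prim_bounds hL.le ⟨hL.le, le_rfl⟩).1]
  have b6 : 2 * Real.exp (3 * H L) * ‖g L‖ ≤ 2 * 1 * ‖g L‖ := by gcongr
  rw [Complex.norm_ofNat, Complex.norm_ofNat]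
  linarith

variable (hq : 0 < κ) (hκ : κ < 1) (hne : g L ≠ 0)
include hq hκ hne

/-- The localization `exp_eigenvalue`, in modulus. -/
lemma exp_re_le : Real.exp (-(l.re * L)) ^ 2 ≤ κ + 5 * (ε * L) ∧
    κ - 5 * (ε * L) ≤ Real.exp (-(l.re * L)) ^ 2 := by
  have hε : ε * L ≤ 1 / 10 := K.small.trans (by norm_num)
  have e := S.exp_eigenvalue hL K.toIsCoupling hε hre h1 hq.le hκ.le h0 hne
  have e1 : ‖Complex.exp (-(2 * l * L))‖ = Real.exp (-(l.re * L)) ^ 2 := by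
    rw [Complex.norm_exp, ← Real.exp_nat_mul]
    congr 1
    simp [Complex.mul_re]; ring
  have e2 := norm_sub_norm_le (Complex.exp (-(2 * l * L))) κ
  have e3 := norm_sub_norm_le (κ : ℂ) (Complex.exp (-(2 * l * L)))
  rw [norm_sub_rev (κ : ℂ)] at e3
  rw [e1, Complex.norm_real, Real.norm_of_nonneg hq.le] at e2 e3
  constructor <;> linarith

/-- With `q = √κ` one has `exp (-re l L) ≈ q`, and `1 + q² - 2q = (1 - q)²` is the margin left by
`moment_sub_le`. The shift by `s ≥ 0`, later produced by `ν f₀`, has the sign of the dominant term.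
-/
lemma moment_lower (hκ2 : 200 * (ε * L) ≤ √κ * (1 - √κ) ^ 2) {s : ℝ} (hs : 0 ≤ s) :
    (1 - √κ) ^ 2 / 2 * ‖g 0‖
      ≤ ‖l * (∫ x, Real.exp (3 * H x) * (f x + g x) ∂(mes L)) + s * g 0‖ := by
  have e1 := S.moment_sub_le hL K hre h1 h0
  have e2 := (S.exp_re_le hL K hre h1 h0 hq hκ hne).1
  set q := √κ with hqdef
  have hq0 : 0 < q := Real.sqrt_pos.2 hq
  have hqq : q ^ 2 = κ := Real.sq_sqrt hq.le
  have hq1 : q < 1 := by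
    rw [hqdef, Real.sqrt_lt' one_pos]; simpa using hκ
  have heL : 0 < ε * L := mul_pos K.pos hL
  -- The hypothesis reads `5εL ≤ q (1 - q)² / 40`, which is the double product in the square of the
  -- right-hand side.
  have e3 : Real.exp (-(l.re * L)) ≤ q + (1 - q) ^ 2 / 80 := by
    refine (abs_le_of_sq_le_sq' ?_ (by positivity)).2
    nlinarith [mul_pos hq0 heL, sq_nonneg ((1 - q) ^ 2)]
  have e4 : ((1 + κ + s : ℝ) : ℂ) * g 0
      = (l * (∫ x, Real.exp (3 * H x) * (f x + g x) ∂(mes L)) + s * g 0)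
      - (l * (∫ x, Real.exp (3 * H x) * (f x + g x) ∂(mes L)) - (1 + κ) * g 0) := by
    push_cast; ring
  have e5 : (1 + κ + s) * ‖g 0‖ ≤ ‖l * (∫ x, Real.exp (3 * H x) * (f x + g x) ∂(mes L)) + s * g 0‖
      + (2 * Real.exp (-(l.re * L)) + 50 * (ε * L)) * ‖g 0‖ := by
    have : ‖((1 + κ + s : ℝ) : ℂ) * g 0‖ = (1 + κ + s) * ‖g 0‖ := by
      rw [norm_mul, Complex.norm_real, Real.norm_of_nonneg (by positivity)]
    rw [← this, e4]
    exact (norm_sub_le _ _).trans (by linarith)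
  -- Of the margin `(1 - q)²`, the previous estimate costs `1/40` and `50 εL` at most `1/4`.
  have e6 : (1 - q) ^ 2 / 2 ≤ (1 + κ + s) - (2 * Real.exp (-(l.re * L)) + 50 * (ε * L)) := by
    have : q * (1 - q) ^ 2 ≤ 1 * (1 - q) ^ 2 := by gcongr
    rw [← hqq]
    nlinarith
  have := mul_le_mul_of_nonneg_right e6 (norm_nonneg (g 0))
  linarith

omit hq hκ hne in
-- The value `κ = 1` is allowed, so that the bound also serves the open-loop family.
lemma moment_upper (hκ1 : |κ| ≤ 1) :
    ‖l * ∫ x, Real.exp (3 * H x) * (f x + g x) ∂(mes L)‖ ≤ 10 * ‖g 0‖ := by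
  have e1 := S.moment_sub_le hL K hre h1 h0
  have e2 : Real.exp (-(l.re * L)) ≤ 1 := by
    rw [Real.exp_le_one_iff]; have := mul_nonneg hre hL.le; linarith
  have e3 : ‖(1 + κ : ℂ) * g 0‖ ≤ 2 * ‖g 0‖ := by
    rw [norm_mul]
    gcongr
    refine (norm_add_le _ _).trans ?_
    rw [Complex.norm_real, Real.norm_eq_abs, norm_one]; linarith
  have e4 := norm_add_le (l * (∫ x, Real.exp (3 * H x) * (f x + g x) ∂(mes L)) - (1 + κ) * g 0)
    ((1 + κ) * g 0)
  rw [sub_add_cancel] at e4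
  have e5 : (2 * Real.exp (-(l.re * L)) + 50 * (ε * L)) * ‖g 0‖ ≤ 3 * ‖g 0‖ := by
    gcongr
    linarith [K.small]
  linarith [norm_nonneg (g 0)]

end target

end EigSol

end


/-- Real form of the eigenvalue equation for a purely imaginary eigenvalue `iω`. -/
structure OscSol (L : ℝ) (h : ℝ → ℝ) (ω : ℝ) (X Y : ℝ → ℝ) : Prop where
  cX : ContinuousOn X (Icc 0 L)
  cY : ContinuousOn Y (Icc 0 L)
  dX : ∀ x ∈ Ioo 0 L, HasDerivAt X (-ω * Y x + h x * X x) x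
  dY : ∀ x ∈ Ioo 0 L, HasDerivAt Y (ω * X x - h x * Y x) x
  Y0 : Y 0 = 0
  YL : Y L = 0

/-! ### Frequency gap, end value and moment for imaginary eigenvalues -/

namespace OscSol
variable {L : ℝ} {h h' H : ℝ → ℝ} {ε ω : ℝ} {X Y : ℝ → ℝ}

lemma sq_le (hL : 0 < L) (K : IsSmallCoupling L h h' H ε) (S : OscSol L h ω X Y) {x : ℝ}
    (hx : x ∈ Icc 0 L) : X x ^ 2 + Y x ^ 2 ≤ 3 * X 0 ^ 2 := by
  have hd : ∀ z ∈ Ioo 0 L, HasDerivAt (fun x => X x ^ 2 + Y x ^ 2)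
      (2 * h z * (X z ^ 2 - Y z ^ 2)) z := fun z hz =>
    (((S.dX z hz).pow 2).add ((S.dY z hz).pow 2)).congr_deriv (by push_cast; ring)
  have h1 := exp_growth_fwd (D := fun x => X x ^ 2 + Y x ^ 2) (K := 2 * ε)
    ((S.cX.pow 2).add (S.cY.pow 2)) hd (fun z hz => ?_) ⟨le_rfl, hL.le⟩ hx hx.1
  · simp only [S.Y0] at h1
    have h2 : Real.exp (2 * ε * (x - 0)) ≤ 3 := by
      refine le_trans ?_ Real.exp_one_lt_three.le
      rw [Real.exp_le_exp]; nlinarith [hx.2, K.small, K.pos]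
    nlinarith [sq_nonneg (X 0)]
  · have := abs_le.1 (K.bound z ⟨hz.1.le, hz.2.le⟩)
    nlinarith [mul_nonneg (by linarith : 0 ≤ ε - h z) (sq_nonneg (X z)),
      mul_nonneg (by linarith : 0 ≤ ε + h z) (sq_nonneg (Y z))]

lemma abs_le (hL : 0 < L) (K : IsSmallCoupling L h h' H ε) (S : OscSol L h ω X Y) {x : ℝ}
    (hx : x ∈ Icc 0 L) : |X x| ≤ 2 * |X 0| ∧ |Y x| ≤ 2 * |X 0| := by
  have h1 := S.sq_le hL K hx
  have h2 : (2 * |X 0|) ^ 2 = 4 * X 0 ^ 2 := by rw [mul_pow, sq_abs]; norm_num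
  constructor <;> refine abs_le_of_sq_le_sq ?_ (by positivity) <;> rw [h2] <;>
    nlinarith [sq_nonneg (X x), sq_nonneg (Y x), sq_nonneg (X 0)]

lemma cont_exp {H : ℝ → ℝ} (hH : ContinuousOn H (Icc 0 L)) (a : ℝ) :
    ContinuousOn (fun x => Real.exp (a * H x)) (Icc 0 L) :=
  Real.continuous_exp.comp_continuousOn (continuousOn_const.mul hH)

/-- Nonzero eigenvalues are bounded away from `0`. -/
lemma freq_lower (hL : 0 < L) (K : IsSmallCoupling L h h' H ε) (S : OscSol L h ω X Y)
    (hω : ω ≠ 0) (hX : X 0 ≠ 0) : 2 / 5 ≤ |ω| * L := by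
  have de : ∀ a : ℝ, ∀ x ∈ Ioo 0 L, HasDerivAt (fun x => Real.exp (a * H x))
      (Real.exp (a * H x) * (a * h x)) x := fun a x hx => ((K.derivPrim x hx).const_mul a).exp
  -- The integrating factors `exp H` and `exp (-H)` remove the coupling from the two equations.
  have dY' : ∀ x ∈ Ioo 0 L, HasDerivAt (fun x => Real.exp (1 * H x) * Y x)
      (ω * (Real.exp (1 * H x) * X x)) x := fun x hx =>
    ((de 1 x hx).mul (S.dY x hx)).congr_deriv (by ring)
  have dX' : ∀ x ∈ Ioo 0 L, HasDerivAt (fun x => Real.exp ((-1) * H x) * X x)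
      (-(ω * (Real.exp ((-1) * H x) * Y x))) x := fun x hx =>
    ((de (-1) x hx).mul (S.dX x hx)).congr_deriv (by ring)
  have cY' := (cont_exp K.contPrim 1).mul S.cY
  have cX' := (cont_exp K.contPrim (-1)).mul S.cX
  have be : ∀ x ∈ Icc 0 L, Real.exp (1 * H x) ≤ 1 ∧ Real.exp ((-1) * H x) ≤ 2 ∧
      Real.exp ((-1) * H x) ≤ 2 * Real.exp (1 * H x) := fun x hx => by
    obtain ⟨h1, h2⟩ := K.prim_bounds hL.le hx
    have h3 : Real.exp ((-1) * H x) ≤ 6 / 5 := by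
      have := Real.exp_bound_div_one_sub_of_interval (x := (-1) * H x) (by linarith) (by linarith)
      refine this.trans ?_
      rw [div_le_div_iff₀ (by linarith) (by norm_num)]; linarith
    have h4 : 9 / 10 ≤ Real.exp (1 * H x) := by
      have := Real.add_one_le_exp (1 * H x); linarith
    refine ⟨by rw [Real.exp_le_one_iff]; linarith, by linarith, by linarith⟩
  -- Rolle for `exp H · Y`, which vanishes at both ends: since `ω ≠ 0`, `X` has a zero `ξ`.
  obtain ⟨ξ, hξ, hξ0⟩ := exists_hasDerivAt_eq_zero hL cY' (by
    simp [S.Y0, S.YL]) dY'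
  have hXξ : X ξ = 0 := by
    simpa [hω, Real.exp_ne_zero] using hξ0
  have bY : ∀ x ∈ Icc 0 L, Real.exp (1 * H x) * |Y x| ≤ |ω| * (2 * |X 0|) * L := fun x hx => by
    have := norm_sub_le_of_deriv (C := |ω| * (2 * |X 0|)) cY' dY' (fun z hz => ?_)
      ⟨le_rfl, hL.le⟩ hx
    · simpa [S.Y0, abs_mul] using this
    · have hz' : z ∈ Icc 0 L := ⟨hz.1.le, hz.2.le⟩
      rw [Real.norm_eq_abs, abs_mul, abs_mul, Real.abs_exp]
      have h1 := (S.abs_le hL K hz').1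
      have h2 := (be z hz').1
      calc |ω| * (Real.exp (1 * H z) * |X z|) ≤ |ω| * (1 * (2 * |X 0|)) := by gcongr
        _ = _ := by ring
  -- Going from `0` to the zero `ξ`, the component `X` must lose all of `|X 0|`, while its variation
  -- is at most `4 (|ω| L)² |X 0|`; this is impossible if `|ω| L < 2/5`.
  have bX := norm_sub_le_of_deriv (C := |ω| * (2 * (|ω| * (2 * |X 0|) * L))) cX' dX' (fun z hz => ?_)
      ⟨hξ.1.le, hξ.2.le⟩ ⟨le_rfl, hL.le⟩
  · simp only [Pi.mul_apply, K.prim_zero, mul_zero, Real.exp_zero, one_mul, hXξ, sub_zero,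
      Real.norm_eq_abs] at bX
    have h1 : 0 < |X 0| := abs_pos.2 hX
    by_contra hcon
    push Not at hcon
    have h2 : 0 ≤ |ω| * L := by positivity
    have h3 : |ω| * (2 * (|ω| * (2 * |X 0|) * L)) * L = 4 * (|ω| * L) ^ 2 * |X 0| := by ring
    rw [h3] at bX
    have h4 : (|ω| * L) ^ 2 ≤ (2 / 5) ^ 2 := pow_le_pow_left₀ h2 hcon.le 2
    nlinarith
  · have hz' : z ∈ Icc 0 L := ⟨hz.1.le, hz.2.le⟩
    rw [norm_neg, Real.norm_eq_abs, abs_mul, abs_mul, Real.abs_exp]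
    refine mul_le_mul_of_nonneg_left ?_ (abs_nonneg _)
    have h1 := bY z hz'
    have h2 := mul_le_mul_of_nonneg_right (be z hz').2.2 (abs_nonneg (Y z))
    linarith

/-- The energy `X² + Y²` varies at the rate `2h (X² - Y²)`, of first order in `ε`, but `X² - Y² =
(XY)' / ω` oscillates. Subtracting `(2/ω) h X Y`, which vanishes at both ends, leaves a derivative
containing only `h'`, of order `ε²`. -/
lemma end_le (hL : 0 < L) (K : IsSmallCoupling L h h' H ε) (S : OscSol L h ω X Y)
    (hω : ω ≠ 0) (hX : X 0 ≠ 0) : |X L| ≤ (1 + 8 * (ε * L) ^ 2) * |X 0| := by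
  have hfr := S.freq_lower hL K hω hX
  have hωp : 0 < |ω| := abs_pos.2 hω
  have dΨ : ∀ x ∈ Ioo 0 L, HasDerivAt (fun x => X x ^ 2 + Y x ^ 2 - 2 / ω * (h x * (X x * Y x)))
      (-(2 / ω * (h' x * (X x * Y x)))) x := fun x hx => by
    refine ((((S.dX x hx).pow 2).add ((S.dY x hx).pow 2)).sub
      ((((K.deriv x hx).mul ((S.dX x hx).mul (S.dY x hx))).const_mul (2 / ω)))).congr_deriv ?_
    simp only [Pi.mul_apply]
    field_simp
    push_cast
    ring
  have cΨ : ContinuousOn (fun x => X x ^ 2 + Y x ^ 2 - 2 / ω * (h x * (X x * Y x))) (Icc 0 L) :=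
    ((S.cX.pow 2).add (S.cY.pow 2)).sub ((K.cont.mul (S.cX.mul S.cY)).const_mul _)
  have b := norm_sub_le_of_deriv (C := 15 * ε ^ 2 * L * X 0 ^ 2) cΨ dΨ (fun x hx => ?_)
    ⟨le_rfl, hL.le⟩ ⟨hL.le, le_rfl⟩
  · simp only [S.Y0, S.YL, Real.norm_eq_abs] at b
    have b1 := (_root_.abs_le.1 b).2
    have b2 : X L ^ 2 ≤ X 0 ^ 2 * (1 + 15 * (ε * L) ^ 2) := by nlinarith
    rw [← abs_of_nonneg (by positivity : 0 ≤ (1 + 8 * (ε * L) ^ 2)), ← abs_mul]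
    refine sq_le_sq.1 ?_
    nlinarith [mul_nonneg (sq_nonneg (X 0)) (sq_nonneg (ε * L)),
      mul_nonneg (sq_nonneg (X 0)) (sq_nonneg ((ε * L) ^ 2))]
  · have hx' : x ∈ Icc 0 L := ⟨hx.1.le, hx.2.le⟩
    have h1 := S.sq_le hL K hx'
    have h2 : |X x * Y x| ≤ 3 / 2 * X 0 ^ 2 := by
      rw [_root_.abs_le]; constructor <;> nlinarith [sq_nonneg (X x + Y x), sq_nonneg (X x - Y x)]
    rw [norm_neg, Real.norm_eq_abs, abs_mul, abs_mul, abs_div, abs_two]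
    have h3 : 2 / |ω| ≤ 5 * L := by
      rw [div_le_iff₀ hωp]; linarith
    calc 2 / |ω| * (|h' x| * |X x * Y x|) ≤ 5 * L * (2 * ε ^ 2 * (3 / 2 * X 0 ^ 2)) := by
          gcongr; exact K.bound' x hx
      _ = _ := by ring

/-- The moment of an eigenfunction of the skew-adjoint operator against `exp (3 H)`. -/
lemma moment_lower (hL : 0 < L) (K : IsSmallCoupling L h h' H ε) (S : OscSol L h ω X Y)
    (hω : ω ≠ 0) (hX : X 0 ≠ 0) :
    ε * L / 8 * |X 0| ≤ |2 * ω * ∫ x, Real.exp (3 * H x) * Y x ∂(mes L)| := by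
  have hfr := S.freq_lower hL K hω hX
  have hend := S.end_le hL K hω hX
  have hωp : 0 < |ω| := abs_pos.2 hω
  have hε := K.pos
  have ce := cont_exp K.contPrim 3
  have de : ∀ x ∈ Ioo 0 L, HasDerivAt (fun x => Real.exp (3 * H x))
      (Real.exp (3 * H x) * (3 * h x)) x := fun x hx => ((K.derivPrim x hx).const_mul 3).exp
  have cG : ContinuousOn (fun x => 2 * ω * (Real.exp (3 * H x) * Y x)) (Icc 0 L) :=
    (ce.mul S.cY).const_mul _
  have iG : IntervalIntegrable (fun x => 2 * ω * (Real.exp (3 * H x) * Y x)) volume 0 L :=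
    cG.intervalIntegrable_of_Icc hL.le
  have dP : ∀ x ∈ Ioo 0 L, HasDerivAt (fun x => ∫ t in (0 : ℝ)..x, 2 * ω * (Real.exp (3 * H t) * Y t))
      (2 * ω * (Real.exp (3 * H x) * Y x)) x := fun x hx => by
    refine intervalIntegral.integral_hasDerivAt_right ?_ ?_
      ((cG.mono Ioo_subset_Icc_self).continuousAt (isOpen_Ioo.mem_nhds hx))
    · exact iG.mono_set (by rw [uIcc_of_le hx.1.le, uIcc_of_le hL.le]
                            exact Icc_subset_Icc_right hx.2.le)
    · exact (cG.mono Ioo_subset_Icc_self).stronglyMeasurableAtFilter isOpen_Ioo x hx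
  have cP : ContinuousOn (fun x => ∫ t in (0 : ℝ)..x, 2 * ω * (Real.exp (3 * H t) * Y t))
      (Icc 0 L) := by
    have := intervalIntegral.continuousOn_primitive_interval (μ := volume) (a := 0) (b := L)
      (f := fun t => 2 * ω * (Real.exp (3 * H t) * Y t))
      (by rw [uIcc_of_le hL.le]; exact cG.integrableOn_Icc)
    rwa [uIcc_of_le hL.le] at this
  -- Differentiating `-2 exp (3H) X` yields the integrand of the moment and the first-order term
  -- `-8h exp (3H) X`. The corrector `(8/ω) h exp (3H) Y`, zero at both ends, cancels the latter and
  -- leaves only second-order terms.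
  have dΞ : ∀ x ∈ Ioo 0 L, HasDerivAt (fun x => -2 * (Real.exp (3 * H x) * X x)
      + 8 / ω * (h x * (Real.exp (3 * H x) * Y x))
      - ∫ t in (0 : ℝ)..x, 2 * ω * (Real.exp (3 * H t) * Y t))
      (8 / ω * ((h' x + 2 * h x ^ 2) * (Real.exp (3 * H x) * Y x))) x := fun x hx => by
    refine (((((de x hx).mul (S.dX x hx)).const_mul (-2)).add
      (((K.deriv x hx).mul ((de x hx).mul (S.dY x hx))).const_mul (8 / ω))).sub
      (dP x hx)).congr_deriv ?_
    simp only [Pi.mul_apply]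
    field_simp
    ring
  have cΞ : ContinuousOn (fun x => -2 * (Real.exp (3 * H x) * X x)
      + 8 / ω * (h x * (Real.exp (3 * H x) * Y x))
      - ∫ t in (0 : ℝ)..x, 2 * ω * (Real.exp (3 * H t) * Y t)) (Icc 0 L) :=
    (((ce.mul S.cX).const_mul _).add ((K.cont.mul (ce.mul S.cY)).const_mul _)).sub cP
  have b := norm_sub_le_of_deriv (C := 160 * ε ^ 2 * L * |X 0|) cΞ dΞ (fun x hx => ?_)
    ⟨le_rfl, hL.le⟩ ⟨hL.le, le_rfl⟩
  · simp only [S.Y0, S.YL, Real.norm_eq_abs, K.prim_zero, intervalIntegral.integral_same, mul_zero,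
      Real.exp_zero, one_mul, add_zero, sub_zero] at b
    rw [integral_mes_full hL.le, integral_const_mul] at b
    generalize 2 * ω * ∫ x, Real.exp (3 * H x) * Y x ∂(mes L) = P at b ⊢
    -- This first-order loss of the weight at `L` prevents the two boundary terms from cancelling:
    -- `|X L|` exceeds `|X 0|` only to second order.
    have e3 : Real.exp (3 * H L) ≤ 1 - ε * L / 8 := by
      have h1 := K.prim_end hL.le
      have h2 : 3 * H L ≤ -(3 * (ε * L / 8)) := by linarith
      refine (Real.exp_le_exp.2 h2).trans ?_
      have h3 := Real.add_one_le_exp (3 * (ε * L / 8))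
      have hp : 0 < ε * L := mul_pos hε hL
      rw [Real.exp_neg]
      refine (inv_anti₀ (by positivity) h3).trans ?_
      rw [inv_le_iff_one_le_mul₀ (by positivity)]
      nlinarith [K.small]
    have h4 : |Real.exp (3 * H L) * X L| ≤ (1 - ε * L / 8) * ((1 + 8 * (ε * L) ^ 2) * |X 0|) := by
      rw [abs_mul, Real.abs_exp]
      have : 0 ≤ 1 - ε * L / 8 := by linarith [K.small]
      gcongr
    have h5 : 2 * |X 0| ≤ |P| + 2 * |Real.exp (3 * H L) * X L|
        + 160 * ε ^ 2 * L * |X 0| * L := by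
      have e : 2 * X 0 = P + 2 * (Real.exp (3 * H L) * X L)
        + (-2 * (Real.exp (3 * H L) * X L) - P - -2 * X 0) := by ring
      have := abs_add_three P (2 * (Real.exp (3 * H L) * X L))
        (-2 * (Real.exp (3 * H L) * X L) - P - -2 * X 0)
      rw [← e, abs_mul 2 (X 0), abs_mul 2 (_ * _), abs_two] at this
      linarith
    have hp : 0 < ε * L := mul_pos hε hL
    -- With `a = εL` the gain `a/4` beats the losses `16a² + 160a²` because `a ≤ 1/4000`.
    have h6 : 2 - 2 * ((1 - ε * L / 8) * (1 + 8 * (ε * L) ^ 2)) - 160 * (ε * L) ^ 2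
        ≥ ε * L / 8 := by
      nlinarith [K.small, mul_pos hp hp, mul_pos (mul_pos hp hp) hp]
    nlinarith [mul_le_mul_of_nonneg_right h6 (abs_nonneg (X 0))]
  · have hx' : x ∈ Icc 0 L := ⟨hx.1.le, hx.2.le⟩
    have h1 := (S.abs_le hL K hx').2
    have h2 : |h' x + 2 * h x ^ 2| ≤ 4 * ε ^ 2 := by
      have h3 := K.bound x hx'
      have h4 : h x ^ 2 ≤ ε ^ 2 := by
        rw [← sq_abs]; exact pow_le_pow_left₀ (abs_nonneg _) h3 2
      refine (abs_add_le _ _).trans ?_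
      rw [abs_mul, abs_two, abs_of_nonneg (sq_nonneg (h x))]
      linarith [K.bound' x hx]
    have h3 : 8 / |ω| ≤ 20 * L := by
      rw [div_le_iff₀ hωp]; linarith
    have h4 : Real.exp (3 * H x) ≤ 1 := by
      rw [Real.exp_le_one_iff]; linarith [(K.prim_bounds hL.le hx').1]
    rw [Real.norm_eq_abs, abs_mul, abs_mul, abs_mul, abs_div, Real.abs_exp,
      abs_of_pos (by norm_num : (0 : ℝ) < 8)]
    calc 8 / |ω| * (|h' x + 2 * h x ^ 2| * (Real.exp (3 * H x) * |Y x|))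
        ≤ 20 * L * (4 * ε ^ 2 * (1 * (2 * |X 0|))) := by gcongr
      _ = _ := by ring

end OscSol


/-! ### The coupling coefficient `δ / 3` -/

/-- `δ / 3`. -/
def coup (L γ x : ℝ) : ℝ := delta L γ x / 3

/-- The primitive of `δ / 3`. -/
def coupPrim (L γ x : ℝ) : ℝ := ∫ y in (0 : ℝ)..x, coup L γ y

section
variable {L γ : ℝ}

/-- With `p, m = √(1 ± γL/2)` one gets `δ/3 = -c / (p - (p - m) x / L)`, where `c = (p - m) / (2L) =
γ / (2 (p + m))` lies between `γ/5` and `γ/3`. The denominator goes from `p` to `m`, hence stays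
within `[9/10, 11/10]`. All the bounds follow with `ε = γ`. -/
lemma isSmallCoupling (hL : 0 < L) (hγ : 0 < γ) (hs : γ * L ≤ 1 / 4000) :
    IsSmallCoupling L (coup L γ)
      (fun x => -(2 * ((√(1 + γ * L / 2) - √(1 - γ * L / 2)) / (2 * L)) ^ 2 /
        (√(1 + γ * L / 2) - (√(1 + γ * L / 2) - √(1 - γ * L / 2)) * x / L) ^ 2))
      (coupPrim L γ) γ := by
  have hγL : 0 < γ * L := mul_pos hγ hL
  have hh : ∀ x, coup L γ x = -((√(1 + γ * L / 2) - √(1 - γ * L / 2)) / (2 * L) /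
      (√(1 + γ * L / 2) - (√(1 + γ * L / 2) - √(1 - γ * L / 2)) * x / L)) := by
    intro x
    have e : γ * lenGamma L γ * x / (2 * L) = (√(1 + γ * L / 2) - √(1 - γ * L / 2)) * x / L := by
      rw [lenGamma]; field_simp
    rw [coup, delta, e, lenGamma]
    field_simp
    ring
  set p := √(1 + γ * L / 2) with hp
  set m := √(1 - γ * L / 2) with hm
  have p2 : p ^ 2 = 1 + γ * L / 2 := Real.sq_sqrt (by linarith)
  have m2 : m ^ 2 = 1 - γ * L / 2 := Real.sq_sqrt (by linarith)
  have p0 : 0 ≤ p := Real.sqrt_nonneg _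
  have m0 : 0 ≤ m := Real.sqrt_nonneg _
  have p1 : p ≤ 11 / 10 := by nlinarith
  have p1' : 1 ≤ p := by nlinarith
  have m1 : m ≤ 1 := by nlinarith
  have m1' : 9 / 10 ≤ m := by nlinarith
  have hpm : (p - m) * (p + m) = γ * L := by ring_nf; linarith
  have hpm0 : 0 < p - m := by nlinarith
  set c := (p - m) / (2 * L) with hc
  have c0 : 0 < c := by positivity
  have hcp : c * (2 * (p + m)) = γ := by
    rw [hc]; field_simp; linarith
  have c1 : c ≤ γ / 3 := by nlinarith
  have c2 : γ / 5 ≤ c := by nlinarith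
  have den : ∀ x ∈ Icc 0 L, 9 / 10 ≤ p - (p - m) * x / L ∧ p - (p - m) * x / L ≤ 11 / 10 := by
    intro x hx
    have h1 : 0 ≤ (p - m) * x / L := div_nonneg (mul_nonneg hpm0.le hx.1) hL.le
    have h2 : (p - m) * x / L ≤ p - m := by
      rw [div_le_iff₀ hL]; exact mul_le_mul_of_nonneg_left hx.2 hpm0.le
    constructor <;> linarith
  have hfun : coup L γ = fun x => -(c / (p - (p - m) * x / L)) := funext hh
  have hcont : ContinuousOn (coup L γ) (Icc 0 L) := by
    rw [hfun]
    refine (ContinuousOn.div continuousOn_const (by fun_prop) fun x hx => ?_).neg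
    linarith [(den x hx).1]
  have icoup : IntervalIntegrable (coup L γ) volume 0 L := hcont.intervalIntegrable_of_Icc hL.le
  refine ⟨⟨hcont, fun x hx => ?_⟩, hγ, hs, fun x hx => ?_, fun x hx => ?_, fun x hx => ?_, ?_,
    fun x hx => ?_, by simp [coupPrim]⟩
  · have hd := (den x hx).1
    rw [hh, abs_neg, abs_div, abs_of_pos c0, abs_of_pos (by linarith), div_le_iff₀ (by linarith)]
    nlinarith
  · have hd := (den x ⟨hx.1.le, hx.2.le⟩).1
    have hne : p - (p - m) * x / L ≠ 0 := by linarith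
    have d1 : HasDerivAt (fun x => p - (p - m) * x / L) (-(2 * c)) x := by
      refine ((((hasDerivAt_id x).const_mul (p - m)).div_const L).const_sub p).congr_deriv ?_
      rw [hc]; field_simp
    rw [hfun]
    refine ((d1.fun_inv hne).const_mul c).neg.congr_deriv ?_ |>.congr_of_eventuallyEq ?_
    · ring
    · exact Eventually.of_forall fun y => by simp [div_eq_mul_inv]
  · have hd := (den x ⟨hx.1.le, hx.2.le⟩).1
    rw [abs_neg, abs_of_nonneg (by positivity), div_le_iff₀ (by nlinarith)]
    have : c ^ 2 ≤ (γ / 3) ^ 2 := pow_le_pow_left₀ c0.le c1 2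
    have h4 := pow_le_pow_left₀ (by norm_num) hd 2
    nlinarith [mul_le_mul_of_nonneg_left h4 (sq_nonneg γ)]
  · have hd := den x hx
    rw [hh, neg_le_neg_iff, le_div_iff₀ (by linarith)]
    nlinarith
  · have := intervalIntegral.continuousOn_primitive_interval (μ := volume) (a := 0) (b := L)
      (f := coup L γ) (by rw [uIcc_of_le hL.le]; exact hcont.integrableOn_Icc)
    rwa [uIcc_of_le hL.le] at this
  · refine intervalIntegral.integral_hasDerivAt_right ?_ ?_
      ((hcont.mono Ioo_subset_Icc_self).continuousAt (isOpen_Ioo.mem_nhds hx))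
    · exact icoup.mono_set (by rw [uIcc_of_le hx.1.le, uIcc_of_le hL.le]
                               exact Icc_subset_Icc_right hx.2.le)
    · exact (hcont.mono Ioo_subset_Icc_self).stronglyMeasurableAtFilter isOpen_Ioo x hx

lemma integral_delta (x : ℝ) : ∫ y in (0 : ℝ)..x, delta L γ y = 3 * coupPrim L γ x := by
  rw [coupPrim, ← intervalIntegral.integral_const_mul]
  congr 1; ext y; rw [coup]; ring

lemma opA_ae {ε κ : ℝ} (hL : 0 ≤ L) (H : IsCoupling L (coup L γ) ε) (α : Dom L κ) :
    Aop L κ (coup L γ) α =ᵐ[mes L] opA L γ α := by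
  filter_upwards [Aop_ae H hL α] with x hx
  refine val_ext ?_ ?_
  · rw [hx.1]; simp [opA, coup]
  · rw [hx.2]; simp [opA, coup]

lemma eigen_iff {ε κ : ℝ} (hL : 0 ≤ L) (H : IsCoupling L (coup L γ) ε) (α : Dom L κ) (l : ℂ) :
    (∀ᵐ x ∂(mes L), opA L γ α x = l • toL2 α x) ↔ Aop L κ (coup L γ) α = l • toL2 α := by
  rw [Lp.ext_iff]
  constructor
  · intro h
    filter_upwards [h, opA_ae hL H α, Lp.coeFn_smul l (toL2 α)] with x h1 h2 h3
    rw [h2, h1, h3, Pi.smul_apply]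
  · intro h
    filter_upwards [h, opA_ae hL H α, Lp.coeFn_smul l (toL2 α)] with x h1 h2 h3
    rw [← h2, h1, h3, Pi.smul_apply]

end


/-! ### Small perturbations of a diagonal operator -/

/-- `sg p + v` is an eigenvector of `diag l₀ + B` with eigenvalue `l₀ p + η`. -/
structure IsPert (B : Seq →L[ℂ] Seq) (l₀ : ℤ → ℂ) (p : ℤ) (v : Seq) (η : ℂ) : Prop where
  norm_le : ‖v‖ ≤ 1
  diag_zero : v p = 0
  eq : ∀ q, (l₀ p + η) * (sg p + v : Seq) q = l₀ q * (sg p + v : Seq) q + B (sg p + v) q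

section pert
variable {B : Seq →L[ℂ] Seq} {l₀ : ℤ → ℂ} {b g : ℝ} {p : ℤ}

lemma norm_sg (p : ℤ) : ‖sg p‖ = 1 := by
  rw [lp.norm_single (by simp)]; simp

lemma IsPert.eta_eq {v : Seq} {η : ℂ} (h : IsPert B l₀ p v η) : η = B (sg p + v) p := by
  have := h.eq p
  rw [lp.coeFn_add, Pi.add_apply, h.diag_zero, sg_apply, if_pos rfl] at this
  linear_combination this

/-- The fixed point map for the perturbed eigenvector. -/
def pertMap (B : Seq →L[ℂ] Seq) (l₀ : ℤ → ℂ) (p : ℤ) (v : Seq) : Seq :=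
  diag (fun q => if q = p then 0 else (l₀ p - l₀ q + B (sg p + v) p)⁻¹) (B (sg p + v))

variable (hg : 0 < g) (hb : ‖B‖ ≤ b) (hbg : 16 * b ≤ g)
  (hgap : ∀ p q, p ≠ q → g ≤ ‖l₀ p - l₀ q‖)
include hb hbg

lemma pert_eta_le {v : Seq} (hv : ‖v‖ ≤ 1) : ‖B (sg p + v) p‖ ≤ g / 8 := by
  refine (lp.norm_apply_le_norm (by simp) _ _).trans ?_
  have h1 : ‖sg p + v‖ ≤ 2 := (norm_add_le _ _).trans (by rw [norm_sg]; linarith)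
  have := B.le_of_opNorm_le_of_le hb h1
  linarith

include hg hgap

lemma pert_den {v : Seq} (hv : ‖v‖ ≤ 1) {q : ℤ} (hq : q ≠ p) :
    ‖l₀ p - l₀ q‖ / 2 ≤ ‖l₀ p - l₀ q + B (sg p + v) p‖ := by
  have h1 := pert_eta_le hb hbg (p := p) hv
  have h2 := hgap p q hq.symm
  have h3 := norm_sub_le_norm_add (l₀ p - l₀ q) (B (sg p + v) p)
  linarith

lemma pert_inv_le {v : Seq} (hv : ‖v‖ ≤ 1) {q : ℤ} (hq : q ≠ p) :
    ‖(l₀ p - l₀ q + B (sg p + v) p)⁻¹‖ ≤ 2 / ‖l₀ p - l₀ q‖ := by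
  have h0 : 0 < ‖l₀ p - l₀ q‖ := hg.trans_le (hgap p q hq.symm)
  rw [norm_inv]
  refine (inv_anti₀ (by positivity) (pert_den hg hb hbg hgap hv hq)).trans_eq ?_
  rw [inv_div]

lemma pert_coef_le {v : Seq} (hv : ‖v‖ ≤ 1) (q : ℤ) :
    ‖(if q = p then 0 else (l₀ p - l₀ q + B (sg p + v) p)⁻¹ : ℂ)‖ ≤ 2 / g := by
  split_ifs with hq
  · simp; positivity
  · exact (pert_inv_le hg hb hbg hgap hv hq).trans (by gcongr; exact hgap p q (Ne.symm hq))

lemma pertMap_apply {v : Seq} (hv : ‖v‖ ≤ 1) (q : ℤ) : pertMap B l₀ p v q =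
    if q = p then 0 else (l₀ p - l₀ q + B (sg p + v) p)⁻¹ * B (sg p + v) q := by
  rw [pertMap, diag_apply (pert_coef_le hg hb hbg hgap hv)]
  split_ifs <;> simp

lemma pertMap_mem {v : Seq} (hv : ‖v‖ ≤ 1) : ‖pertMap B l₀ p v‖ ≤ 1 := by
  refine (norm_diag_apply_le (pert_coef_le hg hb hbg hgap hv) _).trans ?_
  have h1 : ‖sg p + v‖ ≤ 2 := (norm_add_le _ _).trans (by rw [norm_sg]; linarith)
  have := B.le_of_opNorm_le_of_le hb h1
  rw [div_mul_eq_mul_div, div_le_one hg]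
  linarith

/-- The map depends on `v` through the vector `B (sg p + v)` and through the eigenvalue shift in the
denominators; each dependence has Lipschitz constant at most `1/8` when `16 b ≤ g`. -/
lemma pertMap_lipschitz {v w : Seq} (hv : ‖v‖ ≤ 1) (hw : ‖w‖ ≤ 1) :
    ‖pertMap B l₀ p v - pertMap B l₀ p w‖ ≤ 1 / 2 * ‖v - w‖ := by
  have hb0 : 0 ≤ b := (norm_nonneg _).trans hb
  set m : Seq → ℤ → ℂ := fun v q => if q = p then 0 else (l₀ p - l₀ q + B (sg p + v) p)⁻¹ with hm
  have e : pertMap B l₀ p v - pertMap B l₀ p w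
      = diag (m v) (B (v - w)) + diag (fun q => m v q - m w q) (B (sg p + w)) := by
    ext q
    rw [lp.coeFn_add, Pi.add_apply, lp.coeFn_sub, Pi.sub_apply,
      diag_apply (pert_coef_le hg hb hbg hgap hv), diag_apply (C := 2 / g + 2 / g) (fun q =>
        (norm_sub_le _ _).trans (add_le_add (pert_coef_le hg hb hbg hgap hv q)
          (pert_coef_le hg hb hbg hgap hw q))), pertMap, pertMap,
      diag_apply (pert_coef_le hg hb hbg hgap hv), diag_apply (pert_coef_le hg hb hbg hgap hw)]
    have : B (v - w) q = B (sg p + v) q - B (sg p + w) q := by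
      rw [← Pi.sub_apply, ← lp.coeFn_sub, ← map_sub, add_sub_add_left_eq_sub]
    rw [this]; ring
  have h1 : ‖B (v - w)‖ ≤ b * ‖v - w‖ := B.le_of_opNorm_le hb _
  have h2 : ∀ q, ‖m v q - m w q‖ ≤ 4 * b / g ^ 2 * ‖v - w‖ := by
    intro q
    by_cases hq : q = p
    · simp only [hm, if_pos hq, sub_zero, norm_zero]; positivity
    · simp only [hm, if_neg hq]
      have a1 := hg.trans_le (hgap p q (Ne.symm hq))
      have n1 : l₀ p - l₀ q + B (sg p + v) p ≠ 0 :=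
        norm_pos_iff.1 (lt_of_lt_of_le (by positivity) (pert_den hg hb hbg hgap hv hq))
      have n2 : l₀ p - l₀ q + B (sg p + w) p ≠ 0 :=
        norm_pos_iff.1 (lt_of_lt_of_le (by positivity) (pert_den hg hb hbg hgap hw hq))
      have : (l₀ p - l₀ q + B (sg p + v) p)⁻¹ - (l₀ p - l₀ q + B (sg p + w) p)⁻¹
          = (l₀ p - l₀ q + B (sg p + v) p)⁻¹ * (l₀ p - l₀ q + B (sg p + w) p)⁻¹
            * B (w - v) p := by
        have : B (w - v) p = B (sg p + w) p - B (sg p + v) p := by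
          rw [← Pi.sub_apply, ← lp.coeFn_sub, ← map_sub, add_sub_add_left_eq_sub]
        rw [this]; field_simp; ring
      rw [this, norm_mul, norm_mul]
      have c1 := (pert_inv_le hg hb hbg hgap hv hq).trans
        (div_le_div_of_nonneg_left zero_le_two hg (hgap p q (Ne.symm hq)))
      have c2 := (pert_inv_le hg hb hbg hgap hw hq).trans
        (div_le_div_of_nonneg_left zero_le_two hg (hgap p q (Ne.symm hq)))
      have c3 : ‖B (w - v) p‖ ≤ b * ‖v - w‖ := by
        refine (lp.norm_apply_le_norm (by simp) _ _).trans ?_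
        rw [norm_sub_rev]; exact B.le_of_opNorm_le hb _
      calc _ ≤ 2 / g * (2 / g) * (b * ‖v - w‖) := by gcongr
        _ = _ := by field_simp; ring
  have h3 : ‖sg p + w‖ ≤ 2 := (norm_add_le _ _).trans (by rw [norm_sg]; linarith)
  have h4 := B.le_of_opNorm_le_of_le hb h3
  rw [e]
  refine (norm_add_le _ _).trans ?_
  have h5 : ‖diag (m v) (B (v - w))‖ ≤ 2 / g * ‖B (v - w)‖ :=
    norm_diag_apply_le (pert_coef_le hg hb hbg hgap hv) (B (v - w))
  have h6 : ‖diag (fun q => m v q - m w q) (B (sg p + w))‖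
      ≤ 4 * b / g ^ 2 * ‖v - w‖ * ‖B (sg p + w)‖ := norm_diag_apply_le h2 (B (sg p + w))
  have h7 : 2 / g * (b * ‖v - w‖) ≤ 1 / 8 * ‖v - w‖ := by
    rw [← mul_assoc]; gcongr
    rw [div_mul_eq_mul_div, div_le_iff₀ hg]; linarith
  have h8 : 4 * b / g ^ 2 * ‖v - w‖ * (b * 2) ≤ 1 / 8 * ‖v - w‖ := by
    rw [mul_right_comm]; gcongr
    rw [div_mul_eq_mul_div, div_le_iff₀ (by positivity)]
    nlinarith
  have h9 : 2 / g * ‖B (v - w)‖ ≤ 2 / g * (b * ‖v - w‖) := by gcongr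
  have h10 : 4 * b / g ^ 2 * ‖v - w‖ * ‖B (sg p + w)‖ ≤ 4 * b / g ^ 2 * ‖v - w‖ * (b * 2) := by
    gcongr
  linarith [norm_nonneg (v - w)]

lemma IsPert.fixed {v : Seq} {η : ℂ} (h : IsPert B l₀ p v η) : pertMap B l₀ p v = v := by
  ext q
  rw [pertMap_apply hg hb hbg hgap h.norm_le]
  split_ifs with hq
  · rw [hq, h.diag_zero]
  · have := h.eq q
    rw [lp.coeFn_add, Pi.add_apply, sg_apply, if_neg hq, zero_add, h.eta_eq] at this
    rw [inv_mul_eq_iff_eq_mul₀]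
    · linear_combination -this
    · exact norm_pos_iff.1 (lt_of_lt_of_le (by
        have := hg.trans_le (hgap p q (Ne.symm hq))
        positivity) (pert_den hg hb hbg hgap h.norm_le hq))

/-- Besides uniqueness itself, this transfers every symmetry of `B` and `l₀` to the perturbed
eigenvectors. -/
lemma IsPert.unique {v w : Seq} {η θ : ℂ} (h : IsPert B l₀ p v η) (h' : IsPert B l₀ p w θ) :
    v = w ∧ η = θ := by
  have h1 := pertMap_lipschitz hg hb hbg hgap (p := p) h.norm_le h'.norm_le
  rw [h.fixed hg hb hbg hgap, h'.fixed hg hb hbg hgap] at h1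
  have h2 : v = w := by
    rw [← sub_eq_zero, ← norm_eq_zero]; linarith [norm_nonneg (v - w)]
  exact ⟨h2, by rw [h.eta_eq, h'.eta_eq, h2]⟩

/-- Banach's fixed point theorem in the closed unit ball, the shift `η` being recovered as the
`p`-th entry of the perturbation. -/
lemma exists_isPert (p : ℤ) : ∃ v η, IsPert B l₀ p v η := by
  have hmaps : MapsTo (pertMap B l₀ p) (Metric.closedBall 0 1) (Metric.closedBall 0 1) := by
    intro v hv
    rw [mem_closedBall_zero_iff] at hv ⊢
    exact pertMap_mem hg hb hbg hgap hv
  have hcontr : ContractingWith (1 / 2) (hmaps.restrict _ _ _) := by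
    refine ⟨by norm_num, LipschitzWith.of_dist_le_mul fun v w => ?_⟩
    have := pertMap_lipschitz hg hb hbg hgap (p := p) (mem_closedBall_zero_iff.1 v.2)
      (mem_closedBall_zero_iff.1 w.2)
    rw [Subtype.dist_eq, Subtype.dist_eq, dist_eq_norm, dist_eq_norm]
    simpa using this
  obtain ⟨v, hv, hfix, -⟩ := hcontr.exists_fixedPoint' Metric.isClosed_closedBall.isComplete hmaps
    (x := 0) (by simp) (edist_ne_top _ _)
  rw [mem_closedBall_zero_iff] at hv
  have hfix' : pertMap B l₀ p v = v := hfix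
  have hq := pertMap_apply hg hb hbg hgap (p := p) hv
  rw [hfix'] at hq
  have hp : v p = 0 := by rw [hq]; simp
  refine ⟨v, B (sg p + v) p, hv, hp, fun q => ?_⟩
  rw [lp.coeFn_add, Pi.add_apply, sg_apply]
  by_cases hqp : q = p
  · subst hqp; rw [hp]; simp
  · have h1 := hq q
    rw [if_neg hqp, eq_inv_mul_iff_mul_eq₀] at h1
    · rw [if_neg hqp, zero_add, ← h1]; ring
    · exact norm_pos_iff.1 (lt_of_lt_of_le (by
        have := hg.trans_le (hgap p q (Ne.symm hqp))
        positivity) (pert_den hg hb hbg hgap hv hqp))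

end pert

/-- The reflected conjugate of a sequence. -/
def reflC (x : Seq) : Seq := ⟨fun n => conj (x (-n)), memSeq_iff.2 (by
  have := (Equiv.neg ℤ).summable_iff.2 (seq_summable_sq x)
  simpa [Function.comp_def] using this)⟩

@[simp] lemma reflC_apply (x : Seq) (n : ℤ) : reflC x n = conj (x (-n)) := rfl

lemma norm_reflC (x : Seq) : ‖reflC x‖ = ‖x‖ := by
  rw [← sq_eq_sq₀ (norm_nonneg _) (norm_nonneg _), seq_norm_sq, seq_norm_sq]
  simpa using (Equiv.neg ℤ).tsum_eq fun n => ‖x n‖ ^ 2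

lemma reflC_add (x y : Seq) : reflC (x + y) = reflC x + reflC y := by
  ext n; simp [reflC_apply]

lemma reflC_sg (p : ℤ) : reflC (sg p) = sg (-p) := by
  ext n; rw [reflC_apply, sg_apply, sg_apply]
  by_cases h : n = -p
  · simp [h]
  · rw [if_neg h, if_neg (by omega)]; simp

lemma star_sg (p : ℤ) : star (sg p) = sg p := by
  ext n; rw [lp.star_apply, sg_apply]; split_ifs <;> simp

lemma IsPert.reflConj {B : Seq →L[ℂ] Seq} {l₀ : ℤ → ℂ} {p : ℤ} {v : Seq} {η : ℂ}
    (h : IsPert B l₀ p v η) (hB : ∀ x, B (reflC x) = reflC (B x))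
    (hl : ∀ q, l₀ (-q) = conj (l₀ q)) : IsPert B l₀ (-p) (reflC v) (conj η) := by
  have e : sg (-p) + reflC v = reflC (sg p + v) := by rw [reflC_add, reflC_sg]
  refine ⟨by rw [norm_reflC]; exact h.norm_le, by simp [h.diag_zero], fun q => ?_⟩
  have := congrArg conj (h.eq (-q))
  rw [e, hB, reflC_apply, reflC_apply, hl]
  rw [map_mul, map_add, map_add, map_mul, hl, Complex.conj_conj] at this
  exact this

/-- Used for `μ = 0` only: with `IsPert.unique` it makes the shift `η` imaginary. -/
lemma IsPert.starConj {B : Seq →L[ℂ] Seq} {l₀ : ℤ → ℂ} {p : ℤ} {v : Seq} {η : ℂ}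
    (h : IsPert B l₀ p v η) (hB : ∀ x, B (star x) = -star (B x))
    (hl : ∀ q, conj (l₀ q) = -l₀ q) : IsPert B l₀ p (star v) (-conj η) := by
  have e : sg p + star v = star (sg p + v) := by rw [star_add, star_sg]
  refine ⟨by rw [norm_star]; exact h.norm_le, by simp [h.diag_zero], fun q => ?_⟩
  have := congrArg conj (h.eq q)
  rw [map_mul, map_add, map_add, map_mul, hl, hl] at this
  rw [e, hB, lp.coeFn_neg, Pi.neg_apply, lp.star_apply, lp.star_apply]
  change (l₀ p + -conj η) * conj ((sg p + v : Seq) q) = l₀ q * conj ((sg p + v : Seq) q)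
    + -conj (B (sg p + v) q)
  linear_combination -this

/-- The sequence `1 / (1 + |n|)`. -/
def hseq (n : ℤ) : ℝ := (1 + |(n : ℝ)|)⁻¹

lemma hseq_pos (n : ℤ) : 0 < hseq n := by unfold hseq; positivity

lemma summable_hseq_sq : Summable fun n => hseq n ^ 2 := by
  have h1 : Summable fun n : ℤ => 1 / (n : ℝ) ^ 2 := Real.summable_one_div_int_pow.2 one_lt_two
  have h2 : Summable fun n : ℤ => (if n = 0 then 1 else 0 : ℝ) :=
    summable_of_ne_finset_zero (s := {0}) fun n hn => by simpa using hn
  refine Summable.of_nonneg_of_le (fun n => by positivity) (fun n => ?_) (h1.add h2)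
  rcases eq_or_ne n 0 with rfl | hn
  · simp [hseq]
  · rw [if_neg hn, add_zero, one_div, hseq, inv_pow, ← sq_abs (n : ℝ)]
    have : 0 < |(n : ℝ)| := by positivity
    gcongr; linarith

/-- The `ℓ²` norm of `hseq`. -/
def hnorm : ℝ := √(∑' n, hseq n ^ 2)

lemma hnorm_nonneg : 0 ≤ hnorm := Real.sqrt_nonneg _

lemma seq_norm_le_hseq {x : Seq} {C : ℝ} (hC : 0 ≤ C) (e : ℤ ≃ ℤ)
    (h : ∀ n, ‖x n‖ ≤ C * hseq (e n)) : ‖x‖ ≤ C * hnorm := by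
  rw [← sq_le_sq₀ (norm_nonneg _) (mul_nonneg hC hnorm_nonneg), seq_norm_sq, mul_pow, hnorm,
    Real.sq_sqrt (tsum_nonneg fun n => by positivity), ← e.tsum_eq fun n => hseq n ^ 2,
    ← tsum_mul_left]
  refine (seq_summable_sq x).tsum_le_tsum (fun n => ?_)
    ((e.summable_iff.2 summable_hseq_sq).mul_left _)
  rw [← mul_pow]; gcongr; exact h n

/-- Partial fractions `1/(ab) = (1/a + 1/b) / (a + b)`, where `a + b ≥ 2 (1 + |p|)` because `(p - q)
+ (p + q) = 2p`. -/
lemma hseq_mul_le (p q : ℤ) :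
    hseq (p - q) * hseq (p + q) ≤ hseq p / 2 * (hseq (p - q) + hseq (p + q)) := by
  unfold hseq
  have h : 2 * |(p : ℝ)| ≤ |((p - q : ℤ) : ℝ)| + |((p + q : ℤ) : ℝ)| := by
    have := abs_add_le ((p - q : ℤ) : ℝ) ((p + q : ℤ) : ℝ)
    push_cast at this ⊢
    rw [show (p : ℝ) - q + (p + q) = 2 * p by ring, abs_mul, abs_two] at this
    exact this
  have h1 : 0 < 1 + |((p - q : ℤ) : ℝ)| := by positivity
  have h2 : 0 < 1 + |((p + q : ℤ) : ℝ)| := by positivity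
  have h3 : 0 < 1 + |(p : ℝ)| := by positivity
  rw [← mul_inv, inv_add_inv h1.ne' h2.ne', div_eq_mul_inv (_⁻¹) 2, ← mul_inv, inv_mul_eq_div,
    div_div, ← one_div, div_le_div_iff₀ (by positivity) (by positivity), one_mul, mul_comm]
  gcongr
  linarith

/-! ### Decay in `p` of the perturbed eigenvectors and eigenvalues -/

section decay
variable {B : Seq →L[ℂ] Seq} {l₀ : ℤ → ℂ} {b g β : ℝ} {p : ℤ} {v : Seq} {η : ℂ}
variable (hg : 0 < g) (hb : ‖B‖ ≤ b) (hbg : 16 * b ≤ g)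
  (hgap' : ∀ p q, g * |((p - q : ℤ) : ℝ)| ≤ ‖l₀ p - l₀ q‖)
  (hβ : ∀ p q, ‖B (sg p) q‖ ≤ β * hseq (p + q)) (h : IsPert B l₀ p v η)
include hg hb hbg hgap' hβ h

/-- At first order `v q` is an entry of size `hseq (p + q)` divided by a gap, a factor of size `hseq
(p - q)`. By `hseq_mul_le` the product is `hseq p` times a square-summable sequence in `q` of norm
independent of `p`. The remaining part has norm at most `‖v‖ / 8` and is absorbed. -/
lemma IsPert.norm_le_hseq : ‖v‖ ≤ 8 * β / g * hnorm * hseq p := by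
  have hgap : ∀ p q, p ≠ q → g ≤ ‖l₀ p - l₀ q‖ := fun p q hpq =>
    (le_mul_of_one_le_right hg.le (by
      exact_mod_cast Int.one_le_abs (sub_ne_zero.2 hpq))).trans (hgap' p q)
  have hβ0 : 0 ≤ β := by
    have := (norm_nonneg _).trans (hβ 0 0)
    simpa [hseq] using this
  have hH := hseq_pos p
  have hN := hnorm_nonneg
  set m : ℤ → ℂ := fun q => if q = p then 0 else (l₀ p - l₀ q + B (sg p + v) p)⁻¹ with hm
  have hmle : ∀ q, ‖m q‖ ≤ 2 / g := pert_coef_le hg hb hbg hgap h.norm_le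
  have e : v = diag m (B (sg p)) + diag m (B v) := by
    rw [← map_add, ← map_add]; exact (h.fixed hg hb hbg hgap).symm
  have h1 : ‖diag m (B v)‖ ≤ 1 / 8 * ‖v‖ := by
    refine (norm_diag_apply_le hmle _).trans ?_
    have := B.le_of_opNorm_le hb v
    calc _ ≤ 2 / g * (b * ‖v‖) := by gcongr
      _ = (2 * b / g) * ‖v‖ := by ring
      _ ≤ _ := by
        refine mul_le_mul_of_nonneg_right ?_ (norm_nonneg _)
        rw [div_le_iff₀ hg]; linarith
  -- the leading part, split into its two slowly decaying factors
  have key : ∀ q, ‖diag m (B (sg p)) q‖ ≤ 2 * β / g * hseq p * (hseq (p - q) + hseq (p + q)) := by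
    intro q
    rw [diag_apply hmle, norm_mul]
    by_cases hq : q = p
    · have := hseq_pos (p - q); have := hseq_pos (p + q)
      simp only [hm, if_pos hq, norm_zero, zero_mul]; positivity
    · have h2 : ‖m q‖ ≤ 4 / g * hseq (p - q) := by
        simp only [hm, if_neg hq]
        refine (pert_inv_le hg hb hbg hgap h.norm_le hq).trans ?_
        have h3 : (1 : ℝ) ≤ |((p - q : ℤ) : ℝ)| := by
          exact_mod_cast Int.one_le_abs (sub_ne_zero.2 (Ne.symm hq))
        have h4 := hgap' p q
        calc 2 / ‖l₀ p - l₀ q‖ ≤ 2 / (g * |((p - q : ℤ) : ℝ)|) := by gcongr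
          _ ≤ 4 / (g * (1 + |((p - q : ℤ) : ℝ)|)) := by
            rw [div_le_div_iff₀ (by positivity) (by positivity)]; nlinarith
          _ = _ := by unfold hseq; field_simp
      have h5 := hβ p q
      have h6 := hseq_mul_le p q
      have := hseq_pos (p - q); have := hseq_pos (p + q)
      calc _ ≤ 4 / g * hseq (p - q) * (β * hseq (p + q)) := by gcongr
        _ = 4 / g * β * (hseq (p - q) * hseq (p + q)) := by ring
        _ ≤ 4 / g * β * (hseq p / 2 * (hseq (p - q) + hseq (p + q))) := by gcongr
        _ = _ := by ring
  have h2 : ‖diag m (B (sg p))‖ ≤ 4 * β / g * hnorm * hseq p := by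
    set C := 2 * β / g * hseq p with hC
    have hC0 : 0 ≤ C := by positivity
    let x : ℤ ≃ ℤ → Seq := fun e => ⟨fun n => ((C * hseq (e n) : ℝ) : ℂ), memSeq_iff.2 (by
      simpa [mul_pow] using (e.summable_iff.2 summable_hseq_sq).mul_left (C ^ 2))⟩
    have hx : ∀ (e : ℤ ≃ ℤ) n, ‖x e n‖ = C * hseq (e n) := fun e n => by
      change ‖((C * hseq (e n) : ℝ) : ℂ)‖ = _
      rw [Complex.norm_real, Real.norm_of_nonneg (mul_nonneg hC0 (hseq_pos _).le)]
    have hxn : ∀ e : ℤ ≃ ℤ, ‖x e‖ ≤ C * hnorm := fun e =>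
      seq_norm_le_hseq hC0 e fun n => (hx e n).le
    have : ‖diag m (B (sg p))‖ ≤ 1 * ‖x (Equiv.subLeft p) + x (Equiv.addLeft p)‖ := by
      refine seq_norm_le _ _ zero_le_one fun q => ?_
      refine (key q).trans_eq ?_
      have : (x (Equiv.subLeft p) + x (Equiv.addLeft p) : Seq) q
          = ((C * hseq (p - q) + C * hseq (p + q) : ℝ) : ℂ) := by
        rw [lp.coeFn_add, Pi.add_apply, Complex.ofReal_add]; rfl
      have a1 := hseq_pos (p - q)
      have a2 := hseq_pos (p + q)
      rw [this, Complex.norm_real, Real.norm_of_nonneg (by positivity)]; ring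
    refine this.trans ?_
    rw [one_mul]
    refine (norm_add_le _ _).trans ((add_le_add (hxn _) (hxn _)).trans_eq ?_)
    rw [hC]; ring
  have h3 : ‖v‖ ≤ ‖diag m (B (sg p))‖ + ‖diag m (B v)‖ := by
    conv_lhs => rw [e]
    exact norm_add_le _ _
  have : 8 * β / g * hnorm * hseq p = 2 * (4 * β / g * hnorm * hseq p) := by ring
  linarith [norm_nonneg v]

lemma IsPert.eta_le_hseq : ‖η‖ ≤ (β + b * (8 * β / g * hnorm)) * hseq p := by
  rw [h.eta_eq, map_add, lp.coeFn_add, Pi.add_apply, add_mul]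
  have hβ0 : 0 ≤ β := by
    have := (norm_nonneg _).trans (hβ 0 0)
    simpa [hseq] using this
  refine (norm_add_le _ _).trans (add_le_add ((hβ p p).trans ?_) ?_)
  · refine mul_le_mul_of_nonneg_left ?_ hβ0
    unfold hseq
    refine inv_anti₀ (by positivity) ?_
    push_cast
    rw [← two_mul, abs_mul, abs_two]
    linarith [abs_nonneg (p : ℝ)]
  · refine (lp.norm_apply_le_norm (by simp) _ _).trans ((B.le_of_opNorm_le hb v).trans ?_)
    rw [mul_assoc]
    have := (norm_nonneg _).trans hb
    gcongr
    exact h.norm_le_hseq hg hb hbg hgap' hβ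

end decay

/-- A family quadratically close to the canonical basis of `ℓ²` is a Riesz basis. -/
lemma exists_riesz_of_close {v : ℤ → Seq} {M : ℝ} (hM : M * hnorm < 1)
    (hv : ∀ p, ‖v p‖ ≤ M * hseq p) : ∃ U : Seq ≃L[ℂ] Seq, ∀ p, U (sg p) = sg p + v p := by
  have hM0 : 0 ≤ M := by
    have := (norm_nonneg _).trans (hv 0)
    simpa [hseq] using this
  have hle : ∀ (x : Seq) p, ‖x p • v p‖ ≤ M * (‖x p‖ * hseq p) := fun x p => by
    rw [norm_smul]
    calc _ ≤ ‖x p‖ * (M * hseq p) := by gcongr; exact hv p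
      _ = _ := by ring
  have hcs : ∀ x : Seq, Summable (fun p => ‖x p‖ * hseq p) ∧
      ∑' p, ‖x p‖ * hseq p ≤ ‖x‖ * hnorm := fun x => by
    have h1 : Summable fun p => ‖x p‖ ^ (2 : ℝ) := by simpa using seq_summable_sq x
    have h2 : Summable fun p => hseq p ^ (2 : ℝ) := by simpa using summable_hseq_sq
    have := Real.inner_le_Lp_mul_Lq_tsum_of_nonneg Real.HolderConjugate.two_two
      (f := fun p => ‖x p‖) (g := hseq) (fun p => norm_nonneg _) (fun p => (hseq_pos p).le)
      h1 h2
    refine ⟨Real.summable_mul_of_Lp_Lq_of_nonneg Real.HolderConjugate.two_two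
      (fun p => norm_nonneg _) (fun p => (hseq_pos p).le) h1 h2, this.trans_eq ?_⟩
    congr 1
    · rw [← Real.sqrt_eq_rpow, Real.sqrt_eq_iff_eq_sq (tsum_nonneg fun n => by positivity)
        (norm_nonneg _), seq_norm_sq]
      simp
    · rw [← Real.sqrt_eq_rpow, hnorm]; simp
  have hsum : ∀ x : Seq, Summable fun p => x p • v p := fun x =>
    Summable.of_norm_bounded ((hcs x).1.mul_left M) (hle x)
  -- By Cauchy–Schwarz the perturbation `x ↦ ∑ x_p v_p` has norm at most `M hnorm < 1`; the Neumann
  -- series inverts `1 + P`.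
  let P : Seq →L[ℂ] Seq := LinearMap.mkContinuous
    { toFun := fun x => ∑' p, x p • v p
      map_add' := fun x y => by
        rw [← (hsum x).tsum_add (hsum y)]
        refine tsum_congr fun p => ?_
        rw [lp.coeFn_add, Pi.add_apply, add_smul]
      map_smul' := fun a x => by
        rw [RingHom.id_apply, ← (hsum x).tsum_const_smul]
        refine tsum_congr fun p => ?_
        rw [lp.coeFn_smul, Pi.smul_apply, smul_assoc] } (M * hnorm) fun x => by
    refine (tsum_of_norm_bounded ((hcs x).1.mul_left M).hasSum (hle x)).trans ?_
    rw [tsum_mul_left, mul_assoc, mul_comm hnorm]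
    exact mul_le_mul_of_nonneg_left (hcs x).2 hM0
  have hP : ‖-P‖ < 1 := by
    rw [norm_neg]
    exact (LinearMap.mkContinuous_norm_le _ (mul_nonneg hM0 hnorm_nonneg) _).trans_lt hM
  refine ⟨ContinuousLinearEquiv.ofUnit (Units.oneSub (-P) hP), fun p => ?_⟩
  change ((Units.oneSub (-P) hP : (Seq →L[ℂ] Seq)ˣ) : Seq →L[ℂ] Seq) (sg p) = _
  rw [Units.val_oneSub, sub_neg_eq_add, _root_.add_apply]
  congr 1
  change ∑' q, sg p q • v q = v p
  rw [tsum_eq_single p fun q hq => by rw [sg_apply, if_neg hq, zero_smul]]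
  rw [sg_apply, if_pos rfl, one_smul]


/-! ### The basis of the decoupled operator -/

section expS
variable {L : ℝ}

lemma continuous_toLp_val {F G : ℝ → ℂ} (hF : Continuous F) (hG : Continuous G) :
    Continuous fun x => (!₂[F x, G x] : Val) := by
  refine (PiLp.continuous_toLp 2 _).comp (continuous_pi fun i => ?_)
  fin_cases i
  · exact hF
  · exact hG

lemma memLp_of_continuous {F : ℝ → Val} (hF : Continuous F) : MemLp F 2 (mes L) := by
  obtain ⟨C, hC⟩ := isCompact_Icc.exists_bound_of_continuousOn (s := Icc 0 L) hF.continuousOn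
  exact MemLp.of_bound hF.aestronglyMeasurable C (ae_mem.mono fun x hx => hC x ⟨hx.1.le, hx.2.le⟩)

/-- The normalization constant `(2L)^{-1/2}`. -/
def nrmC (L : ℝ) : ℂ := (√(2 * L) : ℂ)⁻¹

lemma conj_nrmC : conj (nrmC L) = nrmC L := by
  rw [nrmC, map_inv₀, Complex.conj_ofReal]

lemma nrmC_ne_zero (hL : 0 < L) : nrmC L ≠ 0 := by
  have := Real.sqrt_pos.2 (by positivity : 0 < 2 * L)
  exact inv_ne_zero (by exact_mod_cast this.ne')

lemma nrmC_mul (hL : 0 < L) : nrmC L * nrmC L = (2 * L : ℂ)⁻¹ := by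
  rw [nrmC, ← mul_inv, ← Complex.ofReal_mul, Real.mul_self_sqrt (by positivity)]
  push_cast; rfl

/-- The components of the eigenfunctions of `Λ ∂ₓ`. -/
def expF (L : ℝ) (l : ℂ) : Fin 2 → ℝ → ℂ :=
  ![fun x => nrmC L * Complex.exp (l * (x - L)),
    fun x => -(nrmC L * Complex.exp (-l * (x - L)))]

lemma expF_zero (l : ℂ) (x : ℝ) : expF L l 0 x = nrmC L * Complex.exp (l * (x - L)) := by
  simp [expF]

lemma expF_one (l : ℂ) (x : ℝ) : expF L l 1 x = -(nrmC L * Complex.exp (-l * (x - L))) := by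
  simp [expF]

lemma continuous_expF (l : ℂ) (i : Fin 2) : Continuous (expF L l i) := by
  fin_cases i
  · exact continuous_const.mul (by fun_prop)
  · exact (continuous_const.mul (by fun_prop)).neg

/-- The eigenfunctions of `Λ ∂ₓ`. -/
def expS (L : ℝ) (l : ℂ) : State L :=
  (memLp_of_continuous (L := L)
    (continuous_toLp_val (continuous_expF (L := L) l 0) (continuous_expF (L := L) l 1))).toLp

lemma expS_ae (l : ℂ) : ∀ᵐ x ∂(mes L), ∀ i, expS L l x i = expF L l i x := by
  filter_upwards [(memLp_of_continuous (L := L)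
    (continuous_toLp_val (continuous_expF (L := L) l 0) (continuous_expF (L := L) l 1))).coeFn_toLp]
    with x hx i
  rw [expS, hx]
  fin_cases i <;> rfl

lemma hasDerivAt_exp_shift (r : ℂ) (x : ℝ) :
    HasDerivAt (fun x : ℝ => Complex.exp (r * (x - L))) (r * Complex.exp (r * (x - L))) x := by
  have h : HasDerivAt (fun x : ℝ => r * ((x : ℂ) - L)) r x := by
    simpa using ((Complex.ofRealCLM.hasDerivAt (x := x)).sub_const (L : ℂ)).const_mul r
  exact h.cexp.congr_deriv (by ring)

lemma continuous_exp_shift (r : ℂ) : Continuous fun x : ℝ => Complex.exp (r * (x - L)) := by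
  fun_prop

/-- The frequencies of `Λ ∂ₓ`. -/
def freq (L μ : ℝ) (p : ℤ) : ℂ := μ + Complex.I * Real.pi * p / L

lemma conj_freq (μ : ℝ) (p : ℤ) : conj (freq L μ p) = freq L μ (-p) := by
  simp [freq]

lemma conj_freq_zero (p : ℤ) : conj (freq L 0 p) = -freq L 0 p := by
  simp [freq, neg_div]

lemma freq_sub (μ : ℝ) (p q : ℤ) : freq L μ p - freq L μ q = freq L 0 (p - q) := by
  simp [freq]; ring

lemma norm_freq_sub (hL : 0 < L) (μ : ℝ) (p q : ℤ) :
    ‖freq L μ p - freq L μ q‖ = Real.pi / L * |((p - q : ℤ) : ℝ)| := by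
  rw [freq_sub, freq, Complex.ofReal_zero, zero_add, norm_div, norm_mul, norm_mul, Complex.norm_I,
    Complex.norm_real, Complex.norm_real, Complex.norm_intCast, Real.norm_of_nonneg hL.le,
    Real.norm_of_nonneg Real.pi_pos.le]
  ring

/-- The characteristic equation `exp (-2lL) = exp (-2μL)`. It gives the boundary condition of `expS`
at `0`; the one at `L` is built into the shift `x - L`. -/
lemma exp_freq (hL : 0 < L) (μ : ℝ) (p : ℤ) :
    Complex.exp (-(freq L μ p * L)) = Real.exp (-2 * μ * L) * Complex.exp (freq L μ p * L) := by
  have h : (L : ℂ) ≠ 0 := by exact_mod_cast hL.ne'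
  rw [Complex.ofReal_exp, ← Complex.exp_add, Complex.exp_eq_exp_iff_exists_int]
  refine ⟨-p, ?_⟩
  rw [freq]; push_cast; field_simp; ring

/-- The eigenfunctions of `Λ ∂ₓ` as elements of the domain. -/
lemma exists_expD (hL : 0 < L) (μ : ℝ) (p : ℤ) : ∃ α : DomT L μ,
    toL2 α = expS L (freq L μ p) ∧ lamS L (der α) = freq L μ p • expS L (freq L μ p) := by
  set l := freq L μ p
  have hd : ∀ i x, HasDerivAt (expF L l i) ((![l, -l] : Fin 2 → ℂ) i * expF L l i x) x := by
    intro i x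
    fin_cases i
    · exact ((hasDerivAt_exp_shift l x).const_mul _).congr_deriv (by simp [expF]; ring)
    · exact ((hasDerivAt_exp_shift (-l) x).const_mul _).neg.congr_deriv (by simp [expF]; ring)
  have hae : ∀ᵐ x ∂(mes L), ∀ i, lamS L (l • expS L l) x i
      = (![l, -l] : Fin 2 → ℂ) i * expF L l i x := by
    filter_upwards [lamS_ae (l • expS L l), Lp.coeFn_smul l (expS L l), expS_ae (L := L) l]
      with x h1 h2 h3 i
    fin_cases i
    · exact h1.1.trans (by rw [h2, Pi.smul_apply, PiLp.smul_apply, h3]; rfl)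
    · exact h1.2.trans (by
        rw [h2, Pi.smul_apply, PiLp.smul_apply, h3, smul_eq_mul, ← neg_mul]; rfl)
  have hp : ∀ i, HasPrim L (expF L l i) (fun x => lamS L (l • expS L l) x i) := fun i =>
    (HasPrim.of_hasDerivAt (continuous_expF l i).continuousOn (fun x _ => hd i x)
      (integrable_of_continuousOn
        (continuous_const.mul (continuous_expF l i)).continuousOn)).congr_ae
      (hae.mono fun x hx => (hx i).symm)
  have b0 : expF L l 0 0 = -((Real.exp (-2 * μ * L) : ℝ) : ℂ) * expF L l 1 0 := by
    rw [expF_zero, expF_one]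
    have := exp_freq hL μ p
    simp only [Complex.ofReal_zero, zero_sub, mul_neg, neg_mul, neg_neg] at this ⊢
    rw [this]; ring
  have b1 : expF L l 0 L = -expF L l 1 L := by
    rw [expF_zero, expF_one]; simp
  obtain ⟨α, h1, h2, -⟩ := exists_dom hL (expS L l) (lamS L (l • expS L l)) (expF L l) (expS_ae l)
    hp b0 b1
  exact ⟨α, h1, by rw [h2, lamS_lamS]⟩

lemma integral_exp_shift (hL : 0 ≤ L) (r : ℂ) :
    r * ∫ x, Complex.exp (r * (x - L)) ∂(mes L) = 1 - Complex.exp (-(r * L)) := by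
  have h := intervalIntegral.integral_eq_sub_of_hasDerivAt (a := 0) (b := L)
    (fun x _ => hasDerivAt_exp_shift (L := L) r x)
    ((continuous_const.mul (continuous_exp_shift r)).intervalIntegrable _ _)
  rw [integral_mes_full hL, integral_const_mul] at h
  rw [h]; simp

lemma integrable_exp_shift (r : ℂ) : Integrable (fun x : ℝ => Complex.exp (r * (x - L))) (mes L) :=
  integrable_of_continuousOn (continuous_exp_shift r).continuousOn

lemma conj_exp_shift (p : ℤ) (x : ℝ) : conj (Complex.exp (freq L 0 p * (x - L)))
    = Complex.exp (-freq L 0 p * (x - L)) := by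
  rw [← Complex.exp_conj, map_mul, conj_freq_zero, map_sub, Complex.conj_ofReal, Complex.conj_ofReal]

lemma inner_expS (p : ℤ) (u : State L) : inner ℂ (expS L (freq L 0 p)) u
    = nrmC L * ∫ x, (Complex.exp (-freq L 0 p * (x - L)) * u x 0
      - Complex.exp (freq L 0 p * (x - L)) * u x 1) ∂(mes L) := by
  rw [← pairing_eq_inner, pairing, ← integral_const_mul]
  refine integral_congr_ae ?_
  filter_upwards [expS_ae (L := L) (freq L 0 p)] with x hx
  have h2 : conj (Complex.exp (-freq L 0 p * (x - L))) = Complex.exp (freq L 0 p * (x - L)) := by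
    rw [← conj_exp_shift, Complex.conj_conj]
  rw [hx, hx, expF_zero, expF_one, map_neg, map_mul, map_mul, conj_exp_shift, h2]
  simp only [conj_nrmC]
  ring

lemma orthonormal_expS (hL : 0 < L) : Orthonormal ℂ fun p => expS L (freq L 0 p) := by
  rw [orthonormal_iff_ite]
  intro p q
  have h0 : (L : ℂ) ≠ 0 := by exact_mod_cast hL.ne'
  have e : inner ℂ (expS L (freq L 0 p)) (expS L (freq L 0 q)) = (2 * L : ℂ)⁻¹ *
      ((∫ x, Complex.exp (freq L 0 (q - p) * (x - L)) ∂(mes L))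
        + ∫ x, Complex.exp (-freq L 0 (q - p) * (x - L)) ∂(mes L)) := by
    rw [← integral_add (integrable_exp_shift _) (integrable_exp_shift _), inner_expS,
      ← nrmC_mul hL, mul_assoc]
    congr 1
    rw [← integral_const_mul]
    refine integral_congr_ae ?_
    filter_upwards [expS_ae (L := L) (freq L 0 q)] with x hx
    rw [hx, hx, expF_zero, expF_one, ← freq_sub 0 q p, sub_mul, neg_sub, sub_mul, Complex.exp_sub,
      Complex.exp_sub, neg_mul, neg_mul, Complex.exp_neg, Complex.exp_neg]
    field_simp
    ring
  rw [e]
  split_ifs with h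
  · subst h
    simp [freq, mes_real_univ hL.le]
    field_simp
    norm_num
  · have hr : freq L 0 (q - p) ≠ 0 := by
      have h1 : ((q - p : ℤ) : ℂ) ≠ 0 := by exact_mod_cast sub_ne_zero.2 (Ne.symm h)
      rw [freq, Complex.ofReal_zero, zero_add]
      exact div_ne_zero (mul_ne_zero (mul_ne_zero Complex.I_ne_zero
        (by exact_mod_cast Real.pi_ne_zero)) h1) h0
    have i1 := integral_exp_shift hL.le (freq L 0 (q - p))
    have i2 := integral_exp_shift hL.le (-freq L 0 (q - p))
    have i3 := exp_freq hL 0 (q - p)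
    simp only [mul_zero, zero_mul, Real.exp_zero, Complex.ofReal_one, one_mul] at i3
    rw [neg_mul, neg_mul, neg_neg] at i2
    refine mul_eq_zero_of_right _ ?_
    rw [← mul_right_inj' hr]
    simp only [neg_mul] at i2 ⊢
    linear_combination i1 - i2 - i3

/-- Splitting of the integral of a function glued from two halves. -/
lemma integral_glue {E : Type*} [NormedAddCommGroup E] [NormedSpace ℝ E] (hL : 0 ≤ L)
    {f g : ℝ → E} (hf : Integrable f (mes L)) (hg : Integrable g (mes L)) :
    IntervalIntegrable (fun x => if 0 < x then f x else g (-x)) volume (-L) L ∧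
    ∫ x in (-L)..L, (if 0 < x then f x else g (-x)) = (∫ x, f x ∂(mes L)) + ∫ x, g x ∂(mes L) := by
  have c1 : ∀ x ∈ Ioc 0 L, f x = if 0 < x then f x else g (-x) := fun x hx => by
    rw [if_pos hx.1]
  have c2 : ∀ x ∈ Ioc (-L) 0, g (-x) = if 0 < x then f x else g (-x) := fun x hx => by
    rw [if_neg (not_lt.2 hx.2)]
  have j1 := (intervalIntegrable_iff_mes hL).2 hf
  have j2 : IntervalIntegrable (fun x => g (-x)) volume (-L) 0 := by
    have := (intervalIntegrable_iff_mes hL).2 hg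
    rw [IntervalIntegrable.iff_comp_neg] at this
    simpa using this.symm
  have k1 : IntervalIntegrable (fun x => if 0 < x then f x else g (-x)) volume 0 L :=
    j1.congr (by rw [uIoc_of_le hL]; exact fun x hx => c1 x hx)
  have k2 : IntervalIntegrable (fun x => if 0 < x then f x else g (-x)) volume (-L) 0 :=
    j2.congr (by rw [uIoc_of_le (by linarith)]; exact fun x hx => c2 x hx)
  refine ⟨k2.trans k1, ?_⟩
  rw [← intervalIntegral.integral_add_adjacent_intervals k2 k1, add_comm]
  congr 1
  · rw [← integral_mes_full hL]
    refine intervalIntegral.integral_congr_ae (Eventually.of_forall fun x hx => ?_)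
    rw [uIoc_of_le hL] at hx
    exact (c1 x hx).symm
  · have : ∫ x in (-L)..0, g (-x) = ∫ x in (0 : ℝ)..L, g x := by
      rw [intervalIntegral.integral_comp_neg]; simp
    rw [← integral_mes_full hL, ← this]
    refine intervalIntegral.integral_congr_ae (Eventually.of_forall fun x hx => ?_)
    rw [uIoc_of_le (by linarith)] at hx
    exact (c2 x hx).symm

lemma norm_state_sq (u : State L) : ‖u‖ ^ 2 = ∫ x, ‖u x‖ ^ 2 ∂(mes L) := by
  have h : inner ℂ u u = ((‖u‖ ^ 2 : ℝ) : ℂ) := by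
    rw [inner_self_eq_norm_sq_to_K]; simp
  rw [L2.inner_def] at h
  have h2 : ∀ x, inner ℂ (u x) (u x) = ((‖u x‖ ^ 2 : ℝ) : ℂ) := fun x => by
    rw [inner_self_eq_norm_sq_to_K]; simp
  simp only [h2] at h
  rw [show ∫ x, ((‖u x‖ ^ 2 : ℝ) : ℂ) ∂(mes L) = ((∫ x, ‖u x‖ ^ 2 ∂(mes L) : ℝ) : ℂ) from
    integral_ofReal] at h
  exact_mod_cast h.symm

/-- Glue `u₁` on `(0, L)` and the odd reflection `-u₂(-x)` on `(-L, 0)`. The scalar products with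
`expS` become, up to nonzero factors, the Fourier coefficients of the glued function on an interval
of length `2L`, and Parseval concludes. -/
lemma complete_expS (hL : 0 < L) {u : State L} (hu : ∀ p, inner ℂ (expS L (freq L 0 p)) u = 0) :
    u = 0 := by
  set g : ℝ → ℂ := fun x => if 0 < x then u x 0 else -u (-x) 1 with hg
  have m0 := (Lp.memLp u).eval_piLp 0
  have m1 := (Lp.memLp u).eval_piLp 1
  have q0 : Integrable (fun x => ‖u x 0‖ ^ 2) (mes L) := m0.integrable_norm_pow (by norm_num)
  have q1 : Integrable (fun x => ‖u x 1‖ ^ 2) (mes L) := m1.integrable_norm_pow (by norm_num)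
  have hlt : -L < L := by linarith
  have hg2 : (fun x => ‖g x‖ ^ 2) = fun x => if 0 < x then ‖u x 0‖ ^ 2 else ‖u (-x) 1‖ ^ 2 := by
    ext x; simp only [hg]; split_ifs <;> simp
  obtain ⟨j1, j2⟩ := integral_glue hL.le q0 q1
  rw [← hg2] at j1 j2
  have hgm : MemLp g 2 (volume.restrict (Ioc (-L) L)) := by
    have := (integral_glue hL.le (comp_integrable u 0) (comp_integrable u 1).neg).1
    rw [intervalIntegrable_iff_integrableOn_Ioc_of_le hlt.le] at this j1
    exact (memLp_two_iff_integrable_sq_norm this.1).2 j1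
  have hpar := hasSum_sq_fourierCoeffOn hlt hgm
  have hc : ∀ n, fourierCoeffOn hlt g n = 0 := by
    intro n
    rw [fourierCoeffOn_eq_integral]
    refine smul_eq_zero_of_right _ ?_
    have hf : ∀ x : ℝ, (fourier (-n)) (x : AddCircle (L - -L)) = Complex.exp (-freq L 0 n * x) := by
      intro x
      have h0 : (L : ℂ) ≠ 0 := by exact_mod_cast hL.ne'
      rw [fourier_coe_apply]
      congr 1
      rw [freq]; push_cast; field_simp; ring
    have hi : ∀ x : ℝ, (fourier (-n)) (x : AddCircle (L - -L)) • g x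
        = if 0 < x then Complex.exp (-freq L 0 n * x) * u x 0
          else (fun y : ℝ => -(Complex.exp (freq L 0 n * y) * u y 1)) (-x) := by
      intro x
      rw [hf]; simp only [hg]
      split_ifs
      · rfl
      · simp
    have b : ∀ (r : ℂ) i, Integrable (fun x : ℝ => Complex.exp (r * x) * u x i) (mes L) := by
      intro r i
      refine (HasPrim.of_hasDerivAt (L := L) (F := fun x : ℝ => Complex.exp (r * x))
        (f := fun x : ℝ => r * Complex.exp (r * x)) (by fun_prop) (fun x _ => ?_)
        (integrable_of_continuousOn (by fun_prop))).integrable_mul hL.le (comp_integrable u i)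
      simpa using hasDerivAt_exp_shift (L := 0) r x
    simp only [hi]
    rw [(integral_glue hL.le (b (-freq L 0 n) 0) (g := fun y : ℝ =>
      -(Complex.exp (freq L 0 n * y) * u y 1)) (b _ 1).neg).2, ← integral_add (b _ 0)
      (g := fun y : ℝ => -(Complex.exp (freq L 0 n * y) * u y 1)) (b _ 1).neg]
    have h1 := hu n
    rw [inner_expS, mul_eq_zero, or_iff_right (nrmC_ne_zero hL)] at h1
    have i3 := exp_freq hL 0 n
    simp only [mul_zero, zero_mul, Real.exp_zero, Complex.ofReal_one, one_mul] at i3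
    have h2 : ∀ x : ℝ, Complex.exp (-freq L 0 n * (x - L)) * u x 0
        - Complex.exp (freq L 0 n * (x - L)) * u x 1 = Complex.exp (freq L 0 n * L) *
          (Complex.exp (-freq L 0 n * x) * u x 0 + -(Complex.exp (freq L 0 n * x) * u x 1)) := by
      intro x
      rw [show -freq L 0 n * (x - L) = freq L 0 n * L + -freq L 0 n * x by ring,
        show freq L 0 n * (x - L) = -(freq L 0 n * L) + freq L 0 n * x by ring, Complex.exp_add,
        Complex.exp_add, i3]
      ring
    simp only [h2] at h1
    rw [integral_const_mul, mul_eq_zero, or_iff_right (Complex.exp_ne_zero _)] at h1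
    exact h1
  simp only [hc, norm_zero, ne_eq, OfNat.ofNat_ne_zero, not_false_eq_true, zero_pow] at hpar
  have h3 := hpar.unique hasSum_zero
  rw [j2, ← integral_add q0 q1, smul_eq_zero, or_iff_right (inv_ne_zero (by linarith))] at h3
  rw [← norm_eq_zero, ← sq_eq_zero_iff, norm_state_sq, ← h3]
  congr 1; ext x; rw [norm_val_sq]

/-- The basis of eigenfunctions of the decoupled conservative operator. -/
def expBasis (hL : 0 < L) : HilbertBasis ℤ ℂ (State L) :=
  HilbertBasis.mkOfOrthogonalEqBot (orthonormal_expS hL) (by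
    rw [Submodule.eq_bot_iff]
    intro u hu
    refine complete_expS hL fun p => ?_
    exact (Submodule.mem_orthogonal _ _).1 hu _ (Submodule.subset_span ⟨p, rfl⟩))

lemma expBasis_apply (hL : 0 < L) (p : ℤ) : expBasis hL p = expS L (freq L 0 p) := by
  rw [expBasis, HilbertBasis.coe_mkOfOrthogonalEqBot]

lemma expBasis_repr (hL : 0 < L) (u : State L) (p : ℤ) :
    (expBasis hL).repr u p = inner ℂ (expS L (freq L 0 p)) u := by
  rw [HilbertBasis.repr_apply_apply, expBasis_apply]

end expS


/-! ### The coupling in the basis of the decoupled operator -/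

section weight
variable {L : ℝ}

/-- Multiplication by `diag(exp (μ (x - L)), exp (-μ (x - L)))`. -/
def wt (L μ : ℝ) : State L →L[ℂ] State L :=
  mulOp L ![![fun x => (Real.exp (μ * (x - L)) : ℂ), 0], ![0, fun x => (Real.exp (-μ * (x - L)) : ℂ)]]

lemma wt_ae (μ : ℝ) (u : State L) : ∀ᵐ x ∂(mes L),
    wt L μ u x 0 = Real.exp (μ * (x - L)) * u x 0 ∧
    wt L μ u x 1 = Real.exp (-μ * (x - L)) * u x 1 := by
  have hb : ∀ m : ℝ, |m| = |μ| → ∀ x ∈ Ioo 0 L, ‖(Real.exp (m * (x - L)) : ℂ)‖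
      ≤ Real.exp (|μ| * L) := by
    intro m hm x hx
    rw [Complex.norm_real, Real.norm_of_nonneg (Real.exp_pos _).le, Real.exp_le_exp, ← hm]
    refine (le_abs_self _).trans ?_
    rw [abs_mul]
    gcongr
    rw [abs_le]; constructor <;> linarith [hx.1, hx.2]
  have H : BddMat L ![![fun x => (Real.exp (μ * (x - L)) : ℂ), 0],
      ![0, fun x => (Real.exp (-μ * (x - L)) : ℂ)]] (Real.exp (|μ| * L)) := by
    refine ⟨fun i j => ?_, fun i j x hx => ?_⟩
    · fin_cases i <;> fin_cases j
      · exact Continuous.aestronglyMeasurable (by dsimp; fun_prop)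
      · exact aestronglyMeasurable_zero
      · exact aestronglyMeasurable_zero
      · exact Continuous.aestronglyMeasurable (by dsimp; fun_prop)
    · fin_cases i <;> fin_cases j
      · exact hb μ rfl x hx
      · simpa using (Real.exp_pos _).le
      · simpa using (Real.exp_pos _).le
      · exact hb (-μ) (abs_neg μ) x hx
  filter_upwards [mulOp_coe H u] with x hx
  rw [wt, hx]; simp

lemma wt_neg_wt (μ : ℝ) (u : State L) : wt L (-μ) (wt L μ u) = u := state_ext <| by
  filter_upwards [wt_ae μ u, wt_ae (-μ) (wt L μ u)] with x h1 h2
  rw [h2.1, h2.2, h1.1, h1.2, ← mul_assoc, ← mul_assoc, ← Complex.ofReal_mul, ← Complex.ofReal_mul,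
    ← Real.exp_add, ← Real.exp_add]
  simp

lemma wt_zero (u : State L) : wt L 0 u = u := state_ext <| by
  filter_upwards [wt_ae 0 u] with x h1
  rw [h1.1, h1.2]; simp

/-- `wt` as an isomorphism. -/
def wtEquiv (L μ : ℝ) : State L ≃L[ℂ] State L :=
  ContinuousLinearEquiv.equivOfInverse (wt L μ) (wt L (-μ)) (wt_neg_wt μ)
    (fun u => by have := wt_neg_wt (-μ) u; rwa [neg_neg] at this)

/-- The weight shifts the frequencies by `μ`, so the basis for `μ > 0` is the image of the
orthonormal one under an isomorphism. -/
lemma wt_expS (μ : ℝ) (p : ℤ) : wt L μ (expS L (freq L 0 p)) = expS L (freq L μ p) :=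
  state_ext <| by
    filter_upwards [wt_ae μ (expS L (freq L 0 p)), expS_ae (L := L) (freq L 0 p),
      expS_ae (L := L) (freq L μ p)] with x h1 h2 h3
    rw [h1.1, h1.2, h2, h2, h3, h3]
    simp only [expF_zero, expF_one, Complex.ofReal_exp, mul_neg, neg_inj]
    constructor <;> rw [mul_left_comm, ← Complex.exp_add] <;> congr 2 <;>
      (simp only [freq]; push_cast; ring)

/-- The Riesz basis of eigenfunctions of the decoupled operator. -/
def baseIso (hL : 0 < L) (μ : ℝ) : Seq ≃L[ℂ] State L :=
  (expBasis hL).repr.symm.toContinuousLinearEquiv.trans (wtEquiv L μ)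

lemma baseIso_sg (hL : 0 < L) (μ : ℝ) (p : ℤ) : baseIso hL μ (sg p) = expS L (freq L μ p) := by
  have : baseIso hL μ (sg p) = wt L μ ((expBasis hL).repr.symm (lp.single 2 p (1 : ℂ))) := rfl
  rw [this, HilbertBasis.repr_symm_single, expBasis_apply, wt_expS]

lemma baseIso_symm (hL : 0 < L) (μ : ℝ) (u : State L) (q : ℤ) :
    (baseIso hL μ).symm u q = inner ℂ (expS L (freq L 0 q)) (wt L (-μ) u) :=
  expBasis_repr hL _ q

lemma conjS_expS (l : ℂ) : conjS L (expS L l) = expS L (conj l) := state_ext <| by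
  have h : ∀ (l : ℂ) (x : ℝ), conj (Complex.exp (l * (x - L)))
      = Complex.exp (conj l * (x - L)) := fun l x => by
    rw [← Complex.exp_conj, map_mul, map_sub, Complex.conj_ofReal, Complex.conj_ofReal]
  filter_upwards [conjS_ae (expS L l), expS_ae (L := L) l, expS_ae (L := L) (conj l)]
    with x h1 h2 h3
  rw [h1, h1, h2, h2, h3, h3]
  simp only [expF_zero, expF_one, map_neg, map_mul, h, conj_nrmC, and_self]

lemma inner_conjS (u v : State L) : inner ℂ (conjS L u) (conjS L v) = conj (inner ℂ u v) := by
  rw [← pairing_eq_inner, ← pairing_eq_inner, pairing, pairing, ← integral_conj]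
  refine integral_congr_ae ?_
  filter_upwards [conjS_ae u, conjS_ae v] with x h1 h2
  simp [h1, h2]

lemma inner_swapS (u v : State L) : inner ℂ (swapS L u) (swapS L v) = inner ℂ u v := by
  rw [← pairing_eq_inner, ← pairing_eq_inner, pairing, pairing]
  refine integral_congr_ae ?_
  filter_upwards [swapS_ae u, swapS_ae v] with x h1 h2
  rw [h1.1, h1.2, h2.1, h2.2, add_comm]

lemma wt_conjS (μ : ℝ) (u : State L) : wt L μ (conjS L u) = conjS L (wt L μ u) := state_ext <| by
  filter_upwards [wt_ae μ u, wt_ae μ (conjS L u), conjS_ae u, conjS_ae (wt L μ u)] with x h1 h2 h3 h4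
  rw [h2.1, h2.2, h4, h4, h3, h3, h1.1, h1.2, map_mul, map_mul, Complex.conj_ofReal,
    Complex.conj_ofReal]
  exact ⟨rfl, rfl⟩

lemma baseIso_symm_conjS (hL : 0 < L) (μ : ℝ) (u : State L) :
    (baseIso hL μ).symm (conjS L u) = reflC ((baseIso hL μ).symm u) := by
  ext q
  rw [reflC_apply, baseIso_symm, baseIso_symm, wt_conjS, ← inner_conjS, conjS_expS, conj_freq,
    neg_neg]

lemma swapS_conjS_expS (p : ℤ) :
    swapS L (conjS L (expS L (freq L 0 p))) = -expS L (freq L 0 p) := by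
  rw [conjS_expS, conj_freq_zero]
  refine state_ext ?_
  filter_upwards [swapS_ae (expS L (-freq L 0 p)), expS_ae (L := L) (freq L 0 p),
    expS_ae (L := L) (-freq L 0 p), Lp.coeFn_neg (expS L (freq L 0 p))] with x h1 h2 h3 h4
  rw [h1.1, h1.2, h4, Pi.neg_apply, PiLp.neg_apply, PiLp.neg_apply, h2, h2, h3, h3]
  simp [expF_zero, expF_one]

lemma baseIso_symm_star (hL : 0 < L) (u : State L) :
    (baseIso hL 0).symm (swapS L (conjS L u)) = -star ((baseIso hL 0).symm u) := by
  ext q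
  rw [lp.coeFn_neg, Pi.neg_apply, lp.star_apply, baseIso_symm, baseIso_symm, neg_zero, wt_zero,
    wt_zero, RCLike.star_def, ← inner_conjS,
    ← inner_swapS (conjS L (expS L (freq L 0 q))) (conjS L u), swapS_conjS_expS, inner_neg_left, neg_neg]

/-! ### Matrix of the coupling and perturbed eigenbases -/

section coupling
variable {h : ℝ → ℝ} {ε : ℝ}

lemma couple_conjS (H : IsCoupling L h ε) (hL : 0 ≤ L) (u : State L) :
    couple L h (conjS L u) = conjS L (couple L h u) := state_ext <| by
  filter_upwards [couple_ae H hL u, couple_ae H hL (conjS L u), conjS_ae u,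
    conjS_ae (couple L h u)] with x h1 h2 h3 h4
  rw [h2.1, h2.2, h4, h4, h3, h3, h1.1, h1.2, map_neg, map_mul, map_mul, Complex.conj_ofReal]
  exact ⟨rfl, rfl⟩

lemma couple_swapS (H : IsCoupling L h ε) (hL : 0 ≤ L) (u : State L) :
    couple L h (swapS L u) = -swapS L (couple L h u) := state_ext <| by
  filter_upwards [couple_ae H hL u, couple_ae H hL (swapS L u), swapS_ae u,
    swapS_ae (couple L h u), Lp.coeFn_neg (swapS L (couple L h u))] with x h1 h2 h3 h4 h5
  rw [h2.1, h2.2, h5, Pi.neg_apply, PiLp.neg_apply, PiLp.neg_apply, h4.1, h4.2, h3.1, h3.2, h1.1,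
    h1.2, neg_neg]
  exact ⟨rfl, rfl⟩

/-- The matrix of the coupling. -/
def coupleMat (hL : 0 < L) (μ : ℝ) (h : ℝ → ℝ) : Seq →L[ℂ] Seq :=
  ((baseIso hL μ).symm : State L →L[ℂ] Seq).comp
    ((couple L h).comp (baseIso hL μ : Seq →L[ℂ] State L))

lemma coupleMat_apply (hL : 0 < L) (μ : ℝ) (x : Seq) :
    coupleMat hL μ h x = (baseIso hL μ).symm (couple L h (baseIso hL μ x)) := rfl

lemma norm_coupleMat_le (hL : 0 < L) (μ : ℝ) (H : IsCoupling L h ε) : ‖coupleMat hL μ h‖ ≤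
    2 * (‖((baseIso hL μ).symm : State L →L[ℂ] Seq)‖ * ‖(baseIso hL μ : Seq →L[ℂ] State L)‖) * ε := by
  refine (ContinuousLinearMap.opNorm_comp_le _ _).trans ?_
  have h1 := ContinuousLinearMap.opNorm_comp_le (couple L h) (baseIso hL μ : Seq →L[ℂ] State L)
  have h2 := norm_couple_le H hL.le
  calc _ ≤ ‖((baseIso hL μ).symm : State L →L[ℂ] Seq)‖ *
        (2 * ε * ‖(baseIso hL μ : Seq →L[ℂ] State L)‖) := by
        gcongr; exact h1.trans (by gcongr)
    _ = _ := by ring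

lemma baseIso_reflC (hL : 0 < L) (μ : ℝ) (x : Seq) :
    baseIso hL μ (reflC x) = conjS L (baseIso hL μ x) := by
  rw [← ContinuousLinearEquiv.eq_symm_apply, baseIso_symm_conjS,
    ContinuousLinearEquiv.symm_apply_apply]

lemma baseIso_star (hL : 0 < L) (x : Seq) :
    baseIso hL 0 (star x) = -swapS L (conjS L (baseIso hL 0 x)) := by
  rw [← ContinuousLinearEquiv.eq_symm_apply, map_neg, baseIso_symm_star,
    ContinuousLinearEquiv.symm_apply_apply, neg_neg]

lemma coupleMat_reflC (hL : 0 < L) (μ : ℝ) (H : IsCoupling L h ε) (x : Seq) :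
    coupleMat hL μ h (reflC x) = reflC (coupleMat hL μ h x) := by
  rw [coupleMat_apply, baseIso_reflC, couple_conjS H hL.le, baseIso_symm_conjS]; rfl

/-- The sign comes from `couple_swapS`; it is what keeps the open-loop eigenvalues imaginary after
perturbation. -/
lemma coupleMat_star (hL : 0 < L) (H : IsCoupling L h ε) (x : Seq) :
    coupleMat hL 0 h (star x) = -star (coupleMat hL 0 h x) := by
  rw [coupleMat_apply, baseIso_star, map_neg, couple_swapS H hL.le, couple_conjS H hL.le, neg_neg,
    baseIso_symm_star]; rfl

/-- The coupling exchanges the components, whose exponentials have opposite phases; hence the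
frequencies add and the entry depends on `p + q` only. -/
lemma coupleMat_sg (hL : 0 < L) (μ : ℝ) (H : IsCoupling L h ε) (p q : ℤ) :
    coupleMat hL μ h (sg p) q = (2 * L : ℂ)⁻¹ *
      ((∫ x, h x * Complex.exp (freq L (2 * μ) (p + q) * (x - L)) ∂(mes L))
        - ∫ x, h x * Complex.exp (-freq L (2 * μ) (p + q) * (x - L)) ∂(mes L)) := by
  have hi : ∀ r : ℂ, Integrable (fun x : ℝ => h x * Complex.exp (r * (x - L))) (mes L) := fun r =>
    integrable_of_continuousOn ((Complex.continuous_ofReal.comp_continuousOn H.cont).mul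
      (continuous_exp_shift r).continuousOn)
  have hr : freq L (2 * μ) (p + q) = freq L 0 q + (freq L μ p + μ) := by
    simp only [freq]; push_cast; ring
  rw [coupleMat_apply, baseIso_sg, baseIso_symm, inner_expS, ← integral_sub (hi _) (hi _),
    ← nrmC_mul hL, mul_assoc]
  congr 1
  rw [← integral_const_mul]
  refine integral_congr_ae ?_
  filter_upwards [wt_ae (-μ) (couple L h (expS L (freq L μ p))),
    couple_ae H hL.le (expS L (freq L μ p)), expS_ae (L := L) (freq L μ p)] with x h1 h2 h3
  rw [h1.1, h1.2, h2.1, h2.2, h3, h3, hr, expF_zero, expF_one, neg_neg, Complex.ofReal_exp,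
    Complex.ofReal_exp]
  have e1 : Complex.exp ((freq L 0 q + (freq L μ p + μ)) * (x - L))
      = Complex.exp (freq L 0 q * (x - L)) * (Complex.exp ((μ * (x - L) : ℝ))
        * Complex.exp (freq L μ p * (x - L))) := by
    rw [← Complex.exp_add, ← Complex.exp_add]; congr 1; push_cast; ring
  have e2 : Complex.exp (-(freq L 0 q + (freq L μ p + μ)) * (x - L))
      = Complex.exp (-freq L 0 q * (x - L)) * (Complex.exp ((-μ * (x - L) : ℝ))
        * Complex.exp (-freq L μ p * (x - L))) := by
    rw [← Complex.exp_add, ← Complex.exp_add]; congr 1; push_cast; ring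
  rw [e1, e2]; ring

/-- The oscillating integrals of the coupling decay like the inverse of the frequency. -/
lemma oscillation_le {h' H : ℝ → ℝ} (hL : 0 < L) (K : IsSmallCoupling L h h' H ε) {r : ℂ} {ρ : ℝ}
    (hr : |r.re| ≤ ρ) {k : ℤ} (hk : Real.pi / L * |(k : ℝ)| ≤ ‖r‖) :
    ‖∫ x, h x * Complex.exp (r * (x - L)) ∂(mes L)‖
      ≤ 2 * ε * L * Real.exp (ρ * L) * hseq k := by
  have he := K.pos
  have hs := K.small
  have hexp : ∀ x ∈ Icc 0 L, ‖Complex.exp (r * (x - L))‖ ≤ Real.exp (ρ * L) := by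
    intro x hx
    rw [Complex.norm_exp, Real.exp_le_exp]
    have : (r * (x - L)).re = r.re * (x - L) := by
      rw [← Complex.ofReal_sub, Complex.re_mul_ofReal]
    rw [this]
    refine (le_abs_self _).trans ?_
    rw [abs_mul]
    have : |x - L| ≤ L := by rw [abs_le]; constructor <;> linarith [hx.1, hx.2]
    gcongr
    exact (abs_nonneg _).trans hr
  have hE := Real.exp_pos (ρ * L)
  have hh : ∀ x ∈ Icc 0 L, ‖(h x : ℂ) * Complex.exp (r * (x - L))‖ ≤ ε * Real.exp (ρ * L) := by
    intro x hx
    rw [norm_mul, Complex.norm_real]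
    gcongr
    · exact K.bound x hx
    · exact hexp x hx
  have cc : ContinuousOn (fun x : ℝ => (h x : ℂ)) (Icc 0 L) :=
    Complex.continuous_ofReal.comp_continuousOn K.cont
  have J0 := norm_integral_mes_le hL.le fun x hx => hh x ⟨hx.1.le, hx.2.le⟩
  have i1 : Integrable (fun x => (h x : ℂ) * Complex.exp (r * (x - L))) (mes L) :=
    integrable_of_continuousOn (cc.mul (continuous_exp_shift r).continuousOn)
  have hb2 : ∀ x ∈ Ioo 0 L, ‖((deriv h x : ℝ) : ℂ) * Complex.exp (r * (x - L))‖
      ≤ 2 * ε ^ 2 * Real.exp (ρ * L) := by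
    intro x hx
    rw [norm_mul, Complex.norm_real, (K.deriv x hx).deriv]
    gcongr
    · exact K.bound' x hx
    · exact hexp x ⟨hx.1.le, hx.2.le⟩
  have i2 : Integrable (fun x => ((deriv h x : ℝ) : ℂ) * Complex.exp (r * (x - L))) (mes L) := by
    refine Integrable.of_bound (C := 2 * ε ^ 2 * Real.exp (ρ * L)) ?_ (ae_mem.mono hb2)
    exact ((Complex.measurable_ofReal.comp (measurable_deriv h)).mul
      (continuous_exp_shift r).measurable).aestronglyMeasurable
  have hd : ∀ x ∈ Ioo 0 L, HasDerivAt h (deriv h x) x := fun x hx =>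
    (K.deriv x hx).differentiableAt.hasDerivAt
  have hp := HasPrim.of_hasDerivAt (L := L) (F := fun x => (h x : ℂ) * Complex.exp (r * (x - L)))
    (f := fun x => ((deriv h x : ℝ) : ℂ) * Complex.exp (r * (x - L))
      + r * ((h x : ℂ) * Complex.exp (r * (x - L))))
    (cc.mul (continuous_exp_shift r).continuousOn)
    (fun x hx => ((hd x hx).ofReal_comp.mul (hasDerivAt_exp_shift r x)).congr_deriv (by ring)) (i2.add (i1.const_mul r))
  -- One integration by parts gains a factor `1/|r|`. Together with the trivial bound `J0` it
  -- controls `(1 + |k|) ‖J‖`, including `k = 0`.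
  have e := hp.2 L ⟨hL.le, le_rfl⟩
  rw [integral_mes_full hL.le, integral_add i2 (i1.const_mul r), integral_const_mul] at e
  have J1 := norm_integral_mes_le hL.le hb2
  have a1 := hh L ⟨hL.le, le_rfl⟩
  have a0 := hh 0 ⟨le_rfl, hL.le⟩
  set J := ∫ x, (h x : ℂ) * Complex.exp (r * (x - L)) ∂(mes L) with hJ
  have hrJ : ‖r‖ * ‖J‖ ≤ 3 * ε * Real.exp (ρ * L) := by
    rw [← norm_mul]
    have : r * J = h L * Complex.exp (r * (L - L)) - h 0 * Complex.exp (r * ((0 : ℝ) - L))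
        - ∫ x, ((deriv h x : ℝ) : ℂ) * Complex.exp (r * (x - L)) ∂(mes L) := by
      linear_combination -e
    rw [this]
    refine (norm_sub_le _ _).trans (le_trans (add_le_add ((norm_sub_le _ _).trans
      (add_le_add a1 a0)) J1) ?_)
    nlinarith [mul_pos he hE, mul_le_mul_of_nonneg_right hs (mul_pos he hE).le]
  have hkJ : |(k : ℝ)| * ‖J‖ ≤ ε * Real.exp (ρ * L) * L := by
    have h1 : Real.pi / L * |(k : ℝ)| * ‖J‖ ≤ 3 * ε * Real.exp (ρ * L) :=
      (mul_le_mul_of_nonneg_right hk (norm_nonneg _)).trans hrJ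
    rw [div_mul_eq_mul_div, div_mul_eq_mul_div, div_le_iff₀ hL] at h1
    have h2 := Real.pi_gt_three
    nlinarith [mul_nonneg (abs_nonneg (k : ℝ)) (norm_nonneg J)]
  rw [hseq, ← div_eq_mul_inv, le_div_iff₀ (by positivity)]
  nlinarith

lemma norm_coupleMat_sg_le {h' H : ℝ → ℝ} (hL : 0 < L) {μ : ℝ} (hμ : 0 ≤ μ)
    (K : IsSmallCoupling L h h' H ε) (p q : ℤ) :
    ‖coupleMat hL μ h (sg p) q‖ ≤ 2 * Real.exp (2 * μ * L) * ε * hseq (p + q) := by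
  have hre : (freq L (2 * μ) (p + q)).re = 2 * μ := by simp [freq]
  have hk : Real.pi / L * |((p + q : ℤ) : ℝ)| ≤ ‖freq L (2 * μ) (p + q)‖ := by
    have h1 : (freq L (2 * μ) (p + q)).im = Real.pi / L * ((p + q : ℤ) : ℝ) := by
      simp [freq]; ring
    have h2 := Complex.abs_im_le_norm (freq L (2 * μ) (p + q))
    rwa [h1, abs_mul, abs_of_pos (by positivity)] at h2
  rw [coupleMat_sg hL μ K.toIsCoupling, norm_mul]
  have j1 := oscillation_le hL K (r := freq L (2 * μ) (p + q)) (ρ := 2 * μ)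
    (by rw [hre, abs_of_nonneg (by positivity)]) hk
  have j2 := oscillation_le hL K (r := -freq L (2 * μ) (p + q)) (ρ := 2 * μ)
    (by rw [Complex.neg_re, hre, abs_neg, abs_of_nonneg (by positivity)]) (by rwa [norm_neg])
  have j3 : ‖(2 * L : ℂ)⁻¹‖ = (2 * L)⁻¹ := by
    rw [norm_inv, norm_mul, Complex.norm_real, Real.norm_of_nonneg hL.le]; simp
  rw [j3]
  calc _ ≤ (2 * L)⁻¹ * (2 * ε * L * Real.exp (2 * μ * L) * hseq (p + q)
        + 2 * ε * L * Real.exp (2 * μ * L) * hseq (p + q)) := by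
        gcongr; exact (norm_sub_le _ _).trans (add_le_add j1 j2)
    _ = _ := by field_simp; ring

lemma couple_zero (u : State L) (hL : 0 ≤ L) : couple L (fun _ => 0) u = 0 := by
  have H : IsCoupling L (fun _ => 0) 0 := ⟨continuousOn_const, by simp⟩
  have := (couple L (fun _ => 0)).le_of_opNorm_le (norm_couple_le H hL) u
  simpa using this

/-- A perturbed coordinate vector gives an eigenfunction. -/
lemma IsPert.exists_eigen (hL : 0 < L) {μ : ℝ} {p : ℤ} {v : Seq} {η : ℂ}
    (P : IsPert (coupleMat hL μ h) (freq L μ) p v η) : ∃ α : DomT L μ,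
    toL2 α = baseIso hL μ (sg p + v) ∧ Aop L _ h α = (freq L μ p + η) • toL2 α := by
  choose f hf hf' using exists_expD hL μ
  -- The eigenvector is summed in the decoupled basis, hence with zero coupling; its image there is
  -- the eigenvalue term minus the coupling term.
  obtain ⟨α, h1, h2, -⟩ := exists_dom_series (h := fun _ => 0) (f := f) hL
    (Φ := baseIso hL μ) (fun n => by rw [baseIso_sg, hf])
    (fun n => by rw [Aop_apply, couple_zero _ hL.le, hf', add_zero, hf]) (sg p + v)
    ((freq L μ p + η) • (sg p + v) - coupleMat hL μ h (sg p + v)) (fun q => by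
      rw [lp.coeFn_sub, Pi.sub_apply, lp.coeFn_smul, Pi.smul_apply, smul_eq_mul, P.eq]; ring)
  refine ⟨α, h1, ?_⟩
  rw [Aop_apply, couple_zero _ hL.le, add_zero] at h2
  rw [Aop_apply, h2, h1, map_sub, coupleMat_apply, ContinuousLinearEquiv.apply_symm_apply,
    sub_add_cancel, map_smul]

/-- Riesz bases of eigenfunctions, for a small coupling. -/
theorem exists_eigenbasis (hL : 0 < L) {μ : ℝ} (hμ : 0 ≤ μ) : ∃ ε₀ > 0, ∀ {h h' H : ℝ → ℝ} {ε : ℝ},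
    IsSmallCoupling L h h' H ε → ε < ε₀ → ∃ (f : ℤ → DomT L μ) (ev : ℤ → ℂ) (Φ : Seq ≃L[ℂ] State L),
      (∀ n, Φ (sg n) = toL2 (f n)) ∧ (∀ n, Aop L _ h (f n) = ev n • toL2 (f n)) ∧
      (∃ C : ℝ, ∀ n : ℤ, n ≠ 0 → ‖ev n - freq L μ n‖ ≤ C / |(n : ℝ)|) ∧
      (∀ n, ev (-n) = conj (ev n)) ∧ (∀ n, toL2 (f (-n)) = conjS L (toL2 (f n))) ∧
      (μ = 0 → ∀ n, conj (ev n) = -ev n ∧ swapS L (conjS L (toL2 (f n))) = -toL2 (f n)) := by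
  set N := ‖((baseIso hL μ).symm : State L →L[ℂ] Seq)‖ * ‖(baseIso hL μ : Seq →L[ℂ] State L)‖ with hN
  have hN0 : 0 ≤ N := by positivity
  set K := 2 * Real.exp (2 * μ * L) with hK
  have hK0 : 0 ≤ K := by positivity
  set g := Real.pi / L with hg
  have hg0 : 0 < g := by positivity
  have hh0 := hnorm_nonneg
  -- `32N` gives the contraction condition, `8K hnorm²` the quadratic closeness to the decoupled
  -- basis, and `1` keeps the denominator positive.
  refine ⟨g / (32 * N + 8 * K * hnorm ^ 2 + 1), by positivity, fun {h h' H ε} C hε => ?_⟩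
  have he := C.pos
  rw [lt_div_iff₀ (by positivity)] at hε
  have s1 : 16 * (2 * N * ε) ≤ g := by
    have : 0 ≤ ε * (8 * K * hnorm ^ 2) := by positivity
    nlinarith
  have s2 : 8 * (K * ε) / g * hnorm * hnorm < 1 := by
    rw [div_mul_eq_mul_div, div_mul_eq_mul_div, div_lt_one hg0]
    have : 0 ≤ ε * (32 * N) := by positivity
    nlinarith
  have hb := norm_coupleMat_le hL μ C.toIsCoupling
  have hgap' : ∀ p q, g * |((p - q : ℤ) : ℝ)| ≤ ‖freq L μ p - freq L μ q‖ := fun p q =>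
    (norm_freq_sub hL μ p q).ge
  have hgap : ∀ p q, p ≠ q → g ≤ ‖freq L μ p - freq L μ q‖ := fun p q hpq =>
    (le_mul_of_one_le_right hg0.le (by
      exact_mod_cast Int.one_le_abs (sub_ne_zero.2 hpq))).trans (hgap' p q)
  have hβ := norm_coupleMat_sg_le hL hμ C
  choose v η P using exists_isPert hg0 hb s1 hgap
  have hv := fun p => (P p).norm_le_hseq hg0 hb s1 hgap' hβ
  have hη := fun p => (P p).eta_le_hseq hg0 hb s1 hgap' hβ
  obtain ⟨V, hV⟩ := exists_riesz_of_close s2 hv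
  choose f hf hf' using fun p => (P p).exists_eigen hL
  -- The reflected conjugate of a solution for `p` solves the problem for `-p`, and the solution is
  -- unique.
  have hrefl : ∀ p, v (-p) = reflC (v p) ∧ η (-p) = conj (η p) := fun p =>
    (P (-p)).unique hg0 hb s1 hgap ((P p).reflConj (coupleMat_reflC hL μ C.toIsCoupling)
      fun q => (conj_freq μ q).symm)
  refine ⟨f, fun p => freq L μ p + η p, V.trans (baseIso hL μ), fun n => ?_, hf',
    ⟨K * ε + 2 * N * ε * (8 * (K * ε) / g * hnorm), fun n hn => ?_⟩, fun n => ?_, fun n => ?_,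
    fun h0 n => ?_⟩
  · rw [ContinuousLinearEquiv.trans_apply, hV, hf]
  · rw [add_sub_cancel_left]
    refine (hη n).trans ?_
    rw [hseq, ← div_eq_mul_inv]
    have : 0 < |(n : ℝ)| := by positivity
    gcongr
    linarith
  · simp only [(hrefl n).2, map_add, conj_freq]
  · rw [hf, hf, (hrefl n).1, ← reflC_sg, ← reflC_add, baseIso_reflC]
  · subst h0
    obtain ⟨h1, h2⟩ := (P n).unique hg0 hb s1 hgap ((P n).starConj
      (coupleMat_star hL C.toIsCoupling) fun q => conj_freq_zero q)
    constructor
    · rw [map_add, conj_freq_zero, neg_add, ← neg_eq_iff_eq_neg.2 h2]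
    · have := baseIso_star hL (sg n + v n)
      rw [star_add, star_sg, ← h1] at this
      rw [hf]
      exact neg_eq_iff_eq_neg.1 this.symm

end coupling

end weight


/-! ### Eigenfunctions and their values at `0` -/

section eigval
variable {L κ : ℝ} {h : ℝ → ℝ} {ε : ℝ} {l : ℂ}

lemma rep_eq_of_ae (hL : 0 < L) (α : Dom L κ) {i : Fin 2} {F : ℝ → ℂ}
    (hF : ContinuousOn F (Icc 0 L)) (h : ∀ᵐ x ∂(mes L), toL2 α x i = F x) :
    EqOn (rep α i) F (Icc 0 L) := by
  refine Measure.eqOn_Icc_of_ae_eq (μ := volume) hL.ne ?_ ((rep_hasPrim α i).continuousOn hL.le) hF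
  rw [restrict_Ioo_eq_restrict_Icc.symm]
  filter_upwards [h, rep_ae α] with x h1 h2
  rw [← h2, h1]

lemma norm_toL2_sq (α : Dom L κ) :
    ‖toL2 α‖ ^ 2 = ∫ x, (‖rep α 0 x‖ ^ 2 + ‖rep α 1 x‖ ^ 2) ∂(mes L) := by
  rw [norm_state_sq]
  refine integral_congr_ae ?_
  filter_upwards [rep_ae α] with x hx
  rw [norm_val_sq, hx, hx]

lemma energy_zero (α : Dom L κ) :
    ‖rep α 0 0‖ ^ 2 + ‖rep α 1 0‖ ^ 2 = (1 + κ ^ 2) * ‖rep α 1 0‖ ^ 2 := by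
  rw [rep_bc_zero, norm_mul, norm_neg, Complex.norm_real, mul_pow, Real.norm_eq_abs, sq_abs]; ring

/-- The norm of an eigenfunction is comparable with its value at `0`. -/
lemma eigen_norm_bounds (hL : 0 < L) (H : IsCoupling L h ε) {α : Dom L κ}
    (hα : Aop L κ h α = l • toL2 α) {ρ : ℝ} (hρ : |l.re| ≤ ρ) :
    ‖toL2 α‖ ^ 2 ≤ Real.exp ((2 * ρ + 2 * ε) * L) * L * (1 + κ ^ 2) * ‖rep α 1 0‖ ^ 2 ∧
    L * (1 + κ ^ 2) * ‖rep α 1 0‖ ^ 2 ≤ Real.exp ((2 * ρ + 2 * ε) * L) * ‖toL2 α‖ ^ 2 := by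
  have S := eigSol_of_eigen hL.le H hα
  have hρ0 : 0 ≤ ρ := (abs_nonneg _).trans hρ
  have hε0 := H.nonneg hL.le
  set X := Real.exp ((2 * ρ + 2 * ε) * L) with hX
  have hXle : ∀ x ∈ Ioo 0 L, Real.exp ((2 * ρ + 2 * ε) * (x - 0)) ≤ X := fun x hx => by
    rw [hX, sub_zero, Real.exp_le_exp]
    exact mul_le_mul_of_nonneg_left hx.2.le (by positivity)
  have hint : Integrable (fun x => ‖rep α 0 x‖ ^ 2 + ‖rep α 1 x‖ ^ 2) (mes L) :=
    (S.cont_energy.integrableOn_Icc (μ := volume)).mono_set Ioo_subset_Icc_self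
  have hconst : ∀ c : ℝ, ∫ _x, c ∂(mes L) = c * L := fun c => by
    rw [integral_const, mes_real_univ hL.le, smul_eq_mul, mul_comm]
  have e0 := energy_zero α
  constructor
  · have h1 : ∫ x, (‖rep α 0 x‖ ^ 2 + ‖rep α 1 x‖ ^ 2) ∂(mes L)
        ≤ ∫ _x, X * ((1 + κ ^ 2) * ‖rep α 1 0‖ ^ 2) ∂(mes L) := by
      refine integral_mono_ae hint (integrable_const _) (ae_mem.mono fun x hx => ?_)
      have := S.energy_fwd H hρ ⟨le_rfl, hL.le⟩ ⟨hx.1.le, hx.2.le⟩ hx.1.le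
      rw [e0] at this
      exact this.trans (mul_le_mul_of_nonneg_right (hXle x hx) (by positivity))
    rw [norm_toL2_sq]
    refine h1.trans_eq ?_
    rw [hconst]; ring
  · have h1 : ∫ _x, (1 + κ ^ 2) * ‖rep α 1 0‖ ^ 2 ∂(mes L)
        ≤ ∫ x, X * (‖rep α 0 x‖ ^ 2 + ‖rep α 1 x‖ ^ 2) ∂(mes L) := by
      refine integral_mono_ae (integrable_const _) (hint.const_mul _) (ae_mem.mono fun x hx => ?_)
      have := S.energy_bwd H hρ ⟨le_rfl, hL.le⟩ ⟨hx.1.le, hx.2.le⟩ hx.1.le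
      rw [e0] at this
      exact this.trans (mul_le_mul_of_nonneg_right (hXle x hx) (by positivity))
    rw [hconst, integral_const_mul, ← norm_toL2_sq] at h1
    linarith

/-- Uniqueness for the Cauchy problem: the boundary condition makes the first component vanish at
`0` as well. -/
lemma eigen_eq_zero (hL : 0 < L) (H : IsCoupling L h ε) {α : Dom L κ}
    (hα : Aop L κ h α = l • toL2 α) (h0 : rep α 1 0 = 0) : toL2 α = 0 := by
  have := (eigen_norm_bounds hL H hα le_rfl).1
  rw [h0, norm_zero, zero_pow two_ne_zero, mul_zero] at this
  rw [← norm_eq_zero, ← sq_eq_zero_iff]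
  exact le_antisymm this (sq_nonneg _)

lemma rep_linear (α β : Dom L κ) (a b : ℂ) (i : Fin 2) (hL : 0 < L) :
    rep (a • α - b • β) i 0 = a * rep α i 0 - b * rep β i 0 := by
  have h := (valZeroL hL κ).map_sub (a • α) (b • β)
  rw [map_smul, map_smul] at h
  simp only [valZeroL_apply] at h
  simp only [rep_zero, h]
  rfl

/-- Eigenvalues are simple. -/
lemma eigen_simple (hL : 0 < L) (H : IsCoupling L h ε) {α β : Dom L κ}
    (hα : Aop L κ h α = l • toL2 α) (hβ : Aop L κ h β = l • toL2 β) :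
    rep β 1 0 • toL2 α = rep α 1 0 • toL2 β := by
  have e : toL2 (rep β 1 0 • α - rep α 1 0 • β) = rep β 1 0 • toL2 α - rep α 1 0 • toL2 β := by
    rw [← toL2L_apply, map_sub, map_smul, map_smul]; rfl
  rw [← sub_eq_zero, ← e]
  refine eigen_eq_zero (l := l) hL H ?_ ?_
  · rw [e, map_sub, map_smul, map_smul, hα, hβ, smul_sub, smul_comm l, smul_comm l]
  · rw [rep_linear _ _ _ _ _ hL]; ring

lemma riesz_ne_zero {V : Type*} [NormedAddCommGroup V] [NormedSpace ℂ V] (Φ : Seq ≃L[ℂ] V) (n : ℤ) :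
    Φ (sg n) ≠ 0 := fun h0 => by
  have := norm_sg n
  rw [(map_eq_zero_iff Φ Φ.injective).1 h0, norm_zero] at this
  exact zero_ne_one this

/-- The eigenvalues of a Riesz basis of eigenfunctions are distinct. -/
lemma eigen_injective (hL : 0 < L) (H : IsCoupling L h ε) {f : ℤ → Dom L κ} {ev : ℤ → ℂ}
    {Φ : Seq ≃L[ℂ] State L} (hΦ : ∀ n, Φ (sg n) = toL2 (f n))
    (hf : ∀ n, Aop L κ h (f n) = ev n • toL2 (f n)) : Function.Injective ev := by
  intro n m hnm
  by_contra hne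
  have h1 := eigen_simple hL H (hf n) (by rw [hnm]; exact hf m)
  rw [← hΦ, ← hΦ, ← map_smul, ← map_smul] at h1
  have h2 := congrArg (fun x : Seq => x m) (Φ.injective h1)
  simp only [lp.coeFn_smul, Pi.smul_apply, sg_apply, if_neg (Ne.symm hne), if_true, smul_eq_mul,
    mul_zero, mul_one] at h2
  exact riesz_ne_zero Φ n (by rw [hΦ]; exact eigen_eq_zero hL H (hf n) h2.symm)

lemma rep_conjS (hL : 0 < L) {α β : Dom L κ} (h : toL2 β = conjS L (toL2 α)) (i : Fin 2) :
    EqOn (rep β i) (fun x => conj (rep α i x)) (Icc 0 L) := by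
  refine rep_eq_of_ae hL β (Complex.continuous_conj.comp_continuousOn
    ((rep_hasPrim α i).continuousOn hL.le)) ?_
  rw [h]
  filter_upwards [conjS_ae (toL2 α), rep_ae α] with x h1 h2
  rw [h1, h2]

lemma rep_swapS (hL : 0 < L) {α : Dom L κ} (h : swapS L (conjS L (toL2 α)) = -toL2 α) :
    EqOn (rep α 1) (fun x => -conj (rep α 0 x)) (Icc 0 L) := by
  refine rep_eq_of_ae hL α (Complex.continuous_conj.comp_continuousOn
    ((rep_hasPrim α 0).continuousOn hL.le)).neg ?_
  have e : toL2 α = -swapS L (conjS L (toL2 α)) := by rw [h, neg_neg]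
  filter_upwards [conjS_ae (toL2 α), rep_ae α, swapS_ae (conjS L (toL2 α)),
    Lp.coeFn_neg (swapS L (conjS L (toL2 α))), Lp.ext_iff.1 e] with x h1 h2 h3 h4 h5
  rw [h5, h4, Pi.neg_apply, PiLp.neg_apply, h3.2, h1, h2]

/-- Extension of a conjugation symmetry from the basis vectors. -/
lemma iso_reflC {Φ : Seq ≃L[ℂ] State L} (h : ∀ n, Φ (sg (-n)) = conjS L (Φ (sg n))) (x : Seq) :
    Φ (reflC x) = conjS L (Φ x) := by
  have h1 : HasSum (fun n => conj (x n) • Φ (sg (-n))) (conjS L (Φ x)) := by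
    have := ((seq_hasSum x).mapL (Φ : Seq →L[ℂ] State L)).map (conjS L) (conjS L).continuous
    refine this.congr_fun fun n => ?_
    rw [Function.comp_apply, map_smul, h]
    exact (map_smulₛₗ (conjS L) (x n) _).symm
  have h2 : HasSum (fun n => reflC x n • Φ (sg n)) (Φ (reflC x)) := by
    refine ((seq_hasSum (reflC x)).mapL (Φ : Seq →L[ℂ] State L)).congr_fun fun n => ?_
    exact (map_smul Φ _ _).symm
  refine (((Equiv.neg ℤ).hasSum_iff).2 h2).unique (h1.congr_fun fun n => ?_)
  simp

end eigval

/-! ### Existence of the two families -/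

section existence
variable {L γ μ κ : ℝ} {h : ℝ → ℝ} {ε : ℝ}

/-- The biorthogonal function `φ m` is the Riesz representative of the `m`-th coordinate functional.
-/
theorem nonempty_targetFamily (hL : 0 < L) {f : ℤ → DomT L μ} {ev : ℤ → ℂ} {Φ : Seq ≃L[ℂ] State L}
    (H : IsCoupling L (coup L γ) ε) (hΦ : ∀ n, Φ (sg n) = toL2 (f n))
    (heig : ∀ n, Aop L _ (coup L γ) (f n) = ev n • toL2 (f n))
    (hasym : ∃ C : ℝ, ∀ n : ℤ, n ≠ 0 → ‖ev n - freq L μ n‖ ≤ C / |(n : ℝ)|)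
    (hev : ∀ n, ev (-n) = conj (ev n)) (hf : ∀ n, toL2 (f (-n)) = conjS L (toL2 (f n))) :
    Nonempty (TargetFamily L γ μ) := by
  let φ : ℤ → State L := fun m => (InnerProductSpace.toDual ℂ (State L)).symm
    ((coord m).comp (Φ.symm : State L →L[ℂ] Seq))
  have hφ : ∀ m u, inner ℂ (φ m) u = Φ.symm u m := fun m u => by
    have : inner ℂ (φ m) u = (coord m).comp (Φ.symm : State L →L[ℂ] Seq) u :=
      InnerProductSpace.toDual_symm_apply
    rw [this]; exact coord_apply m _
  have hcs : ∀ n, toL2 (f (-n)) = conjS L (toL2 (f n)) ↔ Φ (sg (-n)) = conjS L (Φ (sg n)) :=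
    fun n => by rw [hΦ, hΦ]
  have hconj : ∀ n, φ (-n) = conjS L (φ n) := fun n => by
    refine ext_inner_right ℂ fun u => ?_
    rw [hφ, ← conjS_conjS u, inner_conjS, hφ, conjS_conjS, ← (Φ.apply_symm_apply u),
      ← iso_reflC fun n => (hcs n).1 (hf n), Φ.symm_apply_apply, Φ.symm_apply_apply, reflC_apply,
      Complex.conj_conj]
  exact ⟨{ f := f, φ := φ, ev := ev
           eigen := fun n => (eigen_iff hL.le H _ _).2 (heig n)
           riesz := ⟨Φ, hΦ⟩
           biorth := fun n m => by
            rw [pairing_eq_inner, hφ, ← hΦ, Φ.symm_apply_apply, sg_apply]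
            simp only [eq_comm]
           ev_asymp := hasym
           ev_conj := hev
           f_conj := fun n => by rw [hf]; exact conjS_ae _
           φ_conj := fun n => by rw [hconj]; exact conjS_ae _ }⟩

/-- The given basis only has to be normalized; orthogonality comes from Green's formula and the
simplicity of the eigenvalues. -/
theorem nonempty_openLoopFamily (hL : 0 < L) {f : ℤ → DomA L} {ev : ℤ → ℂ} {Φ : Seq ≃L[ℂ] State L}
    (H : IsCoupling L (coup L γ) ε) (hΦ : ∀ n, Φ (sg n) = toL2 (f n))
    (heig : ∀ n, Aop L _ (coup L γ) (f n) = ev n • toL2 (f n))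
    (hasym : ∃ C : ℝ, ∀ n : ℤ, n ≠ 0 → ‖ev n - freq L 0 n‖ ≤ C / |(n : ℝ)|)
    (hev : ∀ n, ev (-n) = conj (ev n)) (hf : ∀ n, toL2 (f (-n)) = conjS L (toL2 (f n)))
    (him : ∀ n, conj (ev n) = -ev n) (hsw : ∀ n, swapS L (conjS L (toL2 (f n))) = -toL2 (f n)) :
    Nonempty (OpenLoopFamily L γ) := by
  have hnz : ∀ n, toL2 (f n) ≠ 0 := fun n => hΦ n ▸ riesz_ne_zero Φ n
  have hinj := eigen_injective hL H hΦ heig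
  have hreal : (rep (f 0) 0 0).im = 0 := by
    have := rep_conjS hL (hf 0) 0 (x := 0) ⟨le_rfl, hL.le⟩
    rw [neg_zero] at this
    exact Complex.conj_eq_iff_im.1 this.symm
  have hne : (rep (f 0) 0 0).re ≠ 0 := fun h0 => by
    have h1 : rep (f 0) 0 0 = 0 := Complex.ext h0 hreal
    have h2 := rep_bc_zero (f 0)
    rw [h1] at h2
    exact hnz 0 (eigen_eq_zero hL H (heig 0) (by simpa using h2))
  -- The sign is prescribed for `n = 0` only. Real factors that agree at `n` and `-n` preserve both
  -- symmetries.
  set s : ℤ → ℝ := fun n => if n = 0 then SignType.sign (rep (f 0) 0 0).re else 1 with hs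
  have hs1 : ∀ n, |s n| = 1 := fun n => by
    simp only [hs]
    split_ifs
    · rcases lt_or_gt_of_ne hne with h | h
      · rw [sign_neg h]; simp
      · rw [sign_pos h]; simp
    · simp
  set c : ℤ → ℝ := fun n => s n * ‖toL2 (f n)‖⁻¹ with hc
  have hn0 : ∀ n, ‖toL2 (f n)‖ ≠ 0 := fun n => norm_ne_zero_iff.2 (hnz n)
  have hc0 : ∀ n, (c n : ℂ) ≠ 0 := fun n => by
    have : s n ≠ 0 := fun h0 => by have := hs1 n; rw [h0] at this; simp at this
    exact_mod_cast mul_ne_zero this (inv_ne_zero (hn0 n))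
  have hcn : ∀ n, c (-n) = c n := fun n => by
    simp only [hc, hs, neg_eq_zero, hf, norm_conjS]
  have hto : ∀ n, toL2 ((c n : ℂ) • f n) = (c n : ℂ) • toL2 (f n) := fun n => rfl
  have hconjr : ∀ n, conjS L ((c n : ℂ) • toL2 (f n)) = (c n : ℂ) • conjS L (toL2 (f n)) := fun n => by
    rw [map_smulₛₗ, Complex.conj_ofReal]
  have hconj : ∀ n, toL2 ((c (-n) : ℂ) • f (-n)) = conjS L (toL2 ((c n : ℂ) • f n)) := fun n => by
    rw [hto, hto, hconjr, hcn, hf]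
  have hsw' : ∀ n, toL2 ((c (-n) : ℂ) • f (-n)) = -swapS L (toL2 ((c n : ℂ) • f n)) := fun n => by
    rw [hconj, ← swapS_swapS (conjS L _), hto, hconjr, map_smul, hsw, smul_neg, map_neg]
  -- With equal boundary constants Green's formula gives orthogonality for the bilinear form, which
  -- by the swap symmetry is minus the scalar product against `f n`.
  have horth : ∀ n m, n ≠ m → inner ℂ (toL2 (f n)) (toL2 (f m)) = 0 := fun n m hnm => by
    have h1 := green H hL.le (f m) (f n)
    rw [heig, heig, bil_smul_left, bil_smul_right, sub_self, zero_mul, ← sub_mul, mul_eq_zero,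
      or_iff_right (sub_ne_zero.2 (hinj.ne hnm.symm)), bil] at h1
    have h2 : conjS L (swapS L (toL2 (f n))) = -toL2 (f n) := by
      rw [← hsw]
      refine state_ext ?_
      filter_upwards [conjS_ae (toL2 (f n)), swapS_ae (conjS L (toL2 (f n))), swapS_ae (toL2 (f n)),
        conjS_ae (swapS L (toL2 (f n)))] with x h1 h2 h3 h4
      rw [h4, h4, h3.1, h3.2, h2.1, h2.2, h1, h1]; exact ⟨rfl, rfl⟩
    rw [h2, inner_neg_left, neg_eq_zero] at h1
    exact h1
  refine ⟨{ f := fun n => (c n : ℂ) • f n, ev := ev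
            eigen := fun n => (eigen_iff hL.le H _ _).2 ?_
            orthonormal := ⟨fun n => ?_, fun n m hnm => ?_⟩
            complete := ?_
            ev_asymp := ?_
            ev_conj := hev
            ev_neg := fun n => by rw [hev, him]
            f_conj := fun n => by rw [hconj]; exact conjS_ae _
            f_swap := fun n => ?_
            f_zero_pos := ?_ }⟩
  · rw [map_smul, heig, hto, smul_comm]
  · change ‖toL2 ((c n : ℂ) • f n)‖ = 1
    rw [hto, norm_smul, Complex.norm_real, hc, norm_mul, Real.norm_eq_abs, hs1, one_mul, norm_inv,
      norm_norm, inv_mul_cancel₀ (hn0 n)]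
  · change inner ℂ (toL2 ((c n : ℂ) • f n)) (toL2 ((c m : ℂ) • f m)) = 0
    rw [hto, hto, inner_smul_left, inner_smul_right, horth n m hnm, mul_zero, mul_zero]
  · rw [eq_top_iff]
    intro u _
    have hsum := (seq_hasSum (Φ.symm u)).mapL (Φ : Seq →L[ℂ] State L)
    rw [ContinuousLinearEquiv.coe_coe, Φ.apply_symm_apply] at hsum
    refine (Submodule.isClosed_topologicalClosure _).mem_of_tendsto hsum
      (Eventually.of_forall fun t => Submodule.le_topologicalClosure _
        (Submodule.sum_mem _ fun n _ => ?_))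
    have e : Φ (Φ.symm u n • sg n) = (Φ.symm u n * (c n : ℂ)⁻¹) • toL2 ((c n : ℂ) • f n) := by
      rw [map_smul, hΦ, hto, smul_smul, mul_assoc, inv_mul_cancel₀ (hc0 n), mul_one]
    change Φ (Φ.symm u n • sg n) ∈ _
    rw [e]
    exact Submodule.smul_mem _ _ (Submodule.subset_span ⟨n, rfl⟩)
  · simpa [freq] using hasym
  · rw [hsw']
    filter_upwards [Lp.coeFn_neg (swapS L (toL2 ((c n : ℂ) • f n))),
      swapS_ae (toL2 ((c n : ℂ) • f n))] with x h1 h2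
    rw [h1, Pi.neg_apply, PiLp.neg_apply, PiLp.neg_apply, h2.1, h2.2]
    exact ⟨rfl, rfl⟩
  · have h1 : valZero ((c 0 : ℂ) • f 0) 0 = c 0 * rep (f 0) 0 0 := by
      have h := (valZeroL hL 1).map_smul (c 0 : ℂ) (f 0)
      rw [valZeroL_apply, valZeroL_apply] at h
      rw [h, rep_zero]; rfl
    rw [h1, Complex.re_ofReal_mul, hc, hs]
    simp only [if_true]
    have h2 : 0 < ‖toL2 (f 0)‖⁻¹ := inv_pos.2 ((norm_nonneg _).lt_of_ne' (hn0 0))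
    have h3 : 0 < SignType.sign (rep (f 0) 0 0).re * (rep (f 0) 0 0).re := by
      rw [sign_mul_self]; exact abs_pos.2 hne
    nlinarith

/-- Both families exist for small parameters. -/
theorem exists_families (hL : 0 < L) (hμ : 0 ≤ μ) : ∃ γ₀ > 0, ∀ γ, 0 < γ → γ < γ₀ →
    Nonempty (OpenLoopFamily L γ) ∧ Nonempty (TargetFamily L γ μ) := by
  obtain ⟨ε₁, h1, F⟩ := exists_eigenbasis hL le_rfl
  obtain ⟨ε₂, h2, F'⟩ := exists_eigenbasis hL hμ
  refine ⟨min (min ε₁ ε₂) (1 / (4000 * L)), by positivity, fun γ hγ hlt => ?_⟩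
  rw [lt_min_iff, lt_min_iff, lt_div_iff₀ (by positivity)] at hlt
  have K := isSmallCoupling hL hγ (by linarith [hlt.2])
  constructor
  · obtain ⟨f, ev, Φ, a1, a2, a3, a4, a5, a6⟩ := F K hlt.1.1
    -- For `μ = 0` the target domain is `D(𝒜)`, but the constant has to be rewritten inside the type
    -- of `f`.
    have e : Real.exp (-2 * 0 * L) = 1 := by simp
    revert f
    simp only [DomT]
    rw [e]
    intro f a1 a2 a5 a6
    exact nonempty_openLoopFamily hL K.toIsCoupling a1 a2 a3 a4 a5 (fun n => (a6 trivial n).1)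
      (fun n => (a6 trivial n).2)
  · obtain ⟨f, ev, Φ, a1, a2, a3, a4, a5, -⟩ := F' K hlt.1.2
    exact nonempty_targetFamily hL K.toIsCoupling a1 a2 a3 a4 a5

end existence


/-! ### The open-loop family -/

section openLoop
variable {L γ : ℝ}

/-- `𝓘_ν` as an element of `L²`, for continuous `exp (3 H)`. -/
lemma exists_profile {h' : ℝ → ℝ} (K : IsSmallCoupling L (coup L γ) h' (coupPrim L γ) γ)
    (v : State L) (ν : ℝ) : ∃ I : State L,
      (I =ᵐ[mes L] fun x => profile L γ x + (ν : ℂ) • v x) ∧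
      (∀ u : State L, bil I u = (∫ x, Real.exp (3 * coupPrim L γ x) * (u x 0 + u x 1) ∂(mes L))
        + ν * bil v u) ∧ (conjS L v = v → conjS L I = I) := by
  have hc : ContinuousOn (fun x => (Real.exp (3 * coupPrim L γ x) : ℂ)) (Icc 0 L) :=
    Complex.continuous_ofReal.comp_continuousOn
      (Real.continuous_exp.comp_continuousOn (continuousOn_const.mul K.contPrim))
  have hp : ∀ x i, profile L γ x i = (Real.exp (3 * coupPrim L γ x) : ℂ) := by
    intro x i
    fin_cases i <;> simp [profile, integral_delta]
  have hcv : ContinuousOn (profile L γ) (Icc 0 L) := by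
    refine (PiLp.continuous_toLp 2 _).comp_continuousOn (continuousOn_pi.2 fun i => ?_)
    refine hc.congr fun x _ => ?_
    have := hp x i
    simpa [profile] using this
  have hm : MemLp (profile L γ) 2 (mes L) := by
    obtain ⟨C, hC⟩ := isCompact_Icc.exists_bound_of_continuousOn hcv
    exact MemLp.of_bound ((hcv.mono Ioo_subset_Icc_self).aestronglyMeasurable measurableSet_Ioo) C
      (ae_mem.mono fun x hx => hC x ⟨hx.1.le, hx.2.le⟩)
  have hI : (hm.toLp + (ν : ℂ) • v : State L) =ᵐ[mes L]
      fun x => profile L γ x + (ν : ℂ) • v x := by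
    filter_upwards [Lp.coeFn_add hm.toLp ((ν : ℂ) • v), hm.coeFn_toLp, Lp.coeFn_smul (ν : ℂ) v]
      with x h1 h2 h3
    rw [h1, Pi.add_apply, h2, h3, Pi.smul_apply]
  refine ⟨hm.toLp + (ν : ℂ) • v, hI, fun u => ?_, fun hv => ?_⟩
  · rw [bil_add_left, bil_smul_left, bil_eq]
    congr 1
    refine integral_congr_ae ?_
    filter_upwards [hm.coeFn_toLp] with x hx
    rw [hx, hp, hp]; ring
  · rw [map_add, map_smulₛₗ, Complex.conj_ofReal, hv]
    congr 1
    refine state_ext ?_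
    filter_upwards [conjS_ae hm.toLp, hm.coeFn_toLp] with x h1 h2
    rw [h1, h1, h2, hp, hp, Complex.conj_ofReal]
    exact ⟨rfl, rfl⟩

variable (E : OpenLoopFamily L γ)

namespace OpenLoopFamily

/-- The Hilbert basis of open-loop eigenfunctions. -/
def basis : HilbertBasis ℤ ℂ (State L) := HilbertBasis.mk E.orthonormal E.complete.ge

/-- The coordinates in the open-loop basis. -/
def iso : Seq ≃L[ℂ] State L := E.basis.repr.symm.toContinuousLinearEquiv

lemma iso_sg (n : ℤ) : E.iso (sg n) = toL2 (E.f n) := by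
  have : E.iso (sg n) = E.basis.repr.symm (lp.single 2 n (1 : ℂ)) := rfl
  rw [this, HilbertBasis.repr_symm_single, basis, HilbertBasis.coe_mk]

lemma iso_symm (u : State L) (n : ℤ) : E.iso.symm u n = inner ℂ (toL2 (E.f n)) u := by
  have : E.iso.symm u n = E.basis.repr u n := rfl
  rw [this, HilbertBasis.repr_apply_apply, basis, HilbertBasis.coe_mk]

lemma iso_symm_pairing (u : State L) (n : ℤ) : E.iso.symm u n = pairing L u (toL2 (E.f n)) := by
  rw [iso_symm, pairing_eq_inner]

lemma conj_f (n : ℤ) : toL2 (E.f (-n)) = conjS L (toL2 (E.f n)) := state_ext <| by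
  filter_upwards [E.f_conj n, conjS_ae (toL2 (E.f n))] with x h1 h2
  rw [h1, h1, h2, h2]; exact ⟨rfl, rfl⟩

lemma swap_f (n : ℤ) : swapS L (toL2 (E.f n)) = -toL2 (E.f (-n)) := state_ext <| by
  filter_upwards [E.f_swap n, swapS_ae (toL2 (E.f n)), Lp.coeFn_neg (toL2 (E.f (-n)))] with x h1 h2 h3
  rw [h3, Pi.neg_apply, PiLp.neg_apply, PiLp.neg_apply, h1.1, h1.2, h2.1, h2.2, neg_neg, neg_neg]
  exact ⟨rfl, rfl⟩

/-- Swapping and conjugating `f n` gives `-f n`, so Green's formula for `bil` computes coordinates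
in the orthonormal basis. -/
lemma bil_f (u : State L) (n : ℤ) : bil u (toL2 (E.f n)) = -E.iso.symm u n := by
  rw [bil, swap_f, map_neg, ← conj_f, neg_neg, inner_neg_left, iso_symm]

lemma ev_im (n : ℤ) : conj (E.ev n) = -E.ev n := by rw [← E.ev_conj, E.ev_neg]

lemma ev_re (n : ℤ) : (E.ev n).re = 0 := by
  have := congrArg Complex.re (E.ev_im n)
  rw [Complex.conj_re, Complex.neg_re] at this
  linarith

lemma ev_eq (n : ℤ) : E.ev n = Complex.I * (E.ev n).im :=
  Complex.ext (by simp [E.ev_re]) (by simp)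

lemma ev_zero : E.ev 0 = 0 := by
  have := E.ev_neg 0
  rw [neg_zero] at this
  exact self_eq_neg.1 this

/-- The value at `0` of the first component. -/
def t (n : ℤ) : ℂ := valZero (E.f n) 0

/-- The weights of the basis of `D(𝒜)`. -/
def w (n : ℤ) : ℂ := if n = 0 then 1 else E.ev n

lemma iso_symm_conjS (u : State L) : E.iso.symm (conjS L u) = reflC (E.iso.symm u) := by
  ext n
  rw [reflC_apply, iso_symm, iso_symm, ← inner_conjS, ← conj_f, neg_neg]

lemma rep_one_zero (n : ℤ) : rep (E.f n) 1 0 = -E.t n := by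
  have := rep_bc_zero (E.f n)
  rw [rep_zero] at this
  rw [t, this]; simp

lemma rep_zero_zero (n : ℤ) : rep (E.f n) 0 0 = E.t n := rep_zero _ _

variable (hL : 0 < L)
include hL

lemma rep_f_one (n : ℤ) : EqOn (rep (E.f n) 1) (fun x => -conj (rep (E.f n) 0 x)) (Icc 0 L) :=
  rep_swapS hL (by rw [← conj_f, swap_f, neg_neg])

lemma t_conj (n : ℤ) : conj (E.t n) = E.t n := by
  have := E.rep_f_one hL n ⟨le_rfl, hL.le⟩
  simp only [E.rep_one_zero, rep_zero_zero, neg_inj] at this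
  exact this.symm

lemma t_real (n : ℤ) : E.t n = ((E.t n).re : ℂ) := (Complex.conj_eq_iff_re.1 (E.t_conj hL n)).symm

lemma t_neg (n : ℤ) : E.t (-n) = E.t n := by
  have := rep_conjS hL (E.conj_f n) 0 (x := 0) ⟨le_rfl, hL.le⟩
  simp only [rep_zero_zero, E.t_conj hL] at this
  exact this

variable {h' : ℝ → ℝ} (K : IsSmallCoupling L (coup L γ) h' (coupPrim L γ) γ)
include K

lemma eigen' (n : ℤ) : Aop L 1 (coup L γ) (E.f n) = E.ev n • toL2 (E.f n) :=
  (eigen_iff hL.le K.toIsCoupling _ _).1 (E.eigen n)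

/-- Green's formula against an open-loop eigenfunction. -/
lemma coef_Aop {κ : ℝ} (β : Dom L κ) (n : ℤ) : E.iso.symm (Aop L κ (coup L γ) β) n
    = E.ev n * E.iso.symm (toL2 β) n + ((κ : ℂ) - 1) * (rep β 1 0 * E.t n) := by
  have := green K.toIsCoupling hL.le β (E.f n)
  rw [E.eigen' hL K, bil_smul_right, bil_f, bil_f, E.rep_one_zero, Complex.ofReal_one] at this
  linear_combination -this

lemma coef_Aop_one (α : DomA L) (n : ℤ) : E.iso.symm (Aop L 1 (coup L γ) α) n
    = E.ev n * E.iso.symm (toL2 α) n := by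
  rw [E.coef_Aop hL K]; simp

/-- Imaginary eigenvalues cause no exponential growth: the comparison of `‖f n‖ = 1` with the value
at `0` is uniform in `n`. -/
lemma t_bounds : ∃ c C : ℝ, 0 < c ∧ ∀ n, c ≤ ‖E.t n‖ ∧ ‖E.t n‖ ≤ C := by
  set X := Real.exp ((2 * 0 + 2 * γ) * L) with hX
  have hX0 : 0 < X := Real.exp_pos _
  refine ⟨√(X * L * (1 + 1 ^ 2))⁻¹, √(X / (L * (1 + 1 ^ 2))), by positivity, fun n => ?_⟩
  have hb := eigen_norm_bounds hL K.toIsCoupling (E.eigen' hL K n) (ρ := 0)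
    (by rw [E.ev_re, abs_zero])
  rw [E.orthonormal.1 n, E.rep_one_zero, norm_neg, ← hX] at hb
  constructor
  · rw [Real.sqrt_le_left (norm_nonneg _), inv_le_iff_one_le_mul₀ (by positivity)]
    linarith [hb.1]
  · refine Real.le_sqrt_of_sq_le ?_
    rw [le_div_iff₀ (by positivity)]
    linarith [hb.2]

lemma t_ne_zero (n : ℤ) : E.t n ≠ 0 := by
  obtain ⟨c, C, hc, h⟩ := E.t_bounds hL K
  exact norm_pos_iff.1 (hc.trans_le (h n).1)

lemma ev_injective : Function.Injective E.ev :=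
  eigen_injective hL K.toIsCoupling E.iso_sg (E.eigen' hL K)

lemma ev_ne_zero {n : ℤ} (hn : n ≠ 0) : E.ev n ≠ 0 := fun h0 =>
  hn (E.ev_injective hL K (h0.trans E.ev_zero.symm))

/-- Since `f₂ = -conj f₁`, the system reduces to `f₁' = iω f₁ + h conj f₁`, and the boundary
conditions say that `f₁` is real at both ends. -/
lemma oscSol (n : ℤ) : OscSol L (coup L γ) (E.ev n).im (fun x => (rep (E.f n) 0 x).re)
    (fun x => (rep (E.f n) 0 x).im) := by
  have S := eigSol_of_eigen hL.le K.toIsCoupling (E.eigen' hL K n)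
  have hd : ∀ x ∈ Ioo 0 L, HasDerivAt (rep (E.f n) 0)
      (Complex.I * (E.ev n).im * rep (E.f n) 0 x + coup L γ x * conj (rep (E.f n) 0 x)) x :=
    fun x hx => (S.df x hx).congr_deriv (by
      have h1 : rep (E.f n) 1 x = -conj (rep (E.f n) 0 x) :=
        E.rep_f_one hL n ⟨hx.1.le, hx.2.le⟩
      rw [h1, ← E.ev_eq]; ring)
  refine ⟨Complex.continuous_re.comp_continuousOn S.cf, Complex.continuous_im.comp_continuousOn S.cf,
    fun x hx => ?_, fun x hx => ?_, ?_, ?_⟩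
  · refine (Complex.reCLM.hasFDerivAt.comp_hasDerivAt x (hd x hx)).congr_deriv ?_
    simp
  · refine (Complex.imCLM.hasFDerivAt.comp_hasDerivAt x (hd x hx)).congr_deriv ?_
    simp; ring
  · rw [rep_zero_zero, E.t_real hL, Complex.ofReal_im]
  · have h1 := rep_bc_end (E.f n) hL.le
    rw [E.rep_f_one hL n ⟨hL.le, le_rfl⟩, neg_neg] at h1
    exact Complex.conj_eq_iff_im.1 h1.symm

lemma ev_lower {n : ℤ} (hn : n ≠ 0) : 2 / (5 * L) ≤ ‖E.ev n‖ := by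
  have h1 := (E.oscSol hL K n).freq_lower hL K (fun h0 => E.ev_ne_zero hL K hn (by
    rw [E.ev_eq, h0]; simp)) (by
    rw [rep_zero_zero]; intro h0
    refine E.t_ne_zero hL K n ?_
    rw [E.t_real hL, h0, Complex.ofReal_zero])
  have h2 : ‖E.ev n‖ = |(E.ev n).im| := by
    rw [E.ev_eq, norm_mul, Complex.norm_I, one_mul, Complex.norm_real]; simp
  rw [h2, div_le_iff₀ (by positivity)]
  nlinarith

/-- The basis of `D(𝒜)` made of eigenfunctions. -/
lemma exists_domBasis : (∃ c > 0, ∀ n, c ≤ ‖E.w n‖) ∧ ∃ Ψ : Seq ≃L[ℂ] DomA L,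
    (∀ n, Ψ (sg n) = (E.w n)⁻¹ • E.f n) ∧
      ∀ α n, E.iso.symm (toL2 α) n = (E.w n)⁻¹ * Ψ.symm α n := by
  have h1 : ∀ n, min 1 (2 / (5 * L)) ≤ ‖E.w n‖ := fun n => by
    rw [w]; split_ifs with hn
    · simp
    · exact (min_le_right _ _).trans (E.ev_lower hL K hn)
  have hpos : 0 < min 1 (2 / (5 * L)) := by positivity
  refine ⟨⟨_, hpos, h1⟩, exists_dom_basis hL E.iso_sg (E.eigen' hL K) (E.coef_Aop_one hL K) (C := 1)
    hpos h1 (fun n => ?_) (fun n => ?_)⟩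
  · rw [w, one_mul]; split_ifs with hn
    · rw [hn, E.ev_zero]; simp
    · exact le_rfl
  · rw [w, one_mul]; split_ifs with hn
    · simp
    · linarith

/-- The moments of the virtual profile. -/
lemma moments {ν : ℝ} (hν : 0 < ν) {I : State L} (hI : ∀ u : State L, bil I u
      = (∫ x, Real.exp (3 * coupPrim L γ x) * (u x 0 + u x 1) ∂(mes L))
        + ν * bil (toL2 (E.f 0)) u) :
    ∃ c C : ℝ, 0 < c ∧ ∀ n, c ≤ ‖E.w n * E.iso.symm I n‖ ∧ ‖E.w n * E.iso.symm I n‖ ≤ C := by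
  obtain ⟨c, C, hc, ht⟩ := E.t_bounds hL K
  have hε := K.pos
  have hae : ∀ n, ∫ x, Real.exp (3 * coupPrim L γ x) * (toL2 (E.f n) x 0 + toL2 (E.f n) x 1) ∂(mes L)
      = ∫ x, Real.exp (3 * coupPrim L γ x) * (rep (E.f n) 0 x + rep (E.f n) 1 x) ∂(mes L) :=
    fun n => integral_congr_ae (by
      filter_upwards [rep_ae (E.f n)] with x hx
      rw [hx, hx])
  -- The components of `f 0` are opposite, so the profile, whose components are equal, has no moment
  -- against it: only `ν f₀` contributes.
  have h0 : E.iso.symm I 0 = ν := by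
    have h1 : ∫ x, Real.exp (3 * coupPrim L γ x) * (toL2 (E.f 0) x 0 + toL2 (E.f 0) x 1) ∂(mes L)
        = 0 := by
      rw [← integral_zero ℝ ℂ (μ := mes L)]
      refine integral_congr_ae ?_
      have := E.f_swap 0
      rw [neg_zero] at this
      filter_upwards [this] with x hx
      rw [hx.1]; ring
    have h2 := hI (toL2 (E.f 0))
    rw [h1, E.bil_f, E.bil_f, ← E.iso_sg, E.iso.symm_apply_apply, sg_apply, if_pos rfl] at h2
    linear_combination -h2
  have hb : ∀ n, n ≠ 0 → E.iso.symm I n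
      = -∫ x, Real.exp (3 * coupPrim L γ x) * (rep (E.f n) 0 x + rep (E.f n) 1 x) ∂(mes L) := by
    intro n hn
    have h2 := hI (toL2 (E.f n))
    rw [hae, E.bil_f, E.bil_f, ← E.iso_sg, E.iso.symm_apply_apply, sg_apply, if_neg hn] at h2
    linear_combination -h2
  refine ⟨min ν (γ * L / 8 * c), max ν (10 * C), by positivity, fun n => ?_⟩
  by_cases hn : n = 0
  · rw [hn, h0, w, if_pos rfl, one_mul, Complex.norm_real, Real.norm_of_nonneg hν.le]
    exact ⟨min_le_left _ _, le_max_left _ _⟩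
  · have S := eigSol_of_eigen hL.le K.toIsCoupling (E.eigen' hL K n)
    have hu := S.moment_upper hL K (E.ev_re n).ge (rep_bc_end _ hL.le) (rep_bc_zero (E.f n))
      (by simp)
    rw [E.rep_one_zero, norm_neg] at hu
    have hω : (E.ev n).im ≠ 0 := fun h0 => E.ev_ne_zero hL K hn (by rw [E.ev_eq, h0]; simp)
    have hl := (E.oscSol hL K n).moment_lower hL K hω (by
      rw [rep_zero_zero]; intro h0
      refine E.t_ne_zero hL K n ?_
      rw [E.t_real hL, h0, Complex.ofReal_zero])
    -- `f₁ + f₂ = 2i Im f₁`, which reduces the moment to the one in `OscSol.moment_lower`.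
    have e1 : E.ev n * ∫ x, Real.exp (3 * coupPrim L γ x) * (rep (E.f n) 0 x + rep (E.f n) 1 x) ∂(mes L)
        = ((-(2 * (E.ev n).im * ∫ x, Real.exp (3 * coupPrim L γ x) * (rep (E.f n) 0 x).im ∂(mes L)) : ℝ) : ℂ) := by
      have e2 : ∫ x, Real.exp (3 * coupPrim L γ x) * (rep (E.f n) 0 x + rep (E.f n) 1 x) ∂(mes L)
          = 2 * Complex.I * ((∫ x, Real.exp (3 * coupPrim L γ x) * (rep (E.f n) 0 x).im ∂(mes L) : ℝ) : ℂ) := by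
        rw [← integral_complex_ofReal, ← integral_const_mul]
        refine integral_congr_ae (ae_mem.mono fun x hx => ?_)
        have h1 : rep (E.f n) 1 x = -conj (rep (E.f n) 0 x) := E.rep_f_one hL n ⟨hx.1.le, hx.2.le⟩
        have h3 := Complex.sub_conj (rep (E.f n) 0 x)
        dsimp only
        rw [h1, ← sub_eq_add_neg, h3]; push_cast; ring
      rw [e2, E.ev_eq]
      push_cast
      simp only [Complex.mul_im, Complex.I_re, Complex.I_im, Complex.ofReal_re, Complex.ofReal_im]
      ring_nf
      rw [Complex.I_sq]
      ring
    have ht' : ‖E.t n‖ = |(rep (E.f n) 0 0).re| := by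
      rw [rep_zero_zero]
      conv_lhs => rw [E.t_real hL]
      rw [Complex.norm_real, Real.norm_eq_abs]
    rw [hb n hn, w, if_neg hn, mul_neg, norm_neg]
    refine ⟨?_, ?_⟩
    · rw [e1, Complex.norm_real, Real.norm_eq_abs, abs_neg]
      refine (min_le_right _ _).trans (le_trans ?_ hl)
      rw [← ht']
      have := (ht n).1
      gcongr
    · refine hu.trans ((mul_le_mul_of_nonneg_left (ht n).2 (by norm_num)).trans (le_max_right _ _))

end OpenLoopFamily

end openLoop


/-! ### The target family -/

lemma bil_conjS {L : ℝ} (u v : State L) : bil (conjS L u) (conjS L v) = conj (bil u v) := by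
  rw [bil_eq, bil_eq, ← integral_conj]
  refine integral_congr_ae ?_
  filter_upwards [conjS_ae u, conjS_ae v] with x h1 h2
  simp [h1, h2]

lemma kappa_lt_one {L μ : ℝ} (hL : 0 < L) (hμ : 0 < μ) : Real.exp (-2 * μ * L) < 1 := by
  rw [Real.exp_lt_one_iff]; nlinarith [mul_pos hμ hL]

namespace TargetFamily

section
variable {L γ μ : ℝ} (G : TargetFamily L γ μ)

/-- The coordinates in the target basis. -/
def iso : Seq ≃L[ℂ] State L := G.riesz.choose

lemma iso_sg (p : ℤ) : G.iso (sg p) = toL2 (G.f p) := G.riesz.choose_spec p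

/-- By biorthogonality both continuous functionals take the same values on the basis. -/
lemma iso_symm_pairing (u : State L) (p : ℤ) : G.iso.symm u p = pairing L u (G.φ p) := by
  have h : (innerSL ℂ (G.φ p)).comp (G.iso : Seq →L[ℂ] State L) = coord p := by
    refine seq_clm_ext fun n => ?_
    have := G.biorth n p
    rw [pairing_eq_inner] at this
    rw [coord_apply, sg_apply, ContinuousLinearMap.comp_apply, ContinuousLinearEquiv.coe_coe, iso_sg,
      innerSL_apply_apply, this]
    simp only [eq_comm]
  have h2 := congrArg (fun A : Seq →L[ℂ] ℂ => A (G.iso.symm u)) h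
  simp only [coord_apply] at h2
  rw [← h2, pairing_eq_inner]
  simp

lemma conj_f (p : ℤ) : toL2 (G.f (-p)) = conjS L (toL2 (G.f p)) := state_ext <| by
  filter_upwards [G.f_conj p, conjS_ae (toL2 (G.f p))] with x h1 h2
  rw [h1, h1, h2, h2]; exact ⟨rfl, rfl⟩

lemma iso_symm_conjS (u : State L) : G.iso.symm (conjS L u) = reflC (G.iso.symm u) := by
  have h := iso_reflC (Φ := G.iso) (fun n => by rw [iso_sg, iso_sg, conj_f]) (G.iso.symm u)
  rw [G.iso.apply_symm_apply] at h
  rw [← h, G.iso.symm_apply_apply]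

lemma norm_f_bounds : ∃ c C : ℝ, 0 < c ∧ ∀ p, c ≤ ‖toL2 (G.f p)‖ ∧ ‖toL2 (G.f p)‖ ≤ C := by
  have h1 : ∀ p, 1 ≤ ‖(G.iso.symm : State L →L[ℂ] Seq)‖ * ‖toL2 (G.f p)‖ := fun p => by
    have := (G.iso.symm : State L →L[ℂ] Seq).le_opNorm (toL2 (G.f p))
    rwa [ContinuousLinearEquiv.coe_coe, ← iso_sg, G.iso.symm_apply_apply, norm_sg, iso_sg] at this
  have h0 : 0 < ‖(G.iso.symm : State L →L[ℂ] Seq)‖ := by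
    by_contra h0
    have := h1 0
    nlinarith [norm_nonneg (toL2 (G.f 0)), norm_nonneg (G.iso.symm : State L →L[ℂ] Seq)]
  refine ⟨‖(G.iso.symm : State L →L[ℂ] Seq)‖⁻¹, ‖(G.iso : Seq →L[ℂ] State L)‖, by positivity,
    fun p => ⟨?_, ?_⟩⟩
  · rw [inv_le_iff_one_le_mul₀ h0, mul_comm]; exact h1 p
  · have := (G.iso : Seq →L[ℂ] State L).le_opNorm (sg p)
    rwa [ContinuousLinearEquiv.coe_coe, iso_sg, norm_sg, mul_one] at this

/-- The value at `0` of the second component. -/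
def u (p : ℤ) : ℂ := valZero (G.f p) 1

lemma rep_one_zero (p : ℤ) : rep (G.f p) 1 0 = G.u p := rep_zero _ _

/-- The squares of the eigenfunctions for the bilinear form. -/
def c (p : ℤ) : ℂ := bil (toL2 (G.f p)) (toL2 (G.f p))

lemma c_neg (p : ℤ) : G.c (-p) = conj (G.c p) := by rw [c, c, conj_f, bil_conjS]

variable (hL : 0 < L)
include hL

lemma u_neg (p : ℤ) : G.u (-p) = conj (G.u p) := by
  have := rep_conjS hL (G.conj_f p) 1 (x := 0) ⟨le_rfl, hL.le⟩
  simpa only [rep_one_zero] using this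

variable {h' : ℝ → ℝ} (K : IsSmallCoupling L (coup L γ) h' (coupPrim L γ) γ)
include K

lemma eigen' (p : ℤ) : Aop L _ (coup L γ) (G.f p) = G.ev p • toL2 (G.f p) :=
  (eigen_iff hL.le K.toIsCoupling _ _).1 (G.eigen p)

lemma u_ne_zero (p : ℤ) : G.u p ≠ 0 := fun h0 => by
  have := eigen_eq_zero hL K.toIsCoupling (G.eigen' hL K p) (by rw [rep_one_zero, h0])
  rw [← iso_sg] at this
  exact riesz_ne_zero _ _ this

lemma ev_injective : Function.Injective G.ev :=
  eigen_injective hL K.toIsCoupling G.iso_sg (G.eigen' hL K)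

/-- Distinct target eigenfunctions are orthogonal for the bilinear form, so pairing with `f p` is a
multiple of the `p`-th coordinate: up to `c p` the biorthogonal family is explicit. -/
lemma bil_f (v : State L) (p : ℤ) : bil v (toL2 (G.f p)) = G.c p * G.iso.symm v p := by
  have h : (bilL (toL2 (G.f p))).comp (G.iso : Seq →L[ℂ] State L) = G.c p • coord p := by
    refine seq_clm_ext fun q => ?_
    have e : ((bilL (toL2 (G.f p))).comp (G.iso : Seq →L[ℂ] State L)) (sg q)
        = bil (toL2 (G.f q)) (toL2 (G.f p)) := by rw [← G.iso_sg q]; rfl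
    rw [e, _root_.smul_apply, coord_apply, sg_apply]
    split_ifs with hq
    · rw [hq, smul_eq_mul, mul_one, c]
    · have h1 := green K.toIsCoupling hL.le (G.f q) (G.f p)
      rw [G.eigen' hL K, G.eigen' hL K, bil_smul_left, bil_smul_right, sub_self, zero_mul, ← sub_mul,
        mul_eq_zero, or_iff_right (sub_ne_zero.2 ((G.ev_injective hL K).ne (Ne.symm hq)))] at h1
      rw [h1, smul_zero]
  have h2 := congrArg (fun A : Seq →L[ℂ] ℂ => A (G.iso.symm v)) h
  simp only [_root_.smul_apply, coord_apply, smul_eq_mul] at h2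
  rw [← h2, ContinuousLinearMap.comp_apply, ContinuousLinearEquiv.coe_coe, G.iso.apply_symm_apply]
  rfl

/-- For the lower bound, test `bil_f` against the conjugate swap of `f p`: the left side is `‖f p‖²`
and the coordinate is at most a constant times `‖f p‖`. -/
lemma c_bounds : ∃ c C : ℝ, 0 < c ∧ ∀ p, c ≤ ‖G.c p‖ ∧ ‖G.c p‖ ≤ C := by
  obtain ⟨a, A, ha, hf⟩ := G.norm_f_bounds
  set N := ‖(G.iso.symm : State L →L[ℂ] Seq)‖ with hN
  have h1 : ∀ p, ‖toL2 (G.f p)‖ ≤ ‖G.c p‖ * N := fun p => by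
    have h2 := G.bil_f hL K (conjS L (swapS L (toL2 (G.f p)))) p
    rw [bil_self_conj] at h2
    have h3 := congrArg norm h2
    rw [norm_pow, Complex.norm_real, norm_norm, norm_mul] at h3
    have h4 : ‖G.iso.symm (conjS L (swapS L (toL2 (G.f p)))) p‖ ≤ N * ‖toL2 (G.f p)‖ := by
      refine (lp.norm_apply_le_norm (by simp) _ _).trans ?_
      have := (G.iso.symm : State L →L[ℂ] Seq).le_opNorm (conjS L (swapS L (toL2 (G.f p))))
      rwa [norm_conjS, norm_swapS] at this
    have h5 := ha.trans_le (hf p).1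
    have h6 := mul_le_mul_of_nonneg_left h4 (norm_nonneg (G.c p))
    nlinarith
  have hN0 : 0 < N := by
    by_contra h0
    have := h1 0
    nlinarith [(hf 0).1, norm_nonneg (G.c 0)]
  refine ⟨a / N, A * A, by positivity, fun p => ⟨?_, ?_⟩⟩
  · rw [div_le_iff₀ hN0]; exact (hf p).1.trans (h1 p)
  · have := ha.le.trans (hf p).1
    exact (norm_bil_le _ _).trans (mul_le_mul (hf p).2 (hf p).2 (norm_nonneg _)
      (this.trans (hf p).2))

/-- Green's formula against a target eigenfunction. -/
lemma coef_Aop {κ : ℝ} (β : Dom L κ) (p : ℤ) :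
    G.c p * (G.iso.symm (Aop L κ (coup L γ) β) p - G.ev p * G.iso.symm (toL2 β) p)
      = ((κ : ℂ) - Real.exp (-2 * μ * L)) * (rep β 1 0 * G.u p) := by
  have := green K.toIsCoupling hL.le β (G.f p)
  rw [G.eigen' hL K, bil_smul_right, G.bil_f hL K, G.bil_f hL K, rep_one_zero] at this
  linear_combination this

lemma c_ne_zero (p : ℤ) : G.c p ≠ 0 := by
  obtain ⟨c, C, hc, h⟩ := G.c_bounds hL K
  exact norm_pos_iff.1 (hc.trans_le (h p).1)

lemma coef_Aop_self (β : DomT L μ) (p : ℤ) : G.iso.symm (Aop L _ (coup L γ) β) p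
    = G.ev p * G.iso.symm (toL2 β) p := by
  have := G.coef_Aop hL K β p
  rw [sub_self, zero_mul, mul_eq_zero, or_iff_right (G.c_ne_zero hL K p), sub_eq_zero] at this
  exact this

lemma end_ne_zero (p : ℤ) : rep (G.f p) 1 L ≠ 0 := fun h0 => by
  have S := eigSol_of_eigen hL.le K.toIsCoupling (G.eigen' hL K p)
  have h1 := S.energy_bwd K.toIsCoupling le_rfl ⟨le_rfl, hL.le⟩ ⟨hL.le, le_rfl⟩ hL.le
  rw [rep_bc_end _ hL.le, h0, neg_zero, norm_zero, zero_pow two_ne_zero, add_zero, mul_zero] at h1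
  have h2 := norm_pos_iff.2 (G.u_ne_zero hL K p)
  rw [rep_one_zero] at h1
  have := sq_nonneg ‖rep (G.f p) 0 0‖
  nlinarith

variable (hμ : 0 < μ)
include hμ

/-- `exp (-2 re(ev) L)` is within `5γL` of `κ`. The second hypothesis keeps it below `exp (-3μL/2)`,
which is the decay rate `3μ/4`; the first keeps it above `κ/2`, which bounds the real parts. -/
lemma re_bounds (h1 : 5 * (γ * L) ≤ Real.exp (-2 * μ * L) / 2)
    (h2 : 5 * (γ * L) ≤ Real.exp (-(3 / 2 * μ * L)) - Real.exp (-2 * μ * L)) :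
    ∃ R : ℝ, ∀ p, 3 * μ / 4 ≤ (G.ev p).re ∧ (G.ev p).re ≤ R := by
  refine ⟨-Real.log (Real.exp (-2 * μ * L) / 2) / (2 * L), fun p => ?_⟩
  have S := eigSol_of_eigen hL.le K.toIsCoupling (G.eigen' hL K p)
  have hκ := Real.exp_pos (-2 * μ * L)
  have hre := S.re_nonneg hL.le hκ.le (kappa_lt_one hL hμ) (rep_bc_zero _) (rep_bc_end _ hL.le)
    (by rw [rep_one_zero]; exact G.u_ne_zero hL K p)
  obtain ⟨e1, e2⟩ := S.exp_re_le hL K hre (rep_bc_end _ hL.le) (rep_bc_zero _) hκ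
    (kappa_lt_one hL hμ) (G.end_ne_zero hL K p)
  rw [← Real.exp_nat_mul] at e1 e2
  push_cast at e1 e2
  constructor
  · have : Real.exp (2 * -((G.ev p).re * L)) ≤ Real.exp (-(3 / 2 * μ * L)) := by linarith
    rw [Real.exp_le_exp] at this
    by_contra hcon
    push Not at hcon
    nlinarith
  · have h3 : Real.exp (-2 * μ * L) / 2 ≤ Real.exp (2 * -((G.ev p).re * L)) := by linarith
    rw [← Real.log_le_iff_le_exp (by positivity)] at h3
    rw [le_div_iff₀ (by positivity)]
    linarith

variable {R : ℝ} (hR : ∀ p, 3 * μ / 4 ≤ (G.ev p).re ∧ (G.ev p).re ≤ R)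
include hR

lemma u_bounds : ∃ c C : ℝ, 0 < c ∧ ∀ p, c ≤ ‖G.u p‖ ∧ ‖G.u p‖ ≤ C := by
  obtain ⟨a, A, ha, hf⟩ := G.norm_f_bounds
  set X := Real.exp ((2 * R + 2 * γ) * L) with hX
  set Y := L * (1 + Real.exp (-2 * μ * L) ^ 2) with hY
  have hX0 : 0 < X := Real.exp_pos _
  have hY0 : 0 < Y := by positivity
  have hb := fun p => eigen_norm_bounds hL K.toIsCoupling (G.eigen' hL K p) (ρ := R)
    (by rw [abs_of_nonneg (by linarith [(hR p).1])]; exact (hR p).2)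
  simp only [rep_one_zero, ← hX, mul_assoc] at hb
  refine ⟨√(a ^ 2 / (X * Y)), √(X * A ^ 2 / Y), by positivity, fun p => ⟨?_, ?_⟩⟩
  · rw [Real.sqrt_le_left (norm_nonneg _), div_le_iff₀ (by positivity)]
    have h1 := (hb p).1
    have h2 := pow_le_pow_left₀ ha.le (hf p).1 2
    have h3 : X * (L * ((1 + Real.exp (-2 * (μ * L)) ^ 2) * ‖G.u p‖ ^ 2)) = ‖G.u p‖ ^ 2 * (X * Y) := by
      rw [hY]; ring_nf
    linarith
  · refine Real.le_sqrt_of_sq_le ?_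
    rw [le_div_iff₀ (by positivity)]
    have h1 := (hb p).2
    have h2 := pow_le_pow_left₀ (norm_nonneg _) (hf p).2 2
    have h3 : L * ((1 + Real.exp (-2 * (μ * L)) ^ 2) * ‖G.u p‖ ^ 2) = ‖G.u p‖ ^ 2 * Y := by
      rw [hY]; ring_nf
    nlinarith

omit hL K hμ in
lemma ev_lower (p : ℤ) : 3 * μ / 4 ≤ ‖G.ev p‖ :=
  (hR p).1.trans ((le_abs_self _).trans (Complex.abs_re_le_norm _))

omit hL K in
lemma ev_ne_zero (p : ℤ) : G.ev p ≠ 0 :=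
  norm_pos_iff.1 ((by positivity : 0 < 3 * μ / 4).trans_le (G.ev_lower hR p))

/-- The basis of `D(𝒜̃)` made of eigenfunctions. -/
lemma exists_domBasis : ∃ Ψ : Seq ≃L[ℂ] DomT L μ, (∀ p, Ψ (sg p) = (G.ev p)⁻¹ • G.f p) ∧
    ∀ β p, G.iso.symm (toL2 β) p = (G.ev p)⁻¹ * Ψ.symm β p :=
  exists_dom_basis hL G.iso_sg (G.eigen' hL K) (G.coef_Aop_self hL K) (C := 1)
    (by positivity : 0 < 3 * μ / 4) (G.ev_lower hR) (fun n => by rw [one_mul])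
    (fun n => by linarith)

/-- The moments of the virtual profile. -/
lemma moments (E : OpenLoopFamily L γ)
    (hs : 200 * (γ * L) ≤ √(Real.exp (-2 * μ * L)) * (1 - √(Real.exp (-2 * μ * L))) ^ 2)
    {ν : ℝ} (hν : 0 < ν) {I : State L} (hI : ∀ v : State L, bil I v
      = (∫ x, Real.exp (3 * coupPrim L γ x) * (v x 0 + v x 1) ∂(mes L))
        + ν * bil (toL2 (E.f 0)) v) :
    ∃ c C : ℝ, 0 < c ∧ ∀ p, c ≤ ‖G.ev p * G.iso.symm I p‖ ∧ ‖G.ev p * G.iso.symm I p‖ ≤ C := by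
  obtain ⟨a, A, ha, hu⟩ := G.u_bounds hL K hμ hR
  obtain ⟨b, B, hb, hc⟩ := G.c_bounds hL K
  set κ := Real.exp (-2 * μ * L) with hκdef
  have hκ : 0 < κ := Real.exp_pos _
  have hκ1 : κ < 1 := kappa_lt_one hL hμ
  have hq : √κ < 1 := by rw [Real.sqrt_lt' one_pos]; simpa using hκ1
  have ht := E.t_real hL 0
  have htpos : 0 < (E.t 0).re := E.f_zero_pos
  set τ := (E.t 0).re with hτ
  -- Green's formula for `f 0`, whose eigenvalue is `0`, computes its target coordinates. They add a
  -- nonnegative multiple of the boundary value `u p`, because `τ = f_{0,1}(0) > 0`.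
  have key : ∀ p, G.c p * (G.ev p * G.iso.symm I p) = G.ev p * (∫ x, Real.exp (3 * coupPrim L γ x)
      * (rep (G.f p) 0 x + rep (G.f p) 1 x) ∂(mes L)) + ((ν * (1 - κ) * τ : ℝ) : ℂ) * rep (G.f p) 1 0 := by
    intro p
    have h1 := hI (toL2 (G.f p))
    rw [G.bil_f hL K, G.bil_f hL K] at h1
    have h2 := G.coef_Aop hL K (E.f 0) p
    rw [E.eigen' hL K, E.ev_zero, zero_smul, map_zero, E.rep_one_zero, ht] at h2
    have h3 : ∫ x, Real.exp (3 * coupPrim L γ x) * (toL2 (G.f p) x 0 + toL2 (G.f p) x 1) ∂(mes L)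
        = ∫ x, Real.exp (3 * coupPrim L γ x) * (rep (G.f p) 0 x + rep (G.f p) 1 x) ∂(mes L) :=
      integral_congr_ae (by
        filter_upwards [rep_ae (G.f p)] with x hx
        rw [hx, hx])
    rw [h3] at h1
    rw [rep_one_zero]
    simp only [lp.coeFn_zero, Pi.zero_apply, Complex.ofReal_one, ← hκdef] at h2
    simp only [Complex.ofReal_mul, Complex.ofReal_sub, Complex.ofReal_one]
    linear_combination G.ev p * h1 - ν * h2
  have hC : ∀ p, ‖G.c p * (G.ev p * G.iso.symm I p)‖ ≤ (10 + ν * (1 - κ) * τ) * A ∧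
      (1 - √κ) ^ 2 / 2 * a ≤ ‖G.c p * (G.ev p * G.iso.symm I p)‖ := by
    intro p
    have S := eigSol_of_eigen hL.le K.toIsCoupling (G.eigen' hL K p)
    have hre : 0 ≤ (G.ev p).re := by linarith [(hR p).1]
    have hν' : 0 ≤ ν * (1 - κ) * τ := by
      have : 0 < 1 - κ := by linarith
      positivity
    have hup := S.moment_upper hL K hre (rep_bc_end _ hL.le) (rep_bc_zero (G.f p))
      (by rw [abs_of_pos hκ]; exact hκ1.le)
    have hlo := S.moment_lower hL K hre (rep_bc_end _ hL.le) (rep_bc_zero (G.f p)) hκ hκ1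
      (G.end_ne_zero hL K p) hs hν'
    rw [key]
    rw [rep_one_zero] at hup hlo ⊢
    constructor
    · refine (norm_add_le _ _).trans ?_
      rw [norm_mul ((_ : ℝ) : ℂ), Complex.norm_real, Real.norm_of_nonneg hν', add_mul]
      have := (hu p).2
      exact add_le_add (hup.trans (by gcongr)) (by gcongr)
    · refine le_trans ?_ hlo
      have := (hu p).1
      gcongr
  refine ⟨(1 - √κ) ^ 2 / 2 * a / B, (10 + ν * (1 - κ) * τ) * A / b, ?_, fun p => ⟨?_, ?_⟩⟩
  · have h1 : 0 < 1 - √κ := by linarith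
    have h2 : 0 < B := hb.trans_le ((hc 0).1.trans (hc 0).2)
    positivity
  · have h2 : 0 < B := hb.trans_le ((hc 0).1.trans (hc 0).2)
    rw [div_le_iff₀ h2, mul_comm ‖_‖]
    refine (hC p).2.trans ?_
    rw [norm_mul (G.c p)]
    exact mul_le_mul_of_nonneg_right (hc p).2 (norm_nonneg _)
  · rw [le_div_iff₀ hb, mul_comm]
    refine le_trans ?_ (hC p).1
    rw [norm_mul (G.c p)]
    exact mul_le_mul_of_nonneg_right (hc p).1 (norm_nonneg _)

end

end TargetFamily


/-! ### Diagonal semigroups -/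

lemma norm_exp_sub_one_le_of_re_nonpos {z : ℂ} (hz : z.re ≤ 0) : ‖Complex.exp z - 1‖ ≤ ‖z‖ := by
  have h := Convex.norm_image_sub_le_of_norm_deriv_le (𝕜 := ℂ) (f := Complex.exp) (C := 1)
    (s := {z | z.re ≤ 0}) (fun x _ => Complex.differentiable_exp x) (fun x hx => by
      rw [Complex.deriv_exp, Complex.norm_exp]
      exact Real.exp_le_one_iff.2 hx) (convex_halfSpace_re_le 0) (x := 0) (y := z) (by simp) hz
  simpa using h

lemma seq_tendsto_of_dominated {ι : Type*} {l : Filter ι} {F : ι → Seq} {x : Seq} (b : Seq) {C : ℝ}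
    (hb : ∀ᶠ i in l, ∀ n, ‖F i n - x n‖ ≤ C * ‖b n‖) (h : ∀ n, Tendsto (fun i => F i n) l (𝓝 (x n))) :
    Tendsto F l (𝓝 x) := by
  rw [tendsto_iff_norm_sub_tendsto_zero]
  have h1 : Tendsto (fun i => ∑' n, ‖F i n - x n‖ ^ 2) l (𝓝 (∑' _ : ℤ, (0 : ℝ))) := by
    refine tendsto_tsum_of_dominated_convergence ((seq_summable_sq b).mul_left (C ^ 2))
      (fun n => ?_) ?_
    · have := ((h n).sub_const (x n)).norm.pow 2
      simpa using this
    · filter_upwards [hb] with i hi n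
      rw [norm_pow, norm_norm, ← mul_pow]
      exact pow_le_pow_left₀ (norm_nonneg _) (hi n) 2
  have h2 : ∀ i, ‖F i - x‖ = √(∑' n, ‖F i n - x n‖ ^ 2) := fun i => by
    rw [eq_comm, Real.sqrt_eq_iff_eq_sq (tsum_nonneg fun n => by positivity) (norm_nonneg _),
      seq_norm_sq]
    rfl
  simp only [h2]
  have := (Real.continuous_sqrt.tendsto _).comp h1
  simpa [Function.comp_def] using this

section diagSemi
variable {ev : ℤ → ℂ} {r : ℝ}

/-- The semigroup `diag (exp (-ev t))`. -/
def diagSemi (ev : ℤ → ℂ) (t : ℝ≥0) : Seq →L[ℂ] Seq :=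
  diag fun n => Complex.exp (-ev n * (t : ℝ))

lemma norm_exp_ev_le (hr : ∀ n, r ≤ (ev n).re) (t : ℝ≥0) (n : ℤ) :
    ‖Complex.exp (-ev n * (t : ℝ))‖ ≤ Real.exp (-r * t) := by
  rw [Complex.norm_exp, Complex.re_mul_ofReal, Complex.neg_re, Real.exp_le_exp]
  have := hr n
  gcongr

lemma diagSemi_apply (hr : ∀ n, r ≤ (ev n).re) (t : ℝ≥0) (x : Seq) (n : ℤ) :
    diagSemi ev t x n = Complex.exp (-ev n * (t : ℝ)) * x n :=
  diag_apply (norm_exp_ev_le hr t) x n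

lemma norm_diagSemi_le (hr : ∀ n, r ≤ (ev n).re) (t : ℝ≥0) (x : Seq) :
    ‖diagSemi ev t x‖ ≤ Real.exp (-r * t) * ‖x‖ :=
  norm_diag_apply_le (norm_exp_ev_le hr t) x

lemma isC0Semigroup_diagSemi (hr : ∀ n, r ≤ (ev n).re) (hr0 : 0 ≤ r) :
    IsC0Semigroup (diagSemi ev) where
  zero := by
    ext x n
    rw [diagSemi_apply hr]; simp
  add s t := by
    ext x n
    rw [diagSemi_apply hr, ContinuousLinearMap.comp_apply, diagSemi_apply hr, diagSemi_apply hr,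
      ← mul_assoc, ← Complex.exp_add]
    congr 2; push_cast; ring
  continuous v := by
    rw [continuous_iff_continuousAt]
    intro t
    refine seq_tendsto_of_dominated v (C := 2) (Eventually.of_forall fun s n => ?_) fun n => ?_
    · rw [diagSemi_apply hr, diagSemi_apply hr, ← sub_mul, norm_mul]
      have h1 : ∀ s : ℝ≥0, ‖Complex.exp (-ev n * (s : ℝ))‖ ≤ 1 := fun s =>
        (norm_exp_ev_le hr s n).trans (Real.exp_le_one_iff.2 (by
          have := s.2
          nlinarith [mul_nonneg hr0 s.2]))
      have := norm_sub_le (Complex.exp (-ev n * (s : ℝ))) (Complex.exp (-ev n * (t : ℝ)))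
      have h2 := h1 s
      have h3 := h1 t
      gcongr
      linarith
    · simp only [diagSemi_apply hr]
      have : Continuous fun s : ℝ≥0 => Complex.exp (-ev n * ((s : ℝ) : ℂ)) * v n := by fun_prop
      exact this.tendsto t

/-- Coordinatewise limits determine the generator. Conversely `|exp (-zt) - 1| ≤ |z| t` for `re z ≥
0` dominates the difference quotients by `|y n|`, so they converge in `ℓ²`. -/
lemma generatorGraph_diagSemi (hr : ∀ n, r ≤ (ev n).re) (hr0 : 0 ≤ r) :
    generatorGraph (diagSemi ev) = {q | ∀ n, q.2 n = -ev n * q.1 n} := by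
  have hlim : ∀ (x : Seq) n, Tendsto (fun t : ℝ≥0 =>
      (((t : ℝ) : ℂ)⁻¹ • (diagSemi ev t x - x) : Seq) n) (𝓝[>] 0) (𝓝 (-ev n * x n)) := by
    intro x n
    have h1 : HasDerivAt (fun t : ℝ => Complex.exp (-ev n * t)) (-ev n) 0 := by
      have := hasDerivAt_exp_shift (L := 0) (-ev n) 0
      simpa using this
    have h2 := h1.tendsto_slope_zero_right
    have h3 : Tendsto (fun t : ℝ≥0 => (t : ℝ)) (𝓝[>] 0) (𝓝[>] 0) := by
      refine tendsto_nhdsWithin_iff.2 ⟨?_, ?_⟩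
      · have : Tendsto (fun t : ℝ≥0 => (t : ℝ)) (𝓝 0) (𝓝 ((0 : ℝ≥0) : ℝ)) :=
          NNReal.continuous_coe.tendsto 0
        exact this.mono_left nhdsWithin_le_nhds
      · filter_upwards [self_mem_nhdsWithin] with t ht
        exact NNReal.coe_pos.2 ht
    refine ((h2.comp h3).mul_const (x n)).congr fun t => ?_
    rw [lp.coeFn_smul, Pi.smul_apply, lp.coeFn_sub, Pi.sub_apply, diagSemi_apply hr]
    simp; ring
  ext ⟨x, y⟩
  constructor
  · intro h n
    have h1 : Tendsto (fun t : ℝ≥0 => coord n (((t : ℝ) : ℂ)⁻¹ • (diagSemi ev t x - x)))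
      (𝓝[>] 0) (𝓝 (coord n y)) := ((coord n).continuous.tendsto y).comp h
    simp only [coord_apply] at h1
    exact tendsto_nhds_unique h1 (hlim x n)
  · intro h
    refine seq_tendsto_of_dominated y (C := 2) ?_ fun n => by
      have := hlim x n
      rwa [← h n] at this
    filter_upwards [self_mem_nhdsWithin] with t ht n
    have ht' : (0 : ℝ) < t := NNReal.coe_pos.2 ht
    have h1 : ‖(((t : ℝ) : ℂ)⁻¹ • (diagSemi ev t x - x) : Seq) n‖ ≤ ‖y n‖ := by
      rw [lp.coeFn_smul, Pi.smul_apply, lp.coeFn_sub, Pi.sub_apply, diagSemi_apply hr, smul_eq_mul,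
        h n, norm_mul, norm_inv, Complex.norm_real, Real.norm_of_nonneg ht'.le, ← sub_one_mul,
        norm_mul]
      have h2 : ‖Complex.exp (-ev n * (t : ℝ)) - 1‖ ≤ ‖-ev n * (t : ℝ)‖ := by
        refine norm_exp_sub_one_le_of_re_nonpos ?_
        rw [Complex.re_mul_ofReal, Complex.neg_re]
        nlinarith [hr n]
      rw [norm_mul, Complex.norm_real, Real.norm_of_nonneg ht'.le] at h2
      rw [inv_mul_le_iff₀ ht', norm_mul]
      calc _ ≤ ‖-ev n‖ * t * ‖x n‖ := by gcongr
        _ = _ := by ring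
    linarith [norm_sub_le ((((t : ℝ) : ℂ)⁻¹ • (diagSemi ev t x - x) : Seq) n) (y n)]

end diagSemi

/-! ### Conjugation of semigroups by an isomorphism -/

section transport
variable {V W : Type*} [NormedAddCommGroup V] [NormedSpace ℂ V] [NormedAddCommGroup W]
  [NormedSpace ℂ W] (T : V ≃L[ℂ] W) {S : ℝ≥0 → W →L[ℂ] W}

lemma conjSemigroup_apply (t : ℝ≥0) (v : V) : conjSemigroup T S t v = T.symm (S t (T v)) := rfl

lemma IsC0Semigroup.transport (h : IsC0Semigroup S) : IsC0Semigroup (conjSemigroup T S) where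
  zero := by ext v; rw [conjSemigroup_apply, h.zero]; simp
  add s t := by
    ext v
    rw [conjSemigroup_apply, h.add, ContinuousLinearMap.comp_apply, ContinuousLinearMap.comp_apply,
      conjSemigroup_apply, conjSemigroup_apply, T.apply_symm_apply]
  continuous v := T.symm.continuous.comp (h.continuous (T v))

lemma generatorGraph_conj :
    generatorGraph (conjSemigroup T S) = {q | (T q.1, T q.2) ∈ generatorGraph S} := by
  ext ⟨v, w⟩
  have e : ∀ t : ℝ≥0, T (((t : ℝ) : ℂ)⁻¹ • (conjSemigroup T S t v - v))
      = ((t : ℝ) : ℂ)⁻¹ • (S t (T v) - T v) := fun t => by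
    rw [map_smul, map_sub, conjSemigroup_apply, T.apply_symm_apply]
  constructor
  · intro h
    exact ((T.continuous.tendsto w).comp h).congr e
  · intro h
    have := (T.symm.continuous.tendsto (T w)).comp h
    rw [T.symm_apply_apply] at this
    refine this.congr fun t => ?_
    rw [Function.comp_apply, ← e, T.symm_apply_apply]

lemma IsExpStable.transport {r : ℝ} (h : IsExpStable S r) : IsExpStable (conjSemigroup T S) r := by
  obtain ⟨C, hC⟩ := h
  set a := ‖(T.symm : W →L[ℂ] V)‖
  set b := ‖(T : V →L[ℂ] W)‖
  refine ⟨a * |C| * b, fun t v => ?_⟩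
  have h1 : ‖T.symm (S t (T v))‖ ≤ a * ‖S t (T v)‖ := (T.symm : W →L[ℂ] V).le_opNorm _
  have h2 : ‖T v‖ ≤ b * ‖v‖ := (T : V →L[ℂ] W).le_opNorm v
  have h3 : ‖S t (T v)‖ ≤ |C| * Real.exp (-r * t) * ‖T v‖ :=
    (hC t (T v)).trans (by gcongr; exact le_abs_self C)
  rw [conjSemigroup_apply]
  calc _ ≤ a * ‖S t (T v)‖ := h1
    _ ≤ a * (|C| * Real.exp (-r * t) * (b * ‖v‖)) := by gcongr; exact h3.trans (by gcongr)
    _ = _ := by ring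

end transport


/-! ### The closed-loop operator in coordinates -/

section trace
variable {L γ : ℝ} (E : OpenLoopFamily L γ) (hL : 0 < L) {h' : ℝ → ℝ}
  (K : IsSmallCoupling L (coup L γ) h' (coupPrim L γ) γ)

lemma OpenLoopFamily.iso_symm_swapS (u : State L) (n : ℤ) :
    E.iso.symm (swapS L u) n = -E.iso.symm u (-n) := by
  rw [E.iso_symm, E.iso_symm, ← inner_neg_left, ← E.swap_f, ← inner_swapS, swapS_swapS]

/-- The antisymmetric part of an element of `Dom L κ` belongs to `D(𝒜)`. -/
lemma exists_antisymm (hL : 0 < L) {κ : ℝ} (β : Dom L κ) : ∃ v : DomA L,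
    toL2 v = (2⁻¹ : ℂ) • (toL2 β - swapS L (toL2 β)) ∧
      rep v 0 0 = (rep β 0 0 - rep β 1 0) / 2 := by
  have hu : ∀ᵐ x ∂(mes L), ∀ i, ((2⁻¹ : ℂ) • (toL2 β - swapS L (toL2 β)) : State L) x i
      = (rep β i x - rep β (1 - i) x) / 2 := by
    filter_upwards [rep_ae β, swapS_ae (toL2 β), Lp.coeFn_sub (toL2 β) (swapS L (toL2 β)),
      Lp.coeFn_smul (2⁻¹ : ℂ) (toL2 β - swapS L (toL2 β))] with x h1 h2 h3 h4 i
    rw [h4, Pi.smul_apply, h3, Pi.sub_apply, PiLp.smul_apply, PiLp.sub_apply]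
    fin_cases i <;> simp [h1, h2] <;> ring
  have hF : ∀ i, HasPrim L (fun x => (rep β i x - rep β (1 - i) x) / 2)
      fun x => ((2⁻¹ : ℂ) • (der β - swapS L (der β)) : State L) x i := by
    have hd : ∀ i, (fun x => (der β x i - der β x (1 - i)) / 2) =ᵐ[mes L]
        fun x => ((2⁻¹ : ℂ) • (der β - swapS L (der β)) : State L) x i := fun i => by
      filter_upwards [swapS_ae (der β), Lp.coeFn_sub (der β) (swapS L (der β)),
        Lp.coeFn_smul (2⁻¹ : ℂ) (der β - swapS L (der β))] with x h2 h3 h4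
      rw [h4, Pi.smul_apply, h3, Pi.sub_apply, PiLp.smul_apply, PiLp.sub_apply]
      fin_cases i <;> simp [h2] <;> ring
    refine fun i => HasPrim.congr_ae ?_ (hd i)
    have h1 := rep_hasPrim β i
    have h2 := rep_hasPrim β (1 - i)
    refine ⟨(h1.1.sub h2.1).div_const 2, fun x hx => ?_⟩
    have i1 : IntervalIntegrable (fun t => der β t i) volume 0 x :=
      ((intervalIntegrable_iff_mes hL.le).2 h1.1).mono_set (by
        rw [uIcc_of_le hx.1, uIcc_of_le hL.le]; exact Icc_subset_Icc_right hx.2)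
    have i2 : IntervalIntegrable (fun t => der β t (1 - i)) volume 0 x :=
      ((intervalIntegrable_iff_mes hL.le).2 h2.1).mono_set (by
        rw [uIcc_of_le hx.1, uIcc_of_le hL.le]; exact Icc_subset_Icc_right hx.2)
    beta_reduce
    rw [h1.2 x hx, h2.2 x hx, intervalIntegral.integral_div, intervalIntegral.integral_sub i1 i2]
    ring
  -- The two components are opposite everywhere, so the boundary conditions of `D(𝒜)` hold whatever
  -- `κ` is.
  obtain ⟨v, h1, -, h3⟩ := exists_dom (κ := 1) hL ((2⁻¹ : ℂ) • (toL2 β - swapS L (toL2 β)))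
    ((2⁻¹ : ℂ) • (der β - swapS L (der β)))
    (fun i x => (rep β i x - rep β (1 - i) x) / 2) hu hF (by simp; ring)
    (by simp [rep_bc_end β hL.le]; ring)
  exact ⟨v, h1, h3 0 0 ⟨le_rfl, hL.le⟩⟩

lemma tendsto_Icc_neg_atTop : Tendsto (fun N : ℕ => Finset.Icc (-(N : ℤ)) N) atTop atTop := by
  refine tendsto_atTop_finset_of_monotone (fun a b hab => Finset.Icc_subset_Icc (by simpa) (by simpa))
    fun n => ⟨n.natAbs, ?_⟩
  rw [Finset.mem_Icc]; omega

include hL K in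
/-- Symmetric partial sums of the expansion of `β` at `0`. -/
lemma OpenLoopFamily.tendsto_trace {κ : ℝ} (β : Dom L κ) :
    Tendsto (fun N : ℕ => ∑ n ∈ Finset.Icc (-(N : ℤ)) N, E.iso.symm (toL2 β) n * E.t n) atTop
      (𝓝 ((rep β 0 0 - rep β 1 0) / 2)) := by
  obtain ⟨v, hv, hv0⟩ := exists_antisymm hL β
  obtain ⟨⟨c, hc, hw⟩, Ψ, hΨ, hΨ'⟩ := E.exists_domBasis hL K
  set x := E.iso.symm (toL2 β) with hx
  -- On coordinates the swap is `n ↦ -n` with a sign, so the antisymmetric part has the symmetrized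
  -- coefficients. It lies in `D(𝒜)`, where the expansion converges and the value at `0` is
  -- continuous.
  have hcoef : ∀ n, (E.w n)⁻¹ * Ψ.symm v n = (x n + x (-n)) / 2 := fun n => by
    rw [← hΨ', hv, map_smul, map_sub, lp.coeFn_smul, Pi.smul_apply, lp.coeFn_sub, Pi.sub_apply,
      E.iso_symm_swapS, smul_eq_mul]
    ring
  have hs : HasSum (fun n => (x n + x (-n)) / 2 * E.t n) (rep v 0 0) := by
    have h1 := ((seq_hasSum (Ψ.symm v)).mapL (Ψ : Seq →L[ℂ] DomA L)).mapL
      ((EuclideanSpace.proj (𝕜 := ℂ) (0 : Fin 2)).comp (valZeroL hL 1))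
    have e : (EuclideanSpace.proj (𝕜 := ℂ) (0 : Fin 2)).comp (valZeroL hL 1)
        ((Ψ : Seq →L[ℂ] DomA L) (Ψ.symm v)) = rep v 0 0 := by
      rw [ContinuousLinearEquiv.coe_coe, Ψ.apply_symm_apply, ContinuousLinearMap.comp_apply,
        valZeroL_apply, rep_zero]
      rfl
    rw [e] at h1
    refine h1.congr_fun fun n => ?_
    rw [ContinuousLinearEquiv.coe_coe, map_smul, hΨ, map_smul, map_smul,
      ContinuousLinearMap.comp_apply, valZeroL_apply, ← hcoef]
    simp only [smul_eq_mul, OpenLoopFamily.t]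
    simp
    ring
  rw [← hv0]
  refine (hs.comp tendsto_Icc_neg_atTop).congr fun N => ?_
  -- As `t` is even, symmetric partial sums do not see the symmetrization; this is where their
  -- symmetry matters.
  have h2 : ∑ n ∈ Finset.Icc (-(N : ℤ)) N, x (-n) * E.t n
      = ∑ n ∈ Finset.Icc (-(N : ℤ)) N, x n * E.t n :=
    Finset.sum_nbij' (fun n => -n) (fun n => -n) (by simp; omega) (by simp; omega) (by simp)
      (by simp) (fun n _ => by rw [E.t_neg hL])
  rw [Function.comp_apply]
  calc _ = 2⁻¹ * (∑ n ∈ Finset.Icc (-(N : ℤ)) N, x n * E.t n)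
        + 2⁻¹ * ∑ n ∈ Finset.Icc (-(N : ℤ)) N, x (-n) * E.t n := by
        rw [Finset.mul_sum, Finset.mul_sum, ← Finset.sum_add_distrib]
        exact Finset.sum_congr rfl fun n _ => by ring
    _ = _ := by rw [h2]; ring

include hL K in
/-- The operator on `Dom L κ` in terms of the coordinates in the open-loop basis: the boundary
condition at `0` acts through the trace functional. -/
lemma OpenLoopFamily.exists_dom_iff {κ θ : ℝ} (hκ : 1 + κ ≠ 0) (hθ : θ * (1 + κ) = 1 - κ)
    {β₀ : Dom L κ} (h0 : rep β₀ 1 0 ≠ 0) (x x' : Seq) :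
    (∃ β : Dom L κ, toL2 β = E.iso x ∧ Aop L κ (coup L γ) β = -E.iso x') ↔
      ∃ ℓ : ℂ, Tendsto (fun N : ℕ => ∑ n ∈ Finset.Icc (-(N : ℤ)) N, x n * E.t n) atTop (𝓝 ℓ) ∧
        ∀ n, x' n = -E.ev n * x n - 2 * θ * ℓ * E.t n := by
  have hκ' : (1 + κ : ℂ) ≠ 0 := by exact_mod_cast hκ
  have hθ' : (θ : ℂ) * (1 + κ) = 1 - κ := by exact_mod_cast hθ
  constructor
  · rintro ⟨β, h1, h2⟩
    have h4 := E.tendsto_trace hL K β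
    rw [h1, E.iso.symm_apply_apply] at h4
    refine ⟨_, h4, fun n => ?_⟩
    have h3 := E.coef_Aop hL K β n
    rw [h2, h1, map_neg, E.iso.symm_apply_apply, E.iso.symm_apply_apply, lp.coeFn_neg,
      Pi.neg_apply] at h3
    rw [rep_bc_zero β]
    linear_combination -h3 - rep β 1 0 * E.t n * hθ'
  · rintro ⟨ℓ, h1, h2⟩
    set r := rep β₀ 1 0
    -- The multiple of `β₀` whose trace `-(1 + κ) β₂(0) / 2` equals `ℓ`.
    set β := (-2 * ℓ / ((1 + κ) * r)) • β₀ with hβ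
    have hr : (1 + κ) * rep β 1 0 = -2 * ℓ := by
      have := rep_linear β₀ β₀ (-2 * ℓ / ((1 + κ) * r)) 0 1 hL
      rw [zero_smul, sub_zero, zero_mul, sub_zero] at this
      rw [hβ, this]; change (1 + κ) * (_ * r) = _; field_simp
    set y := E.iso.symm (toL2 β) with hy
    set y' := -E.iso.symm (Aop L κ (coup L γ) β) with hy'
    have h3 : ∀ n, y' n = -E.ev n * y n - 2 * θ * ℓ * E.t n := fun n => by
      rw [hy', lp.coeFn_neg, Pi.neg_apply, E.coef_Aop hL K]
      linear_combination -rep β 1 0 * E.t n * hθ' + θ * E.t n * hr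
    -- The terms in `ℓ t_n` cancel in the difference, whose coefficients multiplied by `μ_n` are
    -- thus square summable: it lies in `D(𝒜)`.
    obtain ⟨ζ, a1, a2, -⟩ := exists_dom_series hL E.iso_sg (E.eigen' hL K) (x - y) (y' - x')
      fun n => by
        rw [lp.coeFn_sub, lp.coeFn_sub, Pi.sub_apply, Pi.sub_apply, h2, h3]; ring
    -- In `D(𝒜)` the trace is `-ζ₂(0)`, and it is zero here. Both components then vanish at `0`, so
    -- `ζ` satisfies the condition there for every `κ`.
    have hζ : rep ζ 1 0 = 0 := by
      have b1 := E.tendsto_trace hL K ζ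
      have b2 := h1.sub (E.tendsto_trace hL K β)
      have b3 := tendsto_nhds_unique b1 (b2.congr fun N => by
        rw [← Finset.sum_sub_distrib]
        refine Finset.sum_congr rfl fun n _ => ?_
        rw [a1, E.iso.symm_apply_apply, lp.coeFn_sub, Pi.sub_apply, sub_mul])
      rw [rep_bc_zero ζ, rep_bc_zero β, Complex.ofReal_one] at b3
      linear_combination -b3 - hr / 2
    obtain ⟨ζ', c1, c2, -⟩ := exists_dom (κ := κ) hL (toL2 ζ) (der ζ) (rep ζ) (rep_ae ζ) (rep_hasPrim ζ)
      (by rw [rep_bc_zero ζ, hζ, mul_zero, mul_zero]) (rep_bc_end ζ hL.le)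
    have c3 : Aop L κ (coup L γ) ζ' = E.iso (y' - x') := by
      rw [← a2, Aop_apply, Aop_apply, c1, c2]
    refine ⟨ζ' + β, ?_, ?_⟩
    · rw [← toL2L_apply, map_add, toL2L_apply, toL2L_apply, c1, a1, map_sub, hy,
        E.iso.apply_symm_apply, sub_add_cancel]
    · rw [map_add, c3, map_sub, hy', map_neg, E.iso.apply_symm_apply]
      abel

end trace


/-! ### The transformation and the closed-loop semigroup -/

/-- Bounded above and away from `0`. -/
def BddAway (m : ℤ → ℂ) : Prop := ∃ c C : ℝ, 0 < c ∧ ∀ n, c ≤ ‖m n‖ ∧ ‖m n‖ ≤ C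

lemma BddAway.ne_zero {m : ℤ → ℂ} (h : BddAway m) (n : ℤ) : m n ≠ 0 := by
  obtain ⟨c, C, hc, h⟩ := h
  exact norm_pos_iff.1 (hc.trans_le (h n).1)

lemma BddAway.mul {m m' : ℤ → ℂ} (h : BddAway m) (h' : BddAway m') :
    BddAway fun n => m n * m' n := by
  obtain ⟨c, C, hc, h⟩ := h
  obtain ⟨c', C', hc', h'⟩ := h'
  refine ⟨c * c', C * C', by positivity, fun n => ?_⟩
  rw [norm_mul]
  exact ⟨mul_le_mul (h n).1 (h' n).1 hc'.le (norm_nonneg _),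
    mul_le_mul (h n).2 (h' n).2 (norm_nonneg _) ((norm_nonneg _).trans (h n).2)⟩

lemma BddAway.inv {m : ℤ → ℂ} (h : BddAway m) : BddAway fun n => (m n)⁻¹ := by
  obtain ⟨c, C, hc, h⟩ := h
  have hC : 0 < C := hc.trans_le ((h 0).1.trans (h 0).2)
  refine ⟨C⁻¹, c⁻¹, by positivity, fun n => ?_⟩
  rw [norm_inv]
  exact ⟨inv_anti₀ (hc.trans_le (h n).1) (h n).2, inv_anti₀ hc (h n).1⟩

lemma bddAway_const {a : ℂ} (h : a ≠ 0) : BddAway fun _ => a :=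
  ⟨‖a‖, ‖a‖, norm_pos_iff.2 h, fun _ => ⟨le_rfl, le_rfl⟩⟩

lemma BddAway.exists_equiv {m : ℤ → ℂ} (h : BddAway m) :
    ∃ D : Seq ≃L[ℂ] Seq, ∀ x n, D x n = m n * x n := by
  obtain ⟨c, C, hc, h⟩ := h
  exact ⟨diagEquiv m c C hc h, diagEquiv_apply hc h⟩

/-- Conjugation symmetry is preserved by multiplication with a symmetric symbol. -/
lemma reflC_eq_iff_of_mul {m : ℤ → ℂ} (hm : ∀ n, m n ≠ 0) (hc : ∀ n, m (-n) = conj (m n))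
    {x y : Seq} (h : ∀ n, y n = m n * x n) : reflC y = y ↔ reflC x = x := by
  have hc' : ∀ n, conj (m (-n)) = m n := fun n => by rw [hc, Complex.conj_conj]
  constructor <;> intro e <;> ext n
  · have := congrArg (fun z : Seq => z n) e
    simp only [reflC_apply, h, map_mul, hc'] at this
    exact mul_left_cancel₀ (hm n) this
  · have := congrArg (fun z : Seq => z n) e
    simp only [reflC_apply] at this
    simp only [reflC_apply, h, map_mul, hc', this]

/-- Expansion in a basis of eigenvectors of the domain. -/
lemma hasSum_domBasis {L κ : ℝ} {f : ℤ → Dom L κ} {w : ℤ → ℂ} {Φ : Seq ≃L[ℂ] State L}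
    (Ψ : Seq ≃L[ℂ] Dom L κ) (h1 : ∀ n, Ψ (sg n) = (w n)⁻¹ • f n)
    (h2 : ∀ α n, Φ.symm (toL2 α) n = (w n)⁻¹ * Ψ.symm α n) (α : Dom L κ) :
    HasSum (fun n => Φ.symm (toL2 α) n • f n) α := by
  have := (seq_hasSum (Ψ.symm α)).mapL (Ψ : Seq →L[ℂ] Dom L κ)
  rw [ContinuousLinearEquiv.coe_coe, Ψ.apply_symm_apply] at this
  refine this.congr_fun fun n => ?_
  rw [map_smul, h1, h2, smul_smul, mul_comm]

/-- The real parts of the eigenvalues separate the two families. -/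
lemma ev_sub_ne_zero {L γ μ : ℝ} (E : OpenLoopFamily L γ) (G : TargetFamily L γ μ)
    (hμ : 0 < μ) {R : ℝ}
    (hR : ∀ p, 3 * μ / 4 ≤ (G.ev p).re ∧ (G.ev p).re ≤ R)
    (p n : ℤ) : G.ev p - E.ev n ≠ 0 := fun h => by
  have h1 := congrArg Complex.re h
  rw [Complex.sub_re, E.ev_re, Complex.zero_re] at h1
  linarith [(hR p).1]

lemma tanh_mul_one_add_exp (x : ℝ) : Real.tanh x * (1 + Real.exp (-2 * x)) = 1 - Real.exp (-2 * x) := by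
  have h : Real.exp (-2 * x) = Real.exp (-x) * Real.exp (-x) := by rw [← Real.exp_add]; ring_nf
  have h1 : Real.exp x * Real.exp (-x) = 1 := by rw [← Real.exp_add]; simp
  have h2 := Real.exp_pos x
  have h3 := Real.exp_pos (-x)
  rw [Real.tanh_eq_sinh_div_cosh, Real.sinh_eq, Real.cosh_eq, h]
  field_simp
  linear_combination (2 * Real.exp (-x)) * h1

section main
variable {L γ μ : ℝ} (hL : 0 < L) {h' : ℝ → ℝ}
  (K : IsSmallCoupling L (coup L γ) h' (coupPrim L γ) γ) (E : OpenLoopFamily L γ)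
  (G : TargetFamily L γ μ)
include hL K

lemma mem_targetGraph_iff (q : DomT L μ × DomT L μ) : q ∈ targetGraph L γ μ ↔
    ∀ p, G.iso.symm (toL2 q.2) p = -G.ev p * G.iso.symm (toL2 q.1) p := by
  have h1 : q ∈ targetGraph L γ μ ↔ toL2 q.2 = -Aop L _ (coup L γ) q.1 := by
    rw [Lp.ext_iff]
    constructor <;> intro h
    · filter_upwards [h, opA_ae hL.le K.toIsCoupling q.1, Lp.coeFn_neg (Aop L _ (coup L γ) q.1)]
        with x a b c
      rw [a, c, Pi.neg_apply, b]
    · change ∀ᵐ x ∂(mes L), _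
      filter_upwards [h, opA_ae hL.le K.toIsCoupling q.1, Lp.coeFn_neg (Aop L _ (coup L γ) q.1)]
        with x a b c
      rw [a, c, Pi.neg_apply, b]
  rw [h1, ← G.iso.symm.injective.eq_iff, lp.ext_iff, funext_iff]
  refine forall_congr' fun p => ?_
  rw [map_neg, lp.coeFn_neg, Pi.neg_apply, G.coef_Aop_self hL K, ← neg_mul (G.ev p)]

lemma mem_closedLoopGraph_iff {ν : ℝ} {I : State L} (hI : I =ᵐ[mes L] virtualProfile E ν)
    (q : DomA L × DomA L) : q ∈ closedLoopGraph E μ ν ↔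
    ∃ ℓ, HasFeedbackValue E μ ν q.1 ℓ ∧ ∀ n, E.iso.symm (toL2 q.2) n
      = -E.ev n * E.iso.symm (toL2 q.1) n + ℓ * E.iso.symm I n := by
  refine exists_congr fun ℓ => and_congr_right fun _ => ?_
  have h1 : (∀ᵐ x ∂(mes L), toL2 q.2 x = -opA L γ q.1 x + ℓ • virtualProfile E ν x) ↔
      toL2 q.2 = -Aop L _ (coup L γ) q.1 + ℓ • I := by
    have e : ∀ᵐ x ∂(mes L), (-Aop L _ (coup L γ) q.1 + ℓ • I : State L) x
        = -opA L γ q.1 x + ℓ • virtualProfile E ν x := by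
      filter_upwards [opA_ae hL.le K.toIsCoupling q.1, Lp.coeFn_neg (Aop L _ (coup L γ) q.1), hI,
        Lp.coeFn_smul ℓ I, Lp.coeFn_add (-Aop L _ (coup L γ) q.1) (ℓ • I)] with x a b c d e
      rw [e, Pi.add_apply, b, d, Pi.neg_apply, Pi.smul_apply, a, c]
    rw [Lp.ext_iff]
    constructor <;> intro h
    · filter_upwards [h, e] with x a b
      rw [a, b]
    · filter_upwards [h, e] with x a b
      rw [a, b]
  rw [h1, ← E.iso.symm.injective.eq_iff, lp.ext_iff, funext_iff]
  refine forall_congr' fun p => ?_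
  rw [map_add, map_neg, map_smul, lp.coeFn_add, Pi.add_apply, lp.coeFn_neg, Pi.neg_apply,
    lp.coeFn_smul, Pi.smul_apply, E.coef_Aop_one hL K, neg_mul, smul_eq_mul]

/-- The target semigroup. -/
lemma exists_targetSemigroup (hμ : 0 < μ) {R : ℝ}
    (hR : ∀ p, 3 * μ / 4 ≤ (G.ev p).re ∧ (G.ev p).re ≤ R) :
    ∃ St : ℝ≥0 → DomT L μ →L[ℂ] DomT L μ, IsC0Semigroup St ∧
      generatorGraph St = targetGraph L γ μ ∧ IsExpStable St (3 * μ / 4) ∧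
      ∀ t β p, G.iso.symm (toL2 (St t β)) p
        = Complex.exp (-G.ev p * (t : ℝ)) * G.iso.symm (toL2 β) p := by
  obtain ⟨Ψ, h1, h2⟩ := G.exists_domBasis hL K hμ hR
  have hr : ∀ p, 3 * μ / 4 ≤ (G.ev p).re := fun p => (hR p).1
  have hr0 : 0 ≤ 3 * μ / 4 := by positivity
  refine ⟨conjSemigroup Ψ.symm (diagSemi G.ev), (isC0Semigroup_diagSemi hr hr0).transport _, ?_,
    IsExpStable.transport _ ⟨1, fun t x => ?_⟩, fun t β p => ?_⟩
  · rw [generatorGraph_conj, generatorGraph_diagSemi hr hr0]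
    ext q
    rw [mem_targetGraph_iff hL K G]
    refine forall_congr' fun p => ?_
    rw [h2, h2, mul_left_comm, mul_right_inj' (inv_ne_zero (G.ev_ne_zero hμ hR p))]
  · rw [one_mul]; exact norm_diagSemi_le hr t x
  · rw [h2, h2, conjSemigroup_apply, ContinuousLinearEquiv.symm_symm, Ψ.symm_apply_apply,
      diagSemi_apply hr, mul_left_comm]

/-- The multipliers of the transformation, in the target basis. -/
def TargetFamily.mult (G : TargetFamily L γ μ) (I : State L) (p : ℤ) : ℂ :=
  -G.iso.symm I p * G.c p / ((1 - Real.exp (-2 * μ * L)) * G.u p)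

/-- The coordinates of the open-loop eigenfunctions in the target basis. -/
lemma TargetFamily.iso_symm_openLoop (n p : ℤ) :
    G.c p * (G.ev p - E.ev n) * G.iso.symm (toL2 (E.f n)) p
      = (1 - Real.exp (-2 * μ * L)) * (E.t n * G.u p) := by
  have h := G.coef_Aop hL K (E.f n) p
  rw [E.eigen' hL K, map_smul, lp.coeFn_smul, Pi.smul_apply, E.rep_one_zero, smul_eq_mul,
    Complex.ofReal_one] at h
  linear_combination -h

end main

/-! ### The transformation in coordinates and the conjugation of the two graphs -/

section transformation
variable {L γ μ ν : ℝ} (hL : 0 < L) {h' : ℝ → ℝ}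
  (K : IsSmallCoupling L (coup L γ) h' (coupPrim L γ) γ) (E : OpenLoopFamily L γ)
  (G : TargetFamily L γ μ) {I : State L}
  (hI : I =ᵐ[mes L] virtualProfile E ν) (hE : BddAway fun n => E.w n * E.iso.symm I n)
  (hG : BddAway fun p => G.ev p * G.iso.symm I p) (hμ : 0 < μ) {R : ℝ}
  (hR : ∀ p, 3 * μ / 4 ≤ (G.ev p).re ∧ (G.ev p).re ≤ R)

include hI in
lemma feedbackCoeff_eq (n : ℤ) : feedbackCoeff E μ ν n
    = -2 * (Real.tanh (μ * L) : ℂ) * E.t n ^ 2 / E.iso.symm I n := by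
  rw [feedbackCoeff, pairing_congr hI.symm EventuallyEq.rfl, ← E.iso_symm_pairing]
  rfl

include hE in
lemma OpenLoopFamily.moment_ne_zero (n : ℤ) : E.iso.symm I n ≠ 0 := right_ne_zero_of_mul (hE.ne_zero n)

include hL hμ in
lemma tanh_ne_zero : (Real.tanh (μ * L) : ℂ) ≠ 0 := by
  have h1 := kappa_lt_one hL hμ
  have h2 := tanh_mul_one_add_exp (μ * L)
  rw [← mul_assoc] at h2
  rw [Complex.ofReal_ne_zero]
  intro h0
  rw [h0, zero_mul] at h2
  linarith

include hL hμ in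
lemma one_sub_kappa_ne_zero : (1 - Real.exp (-2 * μ * L) : ℂ) ≠ 0 := by
  have h1 := kappa_lt_one hL hμ
  exact_mod_cast (sub_pos.2 h1).ne'

include hL K hE hG hμ hR in
-- `X` maps `D(𝒜)` onto `ℓ²`: coordinates in `D(𝒜)` are `ℓ²` sequences divided by `w`, and `t n / (w
-- n b_n)` is bounded above and below. Likewise `G.mult` maps `L²` onto `D(𝒜̃)`, because `ev p ·
-- G.mult p` is bounded above and below.
lemma exists_transformation : ∃ (X : DomA L ≃L[ℂ] Seq) (T : DomA L ≃L[ℂ] DomT L μ),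
    (∀ α n, X α n = -2 * (Real.tanh (μ * L) : ℂ) * E.t n / E.iso.symm I n * E.iso.symm (toL2 α) n) ∧
    ∀ α p, G.iso.symm (toL2 (T α)) p = G.mult I p * G.iso.symm (E.iso (X α)) p := by
  obtain ⟨⟨c, hc, hw⟩, Ψ, -, hΨ⟩ := E.exists_domBasis hL K
  obtain ⟨Ψ', -, hΨ'⟩ := G.exists_domBasis hL K hμ hR
  obtain ⟨D, hD⟩ := (((bddAway_const (a := -2 * (Real.tanh (μ * L) : ℂ))
    (mul_ne_zero (by norm_num) (tanh_ne_zero hL hμ))).mul (E.t_bounds hL K)).mul hE.inv).exists_equiv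
  obtain ⟨D', hD'⟩ := (((bddAway_const (a := -(1 - Real.exp (-2 * μ * L) : ℂ)⁻¹)
    (neg_ne_zero.2 (inv_ne_zero (one_sub_kappa_ne_zero hL hμ)))).mul hG).mul
    (BddAway.mul (G.c_bounds hL K) (BddAway.inv (G.u_bounds hL K hμ hR)))).exists_equiv
  refine ⟨Ψ.symm.trans D, (((Ψ.symm.trans D).trans E.iso).trans G.iso.symm).trans (D'.trans Ψ'),
    fun α n => ?_, fun α p => ?_⟩
  · have : E.w n ≠ 0 := norm_pos_iff.1 (hc.trans_le (hw n))
    rw [hΨ, ContinuousLinearEquiv.trans_apply, hD, mul_inv]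
    ring
  · simp only [ContinuousLinearEquiv.trans_apply]
    rw [hΨ', Ψ'.symm_apply_apply, hD', TargetFamily.mult]
    have := G.ev_ne_zero hμ hR p
    field_simp

variable {X : DomA L ≃L[ℂ] Seq} {T : DomA L ≃L[ℂ] DomT L μ}
  (hX : ∀ α n, X α n
    = -2 * (Real.tanh (μ * L) : ℂ) * E.t n / E.iso.symm I n * E.iso.symm (toL2 α) n)
  (hT : ∀ α p, G.iso.symm (toL2 (T α)) p = G.mult I p * G.iso.symm (E.iso (X α)) p)

include hL K hI hμ hR hX hT in
-- `X (f n)` is a multiple of `sg n`, so only the target coordinates of `f n` are needed. Green's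
-- formula gives them as `(1 - κ) t_n u_p / (c_p (ev p - ev n))`, and the factors in `G.mult` cancel
-- all but the announced quotient.
lemma isBackstepping : IsBackstepping E G ν T := by
  obtain ⟨-, Ψ, hΨ₁, hΨ₂⟩ := E.exists_domBasis hL K
  obtain ⟨Ψ', hΨ₁', hΨ₂'⟩ := G.exists_domBasis hL K hμ hR
  refine ⟨fun n => (hasSum_domBasis Ψ' hΨ₁' hΨ₂' (T (E.f n))).congr_fun fun p => ?_, fun α => ?_⟩
  · congr 1
    have hXn : X (E.f n) = (-2 * (Real.tanh (μ * L) : ℂ) * E.t n / E.iso.symm I n) • sg n := by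
      ext m
      rw [hX, ← E.iso_sg, E.iso.symm_apply_apply, lp.coeFn_smul, Pi.smul_apply, sg_apply, smul_eq_mul]
      split_ifs with h
      · rw [h]
      · simp
    have h1 := G.iso_symm_openLoop hL K E n p
    have h2 : G.iso.symm (toL2 (E.f n)) p
        = (1 - Real.exp (-2 * μ * L)) * (E.t n * G.u p) / (G.c p * (G.ev p - E.ev n)) := by
      rw [eq_div_iff (mul_ne_zero (G.c_ne_zero hL K p) (ev_sub_ne_zero E G hμ hR p n)), ← h1]; ring
    rw [hT, hXn, map_smul, map_smul, lp.coeFn_smul, Pi.smul_apply, E.iso_sg, h2, smul_eq_mul,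
      feedbackCoeff_eq E hI, pairing_congr hI.symm EventuallyEq.rfl, ← G.iso_symm_pairing,
      TargetFamily.mult]
    have := G.c_ne_zero hL K p
    have := ev_sub_ne_zero E G hμ hR p n
    have h3 := one_sub_kappa_ne_zero hL hμ
    have := G.u_ne_zero hL K p
    generalize (1 - Real.exp (-2 * μ * L) : ℂ) = k at h3 ⊢
    field_simp
  · have := (hasSum_domBasis Ψ hΨ₁ hΨ₂ α).mapL (T : DomA L →L[ℂ] DomT L μ)
    refine this.congr_fun fun n => ?_
    rw [map_smul, E.iso_symm_pairing]
    rfl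

include hL K hG hμ in
lemma TargetFamily.mult_ne_zero (p : ℤ) : G.mult I p ≠ 0 :=
  div_ne_zero (mul_ne_zero (neg_ne_zero.2 (right_ne_zero_of_mul (hG.ne_zero p))) (G.c_ne_zero hL K p))
    (mul_ne_zero (one_sub_kappa_ne_zero hL hμ) (G.u_ne_zero hL K p))

include hL K hI hE hG hμ hX hT in
/-- The closed-loop operator is conjugate to the target operator. -/
lemma closedLoopGraph_eq :
    closedLoopGraph E μ ν = {q | (T q.1, T q.2) ∈ targetGraph L γ μ} := by
  ext q
  rw [mem_ofPred_eq, mem_targetGraph_iff hL K G, mem_closedLoopGraph_iff hL K E hI]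
  have hτ := tanh_ne_zero hL hμ
  have ht := E.t_ne_zero hL K
  have hb := E.moment_ne_zero hE
  -- The multiplier of `X` turns `⟨α, F⟩` into the trace sum and the coefficients of `𝓘_ν` into `-2
  -- tanh(μL) t_n`: the profile no longer appears.
  have e1 : (∃ ℓ, HasFeedbackValue E μ ν q.1 ℓ ∧ ∀ n, E.iso.symm (toL2 q.2) n
      = -E.ev n * E.iso.symm (toL2 q.1) n + ℓ * E.iso.symm I n) ↔
      ∃ ℓ : ℂ, Tendsto (fun N : ℕ => ∑ n ∈ Finset.Icc (-(N : ℤ)) N, X q.1 n * E.t n) atTop (𝓝 ℓ) ∧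
        ∀ n, X q.2 n = -E.ev n * X q.1 n - 2 * (Real.tanh (μ * L) : ℝ) * ℓ * E.t n := by
    refine exists_congr fun ℓ => and_congr ?_ (forall_congr' fun n => ?_)
    · rw [HasFeedbackValue]
      refine tendsto_congr fun N => Finset.sum_congr rfl fun n _ => ?_
      rw [hX, ← E.iso_symm_pairing, feedbackCoeff_eq E hI]
      ring
    · have h1 : -2 * (Real.tanh (μ * L) : ℂ) * E.t n / E.iso.symm I n ≠ 0 :=
        div_ne_zero (mul_ne_zero (mul_ne_zero (by norm_num) hτ) (ht n)) (hb n)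
      rw [hX, hX, ← mul_right_inj' h1]
      have h2 : -2 * (Real.tanh (μ * L) : ℂ) * E.t n / E.iso.symm I n * (ℓ * E.iso.symm I n)
          = -2 * (Real.tanh (μ * L) : ℂ) * E.t n * ℓ := by
        have := hb n
        field_simp
      rw [mul_add, h2]
      constructor <;> intro h <;> linear_combination h
  -- The diagonal factor `G.mult` cancels, which moves the relation from `D(𝒜̃)` to `L²`; there it
  -- says that `E.iso (X q.1)` lies in `D(𝒜̃)`.
  have e2 : (∀ p, G.iso.symm (toL2 (T q.2)) p = -G.ev p * G.iso.symm (toL2 (T q.1)) p) ↔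
      ∃ β : DomT L μ, toL2 β = E.iso (X q.1) ∧ Aop L _ (coup L γ) β = -E.iso (X q.2) := by
    have e3 : (∀ p, G.iso.symm (toL2 (T q.2)) p = -G.ev p * G.iso.symm (toL2 (T q.1)) p) ↔
        ∀ p, G.iso.symm (E.iso (X q.2)) p = -G.ev p * G.iso.symm (E.iso (X q.1)) p := by
      refine forall_congr' fun p => ?_
      rw [hT, hT, mul_left_comm, mul_right_inj' (G.mult_ne_zero hL K hG hμ p)]
    rw [e3]
    constructor
    · intro h
      obtain ⟨β, h1, h2, -⟩ := exists_dom_series hL G.iso_sg (G.eigen' hL K)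
        (G.iso.symm (E.iso (X q.1))) (-G.iso.symm (E.iso (X q.2))) fun p => by
          rw [lp.coeFn_neg, Pi.neg_apply, h]; ring
      refine ⟨β, by rw [h1, G.iso.apply_symm_apply], by rw [h2, map_neg, G.iso.apply_symm_apply]⟩
    · rintro ⟨β, h1, h2⟩ p
      have := G.coef_Aop_self hL K β p
      rw [h1, h2, map_neg, lp.coeFn_neg, Pi.neg_apply] at this
      linear_combination -this
  have hκ := Real.exp_pos (-2 * μ * L)
  rw [e1, e2, E.exists_dom_iff hL K (θ := Real.tanh (μ * L)) (β₀ := G.f 0) (by positivity) (by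
    have := tanh_mul_one_add_exp (μ * L)
    rwa [← mul_assoc] at this) (by rw [G.rep_one_zero]; exact G.u_ne_zero hL K 0)]

lemma OpenLoopFamily.isRealValued_iff (u : State L) :
    IsRealValued u ↔ reflC (E.iso.symm u) = E.iso.symm u := by
  rw [WaterTank.isRealValued_iff, ← E.iso_symm_conjS, E.iso.symm.injective.eq_iff]

lemma TargetFamily.isRealValued_iff (u : State L) :
    IsRealValued u ↔ reflC (G.iso.symm u) = G.iso.symm u := by
  rw [WaterTank.isRealValued_iff, ← G.iso_symm_conjS, G.iso.symm.injective.eq_iff]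

include hL K hE hG hμ hX hT in
/-- The transformation preserves and reflects real-valued functions. -/
lemma isRealValued_transformation_iff (hIc : conjS L I = I) (α : DomA L) :
    IsRealValued (toL2 (T α)) ↔ IsRealValued (toL2 α) := by
  have hb : ∀ n, E.iso.symm I (-n) = conj (E.iso.symm I n) := fun n => by
    have := congrArg (fun z : Seq => z (-n)) (E.iso_symm_conjS I)
    simpa only [hIc, reflC_apply, neg_neg] using this
  have hb' : ∀ n, G.iso.symm I (-n) = conj (G.iso.symm I n) := fun n => by
    have := congrArg (fun z : Seq => z (-n)) (G.iso_symm_conjS I)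
    simpa only [hIc, reflC_apply, neg_neg] using this
  -- Real-valued functions have coordinates conjugate at `n` and `-n`, a property preserved both
  -- ways by multipliers with the same symmetry.
  rw [G.isRealValued_iff, reflC_eq_iff_of_mul (G.mult_ne_zero hL K hG hμ) (fun p => ?_) (hT α),
    ← G.isRealValued_iff, E.isRealValued_iff, E.iso.symm_apply_apply, reflC_eq_iff_of_mul
      (fun n => div_ne_zero (mul_ne_zero (mul_ne_zero (by norm_num) (tanh_ne_zero hL hμ))
        (E.t_ne_zero hL K n)) (E.moment_ne_zero hE n)) (fun n => ?_) (hX α), ← E.isRealValued_iff]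
  · rw [hb, E.t_neg hL]
    simp only [map_div₀, map_mul, map_neg, map_ofNat, Complex.conj_ofReal, E.t_conj hL]
  · rw [TargetFamily.mult, TargetFamily.mult, hb', G.c_neg, G.u_neg hL]
    simp only [map_div₀, map_mul, map_neg, map_sub, map_one, Complex.conj_ofReal]

end transformation


/-! ### Generation, stability and spectral properties in the closed loop -/

section conclusion
variable {L γ μ : ℝ}

/-- The smallness conditions on `γ`. -/
lemma exists_smallness (hL : 0 < L) (hμ : 0 < μ) : ∃ γ₀ > 0, ∀ γ, 0 < γ → γ < γ₀ →
    γ * L ≤ 1 / 4000 ∧ 5 * (γ * L) ≤ Real.exp (-2 * μ * L) / 2 ∧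
    5 * (γ * L) ≤ Real.exp (-(3 / 2 * μ * L)) - Real.exp (-2 * μ * L) ∧
    200 * (γ * L) ≤ √(Real.exp (-2 * μ * L)) * (1 - √(Real.exp (-2 * μ * L))) ^ 2 := by
  have hκ := Real.exp_pos (-2 * μ * L)
  have h1 : 0 < Real.exp (-(3 / 2 * μ * L)) - Real.exp (-2 * μ * L) := by
    rw [sub_pos, Real.exp_lt_exp]
    nlinarith [mul_pos hμ hL]
  have h2 : 0 < 1 - √(Real.exp (-2 * μ * L)) := by
    rw [sub_pos, Real.sqrt_lt' one_pos, one_pow]; exact kappa_lt_one hL hμ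
  set a := Real.exp (-2 * μ * L)
  set b := Real.exp (-(3 / 2 * μ * L)) - a
  have h3 : 0 < √a * (1 - √a) ^ 2 := by positivity
  set d := √a * (1 - √a) ^ 2
  have h : ∀ m > 0, ∀ᶠ γ in 𝓝 (0 : ℝ), γ * L < m := fun m hm =>
    (by fun_prop : Continuous fun γ : ℝ => γ * L).tendsto' 0 0 (by simp) |>.eventually_lt_const hm
  obtain ⟨ε, hε, H⟩ := Metric.eventually_nhds_iff.1
    ((h (1 / 4000) (by norm_num)).and ((h (a / 10) (by positivity)).and
      ((h (b / 5) (by positivity)).and (h (d / 200) (by positivity)))))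
  refine ⟨ε, hε, fun γ h0 hlt => ?_⟩
  obtain ⟨a1, a2, a3, a4⟩ := H (y := γ) (by rwa [dist_zero_right, Real.norm_of_nonneg h0.le])
  exact ⟨a1.le, by linarith, by linarith, by linarith⟩

lemma exists_closedLoop (hL : 0 < L) (hμ : 0 < μ) (hγ : 0 < γ) (h1 : γ * L ≤ 1 / 4000)
    (h2 : 5 * (γ * L) ≤ Real.exp (-2 * μ * L) / 2)
    (h3 : 5 * (γ * L) ≤ Real.exp (-(3 / 2 * μ * L)) - Real.exp (-2 * μ * L))
    (h4 : 200 * (γ * L) ≤ √(Real.exp (-2 * μ * L)) * (1 - √(Real.exp (-2 * μ * L))) ^ 2)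
    (E : OpenLoopFamily L γ) (G : TargetFamily L γ μ) (ν : ℝ) (hν : 0 < ν) :
    ∃ (T : DomA L ≃L[ℂ] DomT L μ) (St : ℝ≥0 → DomT L μ →L[ℂ] DomT L μ),
      IsBackstepping E G ν T ∧ IsC0Semigroup St ∧ generatorGraph St = targetGraph L γ μ ∧
      IsC0Semigroup (conjSemigroup T St) ∧ IsExpStable (conjSemigroup T St) (3 * μ / 4) ∧
      generatorGraph (conjSemigroup T St) = closedLoopGraph E μ ν ∧
      domF E μ ν = T ⁻¹' DomT2 L γ μ ∧
      IsRieszBasis (fun p : ℤ => T.symm ((G.ev p)⁻¹ • G.f p)) ∧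
      (∀ p : ℤ, (T.symm ((G.ev p)⁻¹ • G.f p), (-G.ev p) • T.symm ((G.ev p)⁻¹ • G.f p))
        ∈ closedLoopGraph E μ ν) ∧
      ∀ (t : ℝ≥0) (α : DomA L), IsRealValued (toL2 α) →
        IsRealValued (toL2 (conjSemigroup T St t α)) := by
  have K := isSmallCoupling hL hγ h1
  obtain ⟨R, hR⟩ := G.re_bounds hL K hμ h2 h3
  obtain ⟨I, hI, hIbil, hIc⟩ := exists_profile K (toL2 (E.f 0)) ν
  specialize hIc (by rw [← E.conj_f, neg_zero])
  have hE : BddAway _ := E.moments hL K hν hIbil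
  have hG : BddAway _ := G.moments hL K hμ hR E h4 hν hIbil
  obtain ⟨X, T, hX, hT⟩ := exists_transformation hL K E G hE hG hμ hR
  obtain ⟨St, s1, s2, s3, s4⟩ := exists_targetSemigroup hL K G hμ hR
  obtain ⟨Ψ, hΨ, hΨ'⟩ := G.exists_domBasis hL K hμ hR
  have hgraph := closedLoopGraph_eq hL K E G hI hE hG hμ hX hT
  refine ⟨T, St, isBackstepping hL K E G hI hμ hR hX hT, s1, s2, s1.transport T, s3.transport T, ?_,
    ?_, ⟨Ψ.trans T.symm, fun p => ?_⟩, fun p => ?_, fun t α hα => ?_⟩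
  · rw [generatorGraph_conj, s2, hgraph]
  · ext α
    constructor
    · rintro ⟨β, hβ⟩
      rw [hgraph] at hβ
      refine ⟨-T β, ?_⟩
      have e : toL2 (-T β) = -toL2 (T β) := (toL2L L _).map_neg (T β)
      rw [e]
      filter_upwards [hβ, Lp.coeFn_neg (toL2 (T β))] with x a b
      rw [b, Pi.neg_apply, a, neg_neg]
    · rintro ⟨β, hβ⟩
      refine ⟨T.symm (-β), ?_⟩
      rw [hgraph]
      change (T α, T (T.symm (-β))) ∈ targetGraph L γ μ
      rw [T.apply_symm_apply]
      have e : toL2 (-β) = -toL2 β := (toL2L L _).map_neg β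
      change ∀ᵐ x ∂(mes L), toL2 (-β) x = -opA L γ (T α) x
      rw [e]
      filter_upwards [hβ, Lp.coeFn_neg (toL2 β)] with x a b
      rw [b, Pi.neg_apply, a]
  · exact congrArg T.symm (hΨ p)
  · rw [hgraph]
    change (T (T.symm ((G.ev p)⁻¹ • G.f p)), T ((-G.ev p) • T.symm ((G.ev p)⁻¹ • G.f p)))
      ∈ targetGraph L γ μ
    rw [map_smul T (-G.ev p), T.apply_symm_apply, mem_targetGraph_iff hL K G]
    intro q
    rw [← hΨ, hΨ', hΨ', map_smul, Ψ.symm_apply_apply, lp.coeFn_smul, Pi.smul_apply, sg_apply,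
      smul_eq_mul]
    split_ifs with h
    · rw [h]; ring
    · simp
  · have hreal := isRealValued_transformation_iff hL K E G hE hG hμ hX hT hIc
    rw [← hreal, conjSemigroup_apply, T.apply_symm_apply, G.isRealValued_iff,
      reflC_eq_iff_of_mul (fun p => Complex.exp_ne_zero _) (fun p => ?_) (s4 t (T α)),
      ← G.isRealValued_iff, hreal]
    · exact hα
    · rw [G.ev_conj, ← Complex.exp_conj, map_mul, map_neg, Complex.conj_ofReal]

end conclusion

end WaterTank

end

theorem mainTheorem10 (L : ℝ) (hL : 0 < L) (μ : ℝ) (hμ : 0 < μ) :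
    ∃ γ₀ : ℝ, 0 < γ₀ ∧ ∀ γ : ℝ, 0 < γ → γ < γ₀ →
      Nonempty (WaterTank.OpenLoopFamily L γ) ∧ Nonempty (WaterTank.TargetFamily L γ μ) ∧
      ∀ (E : WaterTank.OpenLoopFamily L γ) (G : WaterTank.TargetFamily L γ μ) (ν : ℝ), 0 < ν →
        ∃ (T : WaterTank.DomA L ≃L[ℂ] WaterTank.DomT L μ)
          (St : ℝ≥0 → WaterTank.DomT L μ →L[ℂ] WaterTank.DomT L μ),
          WaterTank.IsBackstepping E G ν T ∧
          WaterTank.IsC0Semigroup St ∧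
          WaterTank.generatorGraph St = WaterTank.targetGraph L γ μ ∧
          -- the closed-loop semigroup and its generator
          WaterTank.IsC0Semigroup (WaterTank.conjSemigroup T St) ∧
          WaterTank.IsExpStable (WaterTank.conjSemigroup T St) (3 * μ / 4) ∧
          WaterTank.generatorGraph (WaterTank.conjSemigroup T St)
            = WaterTank.closedLoopGraph E μ ν ∧
          -- the domain of the generator
          WaterTank.domF E μ ν = T ⁻¹' WaterTank.DomT2 L γ μ ∧
          -- the Riesz basis of eigenvectors
          WaterTank.IsRieszBasis (fun p : ℤ => T.symm ((G.ev p)⁻¹ • G.f p)) ∧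
          (∀ p : ℤ, (T.symm ((G.ev p)⁻¹ • G.f p), (-G.ev p) • T.symm ((G.ev p)⁻¹ • G.f p))
            ∈ WaterTank.closedLoopGraph E μ ν) ∧
          -- real-valued functions are preserved
          ∀ (t : ℝ≥0) (α : WaterTank.DomA L), WaterTank.IsRealValued (WaterTank.toL2 α) →
            WaterTank.IsRealValued (WaterTank.toL2 (WaterTank.conjSemigroup T St t α)) := by
  obtain ⟨γ₁, h₁, H₁⟩ := WaterTank.exists_families hL hμ.le
  obtain ⟨γ₂, h₂, H₂⟩ := WaterTank.exists_smallness hL hμ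
  refine ⟨min γ₁ γ₂, lt_min h₁ h₂, fun γ hγ hlt => ?_⟩
  obtain ⟨hE, hG⟩ := H₁ γ hγ (hlt.trans_le (min_le_left _ _))
  obtain ⟨a, b, c, d⟩ := H₂ γ hγ (hlt.trans_le (min_le_right _ _))
  exact ⟨hE, hG, WaterTank.exists_closedLoop hL hμ hγ a b c d⟩
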